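/- Let $G$ be an ample groupoid, i.e. a locally compact Hausdorff topological groupoid whose range and source maps $r,s\colon G\to G^{(0)}$ are local homeomorphisms and whose unit space $G^{(0)}$ is totally disconnected. Assume that $G^{(0)}$ is compact and that the orbit $G(x):=r(s^{-1}(x))$ has at least three points for every $x\in G^{(0)}$. Let $C^*(G)$ be the full groupoid $C^*$-algebra of $G$, i.e. the completion of the convolution $*$-algebra $C_c(G)$ in the norm $\|f\|=\sup_\rho\|\rho(f)\|$, where $\rho$ runs over the $*$-representations of $C_c(G)$ by bounded operators on Hilbert spaces. Let $[[G]]$ be the topological full group of $G$, i.e. the group, under $UV=\{gh : g\in U,\ h\in V,\ s(g)=r(h)\}$, of the compact open sets $U\subset G$ such that $r|_U$ and $s|_U$ are injective and $r(U)=s(U)=G^{(0)}$. Let $\pi\colon[[G]]\to C^*(G)$, $\pi(U):=1_U$, be the canonical unitary representation, and let $C^*_\pi([[G]])\subset C^*(G)$ be the $C^*$-algebra generated by $\pi([[G]])$. The following conditions are equivalent: (i) $C^*(G)$ admits no tracial state; (ii) $C^*_\pi([[G]])$ admits no character, i.e. no nonzero multiplicative linear functional; (iii) $\pi$ does not weakly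 contain the trivial representation, i.e. it is not the case that $\left|\sum_i\alpha_i\right|\le\left\|\sum_i\alpha_i\pi(U_i)\right\|$ for every $\sum_i\alpha_iU_i\in\mathbb{C}[[G]]$; (iv) $C^*_\pi([[G]])=C^*(G)$. -/

import Mathlib

universe u

/-- A topological groupoid, presented by its set of arrows `G`.  The product `g * h` is only
meaningful for composable pairs, that is, when `src g = rng h`; every axiom, and every notion defined
below, refers to the product of composable pairs only. -/
class TopologicalGroupoid (G : Type u) [TopologicalSpace G] extends Mul G, Inv G where
  /-- The source map, with values in the units (seen as arrows). -/
  src : G → G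
  /-- The range map, with values in the units (seen as arrows). -/
  rng : G → G
  src_src : ∀ g, src (src g) = src g
  rng_src : ∀ g, rng (src g) = src g
  src_mul : ∀ g h, src g = rng h → src (g * h) = src h
  rng_mul : ∀ g h, src g = rng h → rng (g * h) = rng g
  mul_assoc : ∀ g h k, src g = rng h → src h = rng k → g * h * k = g * (h * k)
  mul_src : ∀ g, g * src g = g
  rng_mul_self : ∀ g, rng g * g = g
  src_inv : ∀ g, src g⁻¹ = rng g
  rng_inv : ∀ g, rng g⁻¹ = src g
  inv_mul : ∀ g, g⁻¹ * g = src g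
  mul_inv : ∀ g, g * g⁻¹ = rng g
  continuousOn_mul : ContinuousOn (fun p : G × G => p.1 * p.2) {p | src p.1 = rng p.2}
  continuous_inv : Continuous (fun g : G => g⁻¹)

namespace TopologicalGroupoid

section Basic

variable {G : Type u} [TopologicalSpace G] [TopologicalGroupoid G]

theorem src_rng (g : G) : src (rng g) = rng g := by
  rw [← src_inv, src_src]

theorem rng_rng (g : G) : rng (rng g) = rng g := by
  rw [← src_inv g, rng_src]

theorem inv_mul_cancel_left (g h : G) (hc : src g = rng h) : g⁻¹ * (g * h) = h := by
  rw [← mul_assoc g⁻¹ g h (src_inv g) hc, inv_mul, hc, rng_mul_self]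

theorem mul_inv_cancel_left (g h : G) (hc : rng g = rng h) : g * (g⁻¹ * h) = h := by
  rw [← mul_assoc g g⁻¹ h (rng_inv g).symm (by rw [src_inv, hc]), mul_inv, hc, rng_mul_self]

theorem mul_inv_cancel_right (g h : G) (hc : src g = rng h) : g * h * h⁻¹ = g := by
  rw [mul_assoc g h h⁻¹ hc (rng_inv h).symm, mul_inv, ← hc, mul_src]

theorem inv_inv (g : G) : (g⁻¹)⁻¹ = g := by
  have h := mul_inv_cancel_left g⁻¹ (src g) (by rw [rng_inv, rng_src])
  have h2 : (g⁻¹)⁻¹ * src g = (g⁻¹)⁻¹ := by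
    have := mul_src (g⁻¹)⁻¹
    rwa [src_inv, rng_inv] at this
  have h3 := inv_mul_cancel_left g⁻¹ g (src_inv g)
  rwa [inv_mul, h2] at h3

theorem mul_inv_rev (g h : G) (hc : src g = rng h) : (g * h)⁻¹ = h⁻¹ * g⁻¹ := by
  have e1 : src h⁻¹ = rng g⁻¹ := by rw [src_inv, rng_inv, hc]
  have e2 : h⁻¹ * g⁻¹ * (g * h) = src h := by
    rw [mul_assoc h⁻¹ g⁻¹ (g * h) e1 (by rw [src_inv, rng_mul g h hc]),
      inv_mul_cancel_left g h hc, inv_mul]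
  have e3 : src (h⁻¹ * g⁻¹) = rng (g * h) := by rw [src_mul _ _ e1, src_inv, rng_mul g h hc]
  have e4 := mul_inv_cancel_right (h⁻¹ * g⁻¹) (g * h) e3
  rw [e2] at e4
  rw [← e4]
  have e5 := rng_mul_self (g * h)⁻¹
  rw [rng_inv, src_mul g h hc] at e5
  exact e5.symm

theorem src_eq_of_rng_eq {g : G} (h : rng g = g) : src g = g := by
  rw [← h, src_rng]

theorem rng_eq_of_src_eq {g : G} (h : src g = g) : rng g = g := by
  rw [← h, rng_src]

theorem inv_src (g : G) : (src g)⁻¹ = src g := by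
  have h := mul_src (src g)⁻¹
  rw [src_inv, rng_src, inv_mul, src_src] at h
  exact h.symm

theorem continuous_src : Continuous (src : G → G) := by
  have h : (src : G → G) = fun g => g⁻¹ * g := by
    funext g
    exact (inv_mul g).symm
  rw [h]
  exact continuousOn_mul.comp_continuous (continuous_inv.prodMk continuous_id) (fun g => src_inv g)

theorem continuous_rng : Continuous (rng : G → G) := by
  have h : (rng : G → G) = fun g => src g⁻¹ := by
    funext g
    exact (src_inv g).symm
  rw [h]
  exact continuous_src.comp continuous_inv

variable (G) in
/-- The unit space. -/
def units : Set G := Set.range src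

theorem mem_units_iff {g : G} : g ∈ units G ↔ src g = g := by
  constructor
  · rintro ⟨h, rfl⟩
    exact src_src h
  · intro h
    exact ⟨g, h⟩

theorem src_mem (g : G) : src g ∈ units G := ⟨g, rfl⟩

theorem rng_mem (g : G) : rng g ∈ units G := mem_units_iff.2 (src_rng g)

/-- The source map, as a map onto the unit space. -/
def srcUnit (g : G) : units G := ⟨src g, src_mem g⟩

/-- The range map, as a map onto the unit space. -/
def rngUnit (g : G) : units G := ⟨rng g, rng_mem g⟩

/-- The orbit `r(s⁻¹(x))` of a point `x` of the unit space. -/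
def orbit (x : units G) : Set G := rng '' (src ⁻¹' {(x : G)})

variable (G) in
/-- Ample groupoids: locally compact, Hausdorff, étale, with totally disconnected unit space. -/
class IsAmple : Prop extends LocallyCompactSpace G, T2Space G where
  isLocalHomeomorph_src : IsLocalHomeomorph (srcUnit : G → units G)
  isLocalHomeomorph_rng : IsLocalHomeomorph (rngUnit : G → units G)
  totallyDisconnected : TotallyDisconnectedSpace (units G)

end Basic

section Ample

set_option linter.unusedSectionVars false

variable {G : Type u} [TopologicalSpace G] [TopologicalGroupoid G] [IsAmple G]

theorem isClosed_units : IsClosed (units G) := by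
  have : units G = {g | src g = g} := by
    ext g
    exact mem_units_iff
  rw [this]
  exact isClosed_eq continuous_src continuous_id

theorem isOpen_units : IsOpen (units G) := by
  rw [isOpen_iff_mem_nhds]
  intro x hx
  obtain ⟨U, hU, hinj⟩ := (IsAmple.isLocalHomeomorph_src (G := G)).isLocallyInjective x
  have hxx : src x = x := mem_units_iff.1 hx
  obtain ⟨hxU, hinj⟩ := hinj
  have h1 : src ⁻¹' U ∈ nhds x :=
    (hU.preimage continuous_src).mem_nhds (by simpa [hxx] using hxU)
  filter_upwards [h1, hU.mem_nhds hxU] with g hg hg2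
  exact mem_units_iff.2 (hinj hg hg2 (Subtype.ext (src_src g)))

/-- Compact open bisections: compact open sets on which `src` and `rng` are injective. -/
structure IsCompactOpenBisection (U : Set G) : Prop where
  isCompact : IsCompact U
  isOpen : IsOpen U
  injOn_src : Set.InjOn src U
  injOn_rng : Set.InjOn rng U

theorem IsCompactOpenBisection.isClopen {U : Set G} (h : IsCompactOpenBisection U) :
    IsClopen U :=
  ⟨h.isCompact.isClosed, h.isOpen⟩

theorem exists_isCompactOpenBisection [CompactSpace (units G)] (x : G) :
    ∃ V : Set G, IsCompactOpenBisection V ∧ x ∈ V := by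
  obtain ⟨e, hx, he⟩ := IsAmple.isLocalHomeomorph_src x
  obtain ⟨N, hN, hxN, hNinj⟩ := (IsAmple.isLocalHomeomorph_rng (G := G)).isLocallyInjective x
  have := IsAmple.totallyDisconnected (G := G)
  have hO : IsOpen (e '' (e.source ∩ N)) :=
    e.isOpen_image_of_subset_source (e.open_source.inter hN) Set.inter_subset_left
  obtain ⟨W, hW, hxW, hWsub⟩ := compact_exists_isClopen_in_isOpen hO ⟨x, ⟨hx, hxN⟩, rfl⟩
  have hWt : W ⊆ e.target := hWsub.trans (by
    rintro _ ⟨y, hy, rfl⟩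
    exact e.map_source hy.1)
  have hsub : e.symm '' W ⊆ e.source ∩ N := by
    rintro _ ⟨w, hw, rfl⟩
    obtain ⟨y, hy, rfl⟩ := hWsub hw
    rwa [e.left_inv hy.1]
  refine ⟨e.symm '' W, ⟨?_, ?_, ?_, ?_⟩, ⟨e x, hxW, e.left_inv hx⟩⟩
  · exact hW.isClosed.isCompact.image_of_continuousOn (e.continuousOn_symm.mono hWt)
  · exact e.symm.isOpen_image_of_subset_source hW.isOpen hWt
  · intro a ha b hb hab
    apply e.injOn (hsub ha).1 (hsub hb).1
    rw [← he]
    exact Subtype.ext hab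
  · intro a ha b hb hab
    exact hNinj (hsub ha).2 (hsub hb).2 (Subtype.ext hab)

theorem finite_fiber_rng {K : Set G} (hK : IsCompact K) (x : G) :
    {α | rng α = x ∧ α ∈ K}.Finite := by
  refine hK.induction_on (p := fun s => {α | rng α = x ∧ α ∈ s}.Finite) ?_ ?_ ?_ ?_
  · simp
  · intro s t hst ht
    exact ht.subset (fun α hα => ⟨hα.1, hst hα.2⟩)
  · intro s t hs ht
    refine (hs.union ht).subset ?_
    rintro α ⟨h1, h2 | h2⟩
    · exact Or.inl ⟨h1, h2⟩
    · exact Or.inr ⟨h1, h2⟩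
  · intro g _
    obtain ⟨N, hN, hgN, hinj⟩ := (IsAmple.isLocalHomeomorph_rng (G := G)).isLocallyInjective g
    refine ⟨N, mem_nhdsWithin_of_mem_nhds (hN.mem_nhds hgN), Set.Subsingleton.finite ?_⟩
    rintro a ⟨ha, haN⟩ b ⟨hb, hbN⟩
    exact hinj haN hbN (Subtype.ext (ha.trans hb.symm))

open Classical in
/-- If `U` is a bisection whose range contains `rng γ`, this is the arrow of `U` with the same
range as `γ`. -/
noncomputable def sec (U : Set G) (γ : G) : G :=
  if h : ∃ α ∈ U, rng α = rng γ then h.choose else γ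

theorem sec_mem {U : Set G} {γ : G} (h : ∃ α ∈ U, rng α = rng γ) : sec U γ ∈ U := by
  rw [sec, dif_pos h]
  exact h.choose_spec.1

theorem rng_sec {U : Set G} {γ : G} : rng (sec U γ) = rng γ := by
  by_cases h : ∃ α ∈ U, rng α = rng γ
  · rw [sec, dif_pos h]
    exact h.choose_spec.2
  · rw [sec, dif_neg h]

theorem sec_eq {U : Set G} (hU : Set.InjOn rng U) {α γ : G} (hα : α ∈ U) (h : rng α = rng γ) :
    sec U γ = α :=
  hU (sec_mem ⟨α, hα, h⟩) hα (rng_sec.trans h.symm)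

theorem isOpen_rngDom {U : Set G} (hU : IsOpen U) : IsOpen {γ : G | ∃ α ∈ U, rng α = rng γ} := by
  have h : {γ : G | ∃ α ∈ U, rng α = rng γ} = rngUnit ⁻¹' (rngUnit '' U) := by
    ext γ
    simp [rngUnit]
  rw [h]
  exact ((IsAmple.isLocalHomeomorph_rng (G := G)).isOpenMap U hU).preimage
    (IsAmple.isLocalHomeomorph_rng (G := G)).continuous

theorem isClosed_rngDom {U : Set G} (hU : IsCompact U) :
    IsClosed {γ : G | ∃ α ∈ U, rng α = rng γ} := by
  have h : {γ : G | ∃ α ∈ U, rng α = rng γ} = rng ⁻¹' (rng '' U) := by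
    ext γ
    simp
  rw [h]
  exact (hU.image continuous_rng).isClosed.preimage continuous_rng

theorem continuousOn_sec {U : Set G} (hU : IsOpen U) (hinj : Set.InjOn rng U) :
    ContinuousOn (sec U) {γ : G | ∃ α ∈ U, rng α = rng γ} := by
  intro γ hγ
  apply ContinuousAt.continuousWithinAt
  rw [ContinuousAt, Filter.tendsto_def]
  intro N hN
  obtain ⟨N', hN', hN'o, hmem⟩ := mem_nhds_iff.1 hN
  have h := isOpen_rngDom (hU.inter hN'o)
  have h2 := h.mem_nhds ⟨sec U γ, ⟨sec_mem hγ, hmem⟩, rng_sec⟩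
  filter_upwards [h2] with δ hδ
  obtain ⟨α, hα, hr⟩ := hδ
  rw [Set.mem_preimage, sec_eq hinj hα.1 hr]
  exact hN' hα.2

theorem continuousOn_sec_inv_mul {U : Set G} (hU : IsOpen U) (hinj : Set.InjOn rng U) :
    ContinuousOn (fun γ => (sec U γ)⁻¹ * γ) {γ : G | ∃ α ∈ U, rng α = rng γ} := by
  have h : ContinuousOn (fun γ : G => ((sec U γ)⁻¹, γ)) {γ : G | ∃ α ∈ U, rng α = rng γ} :=
    (continuous_inv.comp_continuousOn (continuousOn_sec hU hinj)).prodMk continuousOn_id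
  refine continuousOn_mul.comp h ?_
  intro γ _
  simp only [Set.mem_ofPred_eq]
  rw [src_inv, rng_sec]

/-- The convolution product `(f ⋆ g)(γ) = ∑_{αβ = γ} f(α) g(β)`. -/
noncomputable def conv (f g : G → ℂ) (γ : G) : ℂ :=
  ∑ᶠ (p : G × G) (_ : src p.1 = rng p.2 ∧ p.1 * p.2 = γ), f p.1 * g p.2

theorem conv_eq (f g : G → ℂ) (γ : G) :
    conv f g γ = ∑ᶠ (α : G) (_ : rng α = rng γ), f α * g (α⁻¹ * γ) := by
  refine finsum_mem_eq_of_bijOn (s := {p : G × G | src p.1 = rng p.2 ∧ p.1 * p.2 = γ})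
    (t := {α | rng α = rng γ}) (fun p => p.1) ⟨?_, ?_, ?_⟩ ?_
  · rintro ⟨a, b⟩ ⟨h1, h2⟩
    simp only [Set.mem_ofPred_eq] at h1 h2 ⊢
    rw [← h2, rng_mul a b h1]
  · rintro ⟨a, b⟩ ⟨h1, h2⟩ ⟨c, d⟩ ⟨h3, h4⟩ h5
    simp only at h1 h2 h3 h4 h5
    subst h5
    rw [← inv_mul_cancel_left a b h1, ← inv_mul_cancel_left a d h3, h2, h4]
  · intro α hα
    refine ⟨(α, α⁻¹ * γ), ⟨?_, ?_⟩, rfl⟩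
    · simp only
      rw [rng_mul _ _ (by rw [src_inv]; exact hα), rng_inv]
    · exact mul_inv_cancel_left α γ hα
  · rintro ⟨a, b⟩ ⟨h1, h2⟩
    simp only at h1 h2 ⊢
    rw [← h2, inv_mul_cancel_left a b h1]

theorem conv_of_bisection {U : Set G} (hU : Set.InjOn rng U) {f : G → ℂ}
    (hf : ∀ x, x ∉ U → f x = 0) (g : G → ℂ) (γ : G) :
    conv f g γ = f (sec U γ) * g ((sec U γ)⁻¹ * γ) := by
  classical
  rw [conv_eq, finsum_eq_single _ (sec U γ)]
  · rw [finsum_eq_if, if_pos rng_sec]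
  · intro α hα
    rw [finsum_eq_if]
    split_ifs with h
    · rw [hf α (fun hm => hα (sec_eq hU hm h).symm), zero_mul]
    · rfl

theorem finite_conv_support {f : G → ℂ} {K : Set G} (hK : IsCompact K)
    (hf : ∀ x, x ∉ K → f x = 0) (g : G → ℂ) (γ : G) :
    (Function.support fun α => ∑ᶠ (_ : rng α = rng γ), f α * g (α⁻¹ * γ)).Finite := by
  classical
  refine (finite_fiber_rng hK (rng γ)).subset ?_
  intro α hα
  rw [Function.mem_support, finsum_eq_if] at hα
  by_cases h : rng α = rng γ
  · refine ⟨h, ?_⟩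
    by_contra hK'
    rw [if_pos h, hf α hK', zero_mul] at hα
    exact hα rfl
  · rw [if_neg h] at hα
    exact absurd rfl hα

theorem conv_add_left {f₁ f₂ : G → ℂ} (g : G → ℂ) (h₁ : HasCompactSupport f₁)
    (h₂ : HasCompactSupport f₂) : conv (f₁ + f₂) g = conv f₁ g + conv f₂ g := by
  classical
  funext γ
  rw [Pi.add_apply, conv_eq, conv_eq, conv_eq, ← finsum_add_distrib
    (finite_conv_support h₁ (fun _ h => image_eq_zero_of_notMem_tsupport h) g γ)
    (finite_conv_support h₂ (fun _ h => image_eq_zero_of_notMem_tsupport h) g γ)]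
  refine finsum_congr fun α => ?_
  simp only [finsum_eq_if]
  split_ifs
  · simp [add_mul]
  · simp

theorem conv_add_right {f : G → ℂ} (g₁ g₂ : G → ℂ) (h : HasCompactSupport f) :
    conv f (g₁ + g₂) = conv f g₁ + conv f g₂ := by
  classical
  funext γ
  rw [Pi.add_apply, conv_eq, conv_eq, conv_eq, ← finsum_add_distrib
    (finite_conv_support h (fun _ h => image_eq_zero_of_notMem_tsupport h) g₁ γ)
    (finite_conv_support h (fun _ h => image_eq_zero_of_notMem_tsupport h) g₂ γ)]
  refine finsum_congr fun α => ?_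
  simp only [finsum_eq_if]
  split_ifs
  · simp [mul_add]
  · simp

theorem conv_smul_left (c : ℂ) (f g : G → ℂ) : conv (c • f) g = c • conv f g := by
  classical
  funext γ
  rw [Pi.smul_apply, conv_eq, conv_eq, smul_finsum]
  refine finsum_congr fun α => ?_
  simp only [finsum_eq_if]
  split_ifs
  · simp [_root_.mul_assoc]
  · simp

theorem conv_star (f g : G → ℂ) (γ : G) :
    starRingEnd ℂ (conv f g γ⁻¹) =
      conv (fun x => starRingEnd ℂ (g x⁻¹)) (fun x => starRingEnd ℂ (f x⁻¹)) γ := by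
  have h1 : starRingEnd ℂ (conv f g γ⁻¹) = ∑ᶠ (p : G × G)
      (_ : src p.1 = rng p.2 ∧ p.1 * p.2 = γ⁻¹), starRingEnd ℂ (f p.1 * g p.2) := by
    change (starRingAut : RingAut ℂ) (conv f g γ⁻¹) = _
    rw [conv]
    rw [← RingEquiv.coe_toAddEquiv, AddEquiv.map_finsum]
    refine finsum_congr fun p => ?_
    rw [AddEquiv.map_finsum]
    rfl
  rw [h1, conv]
  refine finsum_mem_eq_of_bijOn (s := {p : G × G | src p.1 = rng p.2 ∧ p.1 * p.2 = γ⁻¹})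
    (t := {p : G × G | src p.1 = rng p.2 ∧ p.1 * p.2 = γ}) (fun p => (p.2⁻¹, p.1⁻¹))
    ⟨?_, ?_, ?_⟩ ?_
  · rintro ⟨a, b⟩ ⟨h1, h2⟩
    simp only [Set.mem_ofPred_eq] at h1 h2 ⊢
    refine ⟨by rw [src_inv, rng_inv, h1], ?_⟩
    rw [← mul_inv_rev a b h1, h2, inv_inv]
  · rintro ⟨a, b⟩ _ ⟨c, d⟩ _ h
    simp only [Prod.mk.injEq] at h
    rw [← inv_inv a, ← inv_inv b, h.1, h.2, inv_inv, inv_inv]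
  · rintro ⟨a, b⟩ ⟨h1, h2⟩
    simp only at h1 h2
    refine ⟨(b⁻¹, a⁻¹), ⟨?_, ?_⟩, ?_⟩
    · simp only
      rw [src_inv, rng_inv, h1]
    · simp only
      rw [← mul_inv_rev a b h1, h2]
    · simp only
      rw [inv_inv, inv_inv]
  · rintro ⟨a, b⟩ _
    simp only [inv_inv, map_mul]
    rw [mul_comm]

theorem conv_hasCompactSupport {f g : G → ℂ} (hf : HasCompactSupport f)
    (hg : HasCompactSupport g) : HasCompactSupport (conv f g) := by
  have hcl : IsClosed {p : G × G | src p.1 = rng p.2} :=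
    isClosed_eq (continuous_src.comp continuous_fst) (continuous_rng.comp continuous_snd)
  have hK : IsCompact ((fun p : G × G => p.1 * p.2) ''
      ((tsupport f ×ˢ tsupport g) ∩ {p : G × G | src p.1 = rng p.2})) :=
    ((hf.isCompact.prod hg.isCompact).inter_right hcl).image_of_continuousOn
      (continuousOn_mul.mono Set.inter_subset_right)
  classical
  refine HasCompactSupport.intro hK ?_
  intro γ hγ
  rw [conv]
  refine finsum_eq_zero_of_forall_eq_zero fun p => ?_
  rw [finsum_eq_if]
  split_ifs with h
  · by_contra hne
    refine hγ ⟨p, ⟨⟨?_, ?_⟩, h.1⟩, h.2⟩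
    · by_contra hp
      exact hne (by rw [image_eq_zero_of_notMem_tsupport hp, zero_mul])
    · by_contra hp
      exact hne (by rw [image_eq_zero_of_notMem_tsupport hp, mul_zero])
  · rfl

theorem conv_continuous_of_bisection {U : Set G} (hU : IsCompactOpenBisection U) {f g : G → ℂ}
    (hf : ∀ x, x ∉ U → f x = 0) (hfc : Continuous f) (hg : Continuous g) :
    Continuous (conv f g) := by
  have hD : IsOpen {γ : G | ∃ α ∈ U, rng α = rng γ} := isOpen_rngDom hU.isOpen
  have hC : IsClosed {γ : G | ∃ α ∈ U, rng α = rng γ} := isClosed_rngDom hU.isCompact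
  rw [continuous_iff_continuousAt]
  intro γ
  by_cases hγ : ∃ α ∈ U, rng α = rng γ
  · have h1 : ContinuousOn (fun γ => f (sec U γ) * g ((sec U γ)⁻¹ * γ))
        {γ : G | ∃ α ∈ U, rng α = rng γ} :=
      (hfc.comp_continuousOn (continuousOn_sec hU.isOpen hU.injOn_rng)).mul
        (hg.comp_continuousOn (continuousOn_sec_inv_mul hU.isOpen hU.injOn_rng))
    have h2 : conv f g = fun γ => f (sec U γ) * g ((sec U γ)⁻¹ * γ) := by
      funext γ
      exact conv_of_bisection hU.injOn_rng hf g γ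
    rw [h2]
    exact h1.continuousAt (hD.mem_nhds hγ)
  · have h3 : conv f g =ᶠ[nhds γ] fun _ => 0 := by
      filter_upwards [hC.isOpen_compl.mem_nhds hγ] with δ hδ
      rw [conv_of_bisection hU.injOn_rng hf g δ, hf _ (fun h => hδ ⟨_, h, rng_sec⟩), zero_mul]
    exact h3.continuousAt

end Ample


section Algebra

set_option linter.unusedSectionVars false

variable (G : Type u) [TopologicalSpace G] [TopologicalGroupoid G]

/-- The space `C_c(G)` of continuous compactly supported functions on `G`, which will carry the
convolution product (and not the pointwise one). -/
def ConvAlg : Type u := CompactlySupportedContinuousMap G ℂ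

namespace ConvAlg

noncomputable instance : AddCommGroup (ConvAlg G) :=
  inferInstanceAs (AddCommGroup (CompactlySupportedContinuousMap G ℂ))

noncomputable instance : Module ℂ (ConvAlg G) :=
  inferInstanceAs (Module ℂ (CompactlySupportedContinuousMap G ℂ))

instance : FunLike (ConvAlg G) G ℂ :=
  inferInstanceAs (FunLike (CompactlySupportedContinuousMap G ℂ) G ℂ)

variable {G}

theorem ext {f g : ConvAlg G} (h : ∀ x, f x = g x) : f = g :=
  DFunLike.ext f g h

theorem continuous (f : ConvAlg G) : Continuous f :=
  ContinuousMap.continuous (CompactlySupportedContinuousMap.toContinuousMap f)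

theorem hasCompactSupport (f : ConvAlg G) : HasCompactSupport f :=
  CompactlySupportedContinuousMap.hasCompactSupport' f

/-- Constructor of elements of `C_c(G)`. -/
def mk (f : G → ℂ) (hf : Continuous f) (hs : HasCompactSupport f) : ConvAlg G :=
  (⟨⟨f, hf⟩, hs⟩ : CompactlySupportedContinuousMap G ℂ)

@[simp]
theorem mk_apply (f : G → ℂ) (hf : Continuous f) (hs : HasCompactSupport f) (x : G) :
    mk f hf hs x = f x := rfl

@[simp]
theorem add_apply (f g : ConvAlg G) (x : G) : (f + g) x = f x + g x := rfl

@[simp]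
theorem zero_apply (x : G) : (0 : ConvAlg G) x = 0 := rfl

@[simp]
theorem smul_apply (c : ℂ) (f : ConvAlg G) (x : G) : (c • f) x = c * f x := rfl

theorem coe_add (f g : ConvAlg G) : ⇑(f + g) = ⇑f + ⇑g := rfl

theorem coe_smul (c : ℂ) (f : ConvAlg G) : ⇑(c • f) = c • ⇑f := rfl

/-- The product of a function in `C_c(G)` with the indicator function of a clopen set. -/
noncomputable def restrict (f : ConvAlg G) (V : Set G) (hV : IsClopen V) : ConvAlg G :=
  mk (V.indicator f) (f.continuous.indicator (fun x hx => by
    rw [hV.frontier_eq] at hx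
    exact absurd hx (Set.notMem_empty x)))
    (f.hasCompactSupport.mono (by
      intro x hx
      rw [Function.mem_support] at hx ⊢
      exact fun h => hx (by rw [Set.indicator_apply_eq_zero]; exact fun _ => h)))

variable [IsAmple G] [CompactSpace (units G)]

/-- Every function in `C_c(G)` is a finite sum of functions supported on compact open bisections. -/
theorem induction {P : ConvAlg G → Prop} (zero : P 0) (add : ∀ f g, P f → P g → P (f + g))
    (bisection : ∀ U, IsCompactOpenBisection U → ∀ f : ConvAlg G, (∀ x, x ∉ U → f x = 0) → P f)
    (f : ConvAlg G) : P f := by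
  classical
  have key : ∃ V : Set G, IsClopen V ∧ tsupport f ⊆ V ∧
      ∀ f : ConvAlg G, (∀ x, x ∉ V → f x = 0) → P f := by
    refine f.hasCompactSupport.isCompact.induction_on (p := fun s => ∃ V : Set G, IsClopen V ∧
      s ⊆ V ∧ ∀ f : ConvAlg G, (∀ x, x ∉ V → f x = 0) → P f) ?_ ?_ ?_ ?_
    · refine ⟨∅, isClopen_empty, subset_rfl, fun f hf => ?_⟩
      have : f = 0 := ext fun x => hf x (Set.notMem_empty x)
      rwa [this]
    · rintro s t hst ⟨V, hV, htV, h⟩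
      exact ⟨V, hV, hst.trans htV, h⟩
    · rintro s t ⟨V, hV, hsV, h⟩ ⟨W, hW, htW, h2⟩
      refine ⟨V ∪ W, hV.union hW, Set.union_subset_union hsV htW, fun f hf => ?_⟩
      have : f = f.restrict V hV + f.restrict (W \ V) (hW.diff hV) := by
        refine ext fun x => ?_
        simp only [restrict, add_apply, mk_apply, Set.indicator_apply, Set.mem_sdiff]
        by_cases h1 : x ∈ V
        · simp [h1]
        · by_cases h2 : x ∈ W
          · simp [h1, h2]
          · simp [h1, h2, hf x (fun h => h.elim h1 h2)]
      rw [this]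
      refine add _ _ (h _ fun x hx => ?_) (h2 _ fun x hx => ?_)
      · simp [restrict, hx]
      · simp [restrict, hx]
    · intro x _
      obtain ⟨V, hV, hx⟩ := exists_isCompactOpenBisection x
      exact ⟨V, mem_nhdsWithin_of_mem_nhds (hV.isOpen.mem_nhds hx), V, hV.isClopen, subset_rfl,
        bisection V hV⟩
  obtain ⟨V, _, hfV, h⟩ := key
  exact h f fun x hx => image_eq_zero_of_notMem_tsupport (fun h => hx (hfV h))

theorem continuous_conv (f g : ConvAlg G) : Continuous (conv f g) := by
  induction f using ConvAlg.induction with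
  | zero =>
    have : conv (0 : ConvAlg G) g = fun _ => 0 := by
      funext γ
      simp [conv]
    rw [this]
    exact continuous_const
  | add f₁ f₂ h₁ h₂ =>
    rw [coe_add, conv_add_left _ f₁.hasCompactSupport f₂.hasCompactSupport]
    exact h₁.add h₂
  | bisection U hU f hf => exact conv_continuous_of_bisection hU hf f.continuous g.continuous

noncomputable instance : Mul (ConvAlg G) where
  mul f g := mk (conv f g) (continuous_conv f g)
    (conv_hasCompactSupport f.hasCompactSupport g.hasCompactSupport)

theorem mul_apply (f g : ConvAlg G) (γ : G) : (f * g) γ = conv f g γ := rfl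

/-- The involution `f*(γ) = conj (f(γ⁻¹))`. -/
noncomputable instance : Star (ConvAlg G) where
  star f := mk (fun γ => starRingEnd ℂ (f γ⁻¹))
    (Complex.continuous_conj.comp (f.continuous.comp continuous_inv)) (by
      refine HasCompactSupport.intro (f.hasCompactSupport.isCompact.image continuous_inv) ?_
      intro x hx
      have h : f x⁻¹ = 0 := by
        by_contra hne
        exact hx ⟨x⁻¹, subset_tsupport _ hne, inv_inv x⟩
      rw [h, map_zero])

theorem star_apply (f : ConvAlg G) (γ : G) : (star f) γ = starRingEnd ℂ (f γ⁻¹) := rfl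

/-- The indicator function `1_U` of a compact open set. -/
noncomputable def ind (U : Set G) (hU : IsCompact U) (hO : IsOpen U) : ConvAlg G :=
  mk (U.indicator fun _ => 1) (continuous_const.indicator (fun x hx => by
    rw [(IsClopen.frontier_eq ⟨hU.isClosed, hO⟩)] at hx
    exact absurd hx (Set.notMem_empty x)))
    (HasCompactSupport.intro hU (fun _ hx => Set.indicator_of_notMem hx _))

theorem ind_apply (U : Set G) (hU : IsCompact U) (hO : IsOpen U) (x : G) :
    ind U hU hO x = U.indicator (fun _ => 1) x := rfl

/-- The unit of `C_c(G)` is the indicator function of the unit space. -/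
noncomputable instance : One (ConvAlg G) where
  one := ind (units G) (isCompact_iff_compactSpace.2 inferInstance) isOpen_units

theorem one_apply (x : G) : (1 : ConvAlg G) x = (units G).indicator (fun _ => 1) x := rfl

theorem mul_apply_of_bisection {U : Set G} (hU : IsCompactOpenBisection U) {f : ConvAlg G}
    (hf : ∀ x, x ∉ U → f x = 0) (g : ConvAlg G) (γ : G) :
    (f * g) γ = f (sec U γ) * g ((sec U γ)⁻¹ * γ) :=
  conv_of_bisection hU.injOn_rng hf g γ

theorem isCompactOpenBisection_units : IsCompactOpenBisection (units G) where
  isCompact := isCompact_iff_compactSpace.2 inferInstance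
  isOpen := isOpen_units
  injOn_src := by
    intro a ha b hb h
    rw [← mem_units_iff.1 ha, ← mem_units_iff.1 hb, h]
  injOn_rng := by
    intro a ha b hb h
    rw [← rng_eq_of_src_eq (mem_units_iff.1 ha), ← rng_eq_of_src_eq (mem_units_iff.1 hb), h]

theorem sec_units (γ : G) : sec (units G) γ = rng γ :=
  sec_eq isCompactOpenBisection_units.injOn_rng (rng_mem γ) (rng_rng γ)

/-- Left multiplication by a function supported on the unit space. -/
theorem mul_apply_of_units {f : ConvAlg G} (hf : ∀ x, x ∉ units G → f x = 0) (g : ConvAlg G)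
    (γ : G) : (f * g) γ = f (rng γ) * g γ := by
  rw [mul_apply_of_bisection isCompactOpenBisection_units hf, sec_units]
  have h : (rng γ)⁻¹ = rng γ := by rw [← src_inv γ, inv_src]
  rw [h, rng_mul_self]

protected theorem one_mul (f : ConvAlg G) : 1 * f = f := by
  refine ext fun γ => ?_
  rw [mul_apply_of_units (fun x hx => by rw [one_apply, Set.indicator_of_notMem hx]), one_apply,
    Set.indicator_of_mem (rng_mem γ), _root_.one_mul]

protected theorem star_star (f : ConvAlg G) : star (star f) = f := by
  refine ext fun γ => ?_
  rw [star_apply, star_apply, inv_inv, Complex.conj_conj]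

protected theorem star_mul (f g : ConvAlg G) : star (f * g) = star g * star f := by
  refine ext fun γ => ?_
  rw [star_apply, mul_apply, conv_star]
  rfl

protected theorem star_add (f g : ConvAlg G) : star (f + g) = star f + star g := by
  refine ext fun γ => ?_
  simp [star_apply]

protected theorem star_one : star (1 : ConvAlg G) = 1 := by
  have h := ConvAlg.one_mul (star (1 : ConvAlg G))
  have h2 := congrArg star h
  rw [ConvAlg.star_mul, ConvAlg.star_star, ConvAlg.one_mul] at h2
  exact h2

protected theorem mul_one (f : ConvAlg G) : f * 1 = f := by
  rw [← ConvAlg.star_star (f * 1), ConvAlg.star_mul, ConvAlg.star_one, ConvAlg.one_mul,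
    ConvAlg.star_star]

protected theorem add_mul (f g h : ConvAlg G) : (f + g) * h = f * h + g * h :=
  ext fun γ => congrFun (conv_add_left h f.hasCompactSupport g.hasCompactSupport) γ

protected theorem mul_add (f g h : ConvAlg G) : f * (g + h) = f * g + f * h :=
  ext fun γ => congrFun (conv_add_right g h f.hasCompactSupport) γ

protected theorem zero_mul (f : ConvAlg G) : 0 * f = 0 := by
  have h := ConvAlg.add_mul 0 0 f
  rw [add_zero] at h
  exact left_eq_add.1 h

protected theorem mul_zero (f : ConvAlg G) : f * 0 = 0 := by
  have h := ConvAlg.mul_add f 0 0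
  rw [add_zero] at h
  exact left_eq_add.1 h

protected theorem smul_mul (c : ℂ) (f g : ConvAlg G) : (c • f) * g = c • (f * g) :=
  ext fun γ => congrFun (conv_smul_left c f g) γ

protected theorem star_smul (c : ℂ) (f : ConvAlg G) : star (c • f) = star c • star f := by
  refine ext fun γ => ?_
  simp [star_apply]

protected theorem mul_smul (c : ℂ) (f g : ConvAlg G) : f * (c • g) = c • (f * g) := by
  rw [← ConvAlg.star_star (f * (c • g)), ConvAlg.star_mul, ConvAlg.star_smul, ConvAlg.smul_mul,
    ConvAlg.star_smul, ConvAlg.star_mul, ConvAlg.star_star, ConvAlg.star_star, star_star]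

protected theorem mul_assoc (f g h : ConvAlg G) : f * g * h = f * (g * h) := by
  induction f using ConvAlg.induction with
  | zero => rw [ConvAlg.zero_mul, ConvAlg.zero_mul, ConvAlg.zero_mul]
  | add f₁ f₂ h₁ h₂ => rw [ConvAlg.add_mul, ConvAlg.add_mul, ConvAlg.add_mul, h₁, h₂]
  | bisection U hU f hf =>
    refine ext fun γ => ?_
    rw [mul_apply_of_bisection hU hf, mul_apply, mul_apply, conv_eq, conv_eq, mul_finsum]
    set σ := sec U γ with hσ
    have hr : rng σ = rng γ := rng_sec
    have key : ∀ α, rng α = rng γ →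
        (f * g) α * h (α⁻¹ * γ) = f σ * (g (σ⁻¹ * α) * h ((σ⁻¹ * α)⁻¹ * (σ⁻¹ * γ))) := by
      intro α hα
      have h1 : src σ⁻¹ = rng α := by rw [src_inv, hr, hα]
      have h2 : src σ⁻¹ = rng γ := by rw [src_inv, hr]
      by_cases hm : σ ∈ U
      swap
      · have h4 : sec U α ∉ U := fun h5 => hm (sec_mem ⟨_, h5, rng_sec.trans hα⟩)
        rw [mul_apply_of_bisection hU hf, hf _ hm, hf _ h4]
        simp only [MulZeroClass.zero_mul]
      have h3 : sec U α = σ := sec_eq hU.injOn_rng hm (by rw [hr, hα])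
      rw [mul_apply_of_bisection hU hf, h3, _root_.mul_assoc, mul_inv_rev _ _ h1, inv_inv,
        TopologicalGroupoid.mul_assoc α⁻¹ σ (σ⁻¹ * γ) (by rw [src_inv, hr, hα])
          (by rw [rng_mul _ _ h2, rng_inv]), mul_inv_cancel_left σ γ hr]
    have e : ∀ β : G, f σ * ∑ᶠ (_ : rng β = rng (σ⁻¹ * γ)), g β * h (β⁻¹ * (σ⁻¹ * γ)) =
        ∑ᶠ (_ : rng β = rng (σ⁻¹ * γ)), f σ * (g β * h (β⁻¹ * (σ⁻¹ * γ))) := fun β => by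
      classical
      rw [finsum_eq_if, finsum_eq_if, mul_ite, MulZeroClass.mul_zero]
    simp only [e]
    refine finsum_mem_eq_of_bijOn (s := {α | rng α = rng γ})
      (t := {β | rng β = rng (σ⁻¹ * γ)}) (fun α => σ⁻¹ * α) ⟨?_, ?_, ?_⟩ key
    · intro α hα
      have hα' : rng α = rng γ := hα
      change rng (σ⁻¹ * α) = rng (σ⁻¹ * γ)
      rw [rng_mul _ _ (by rw [src_inv, hr, hα']), rng_mul _ _ (by rw [src_inv, hr])]
    · intro α hα β hβ hab
      have hα' : rng α = rng γ := hα
      have hβ' : rng β = rng γ := hβ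
      rw [← mul_inv_cancel_left σ α (hr.trans hα'.symm), ← mul_inv_cancel_left σ β (hr.trans hβ'.symm)]
      exact congrArg _ hab
    · intro β hβ
      have hβ' : rng β = rng (σ⁻¹ * γ) := hβ
      rw [rng_mul _ _ (by rw [src_inv, hr]), rng_inv] at hβ'
      exact ⟨σ * β, (rng_mul _ _ hβ'.symm).trans hr, inv_mul_cancel_left σ β hβ'.symm⟩

noncomputable instance : Ring (ConvAlg G) where
  __ := (inferInstance : AddCommGroup (ConvAlg G))
  left_distrib := ConvAlg.mul_add
  right_distrib := ConvAlg.add_mul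
  zero_mul := ConvAlg.zero_mul
  mul_zero := ConvAlg.mul_zero
  mul_assoc := ConvAlg.mul_assoc
  one_mul := ConvAlg.one_mul
  mul_one := ConvAlg.mul_one

noncomputable instance : Algebra ℂ (ConvAlg G) :=
  Algebra.ofModule ConvAlg.smul_mul (fun c f g => ConvAlg.mul_smul c f g)

noncomputable instance : StarRing (ConvAlg G) where
  star_involutive := ConvAlg.star_star
  star_mul := ConvAlg.star_mul
  star_add := ConvAlg.star_add

instance : StarModule ℂ (ConvAlg G) where
  star_smul := ConvAlg.star_smul

end ConvAlg

end Algebra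


section FullCStar

set_option linter.unusedSectionVars false

variable (G : Type u) [TopologicalSpace G] [TopologicalGroupoid G] [IsAmple G]
  [CompactSpace (units G)]

/-- A `*`-representation of `C_c(G)` by bounded operators on a complex Hilbert space.  (Every cyclic
representation of `C_c(G)` is equivalent to one on a Hilbert space in the universe of `G`, so that
restricting the universe does not change the supremum of the norms.) -/
structure HilbertRep : Type (u + 1) where
  H : Type u
  [normed : NormedAddCommGroup H]
  [inner : InnerProductSpace ℂ H]
  [complete : CompleteSpace H]
  toHom : ConvAlg G →⋆ₙₐ[ℂ] (H →L[ℂ] H)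

attribute [instance] HilbertRep.normed HilbertRep.inner HilbertRep.complete

variable {G}

/-- The full norm `‖f‖ = sup ‖π(f)‖`, over all `*`-representations of `C_c(G)`. -/
noncomputable def fullNorm (f : ConvAlg G) : ℝ := ⨆ π : HilbertRep G, ‖π.toHom f‖

/-- The zero representation. -/
noncomputable def HilbertRep.zero : HilbertRep G where
  H := PUnit
  toHom := 0

instance : Nonempty (HilbertRep G) := ⟨HilbertRep.zero⟩

open Classical in
/-- Extension by zero, as a function. -/
noncomputable def extendFun (k : C(units G, ℂ)) (γ : G) : ℂ :=
  if h : γ ∈ units G then k ⟨γ, h⟩ else 0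

theorem continuous_extendFun (k : C(units G, ℂ)) : Continuous (extendFun k) := by
  rw [continuous_iff_continuousAt]
  intro γ
  by_cases h : γ ∈ units G
  · have h1 : ContinuousOn (extendFun k) (units G) := by
      rw [continuousOn_iff_continuous_domRestrict]
      have : (units G).domRestrict (extendFun k) = k := by
        funext x
        simp [extendFun]
      rw [this]
      exact k.continuous
    exact h1.continuousAt (isOpen_units.mem_nhds h)
  · have h3 : extendFun k =ᶠ[nhds γ] fun _ => 0 := by
      filter_upwards [isClosed_units.isOpen_compl.mem_nhds h] with δ hδ
      exact dif_neg hδ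
    exact h3.continuousAt

/-- The inclusion of `C(G⁰)` in `C_c(G)`, by extension by zero. -/
noncomputable def extend (k : C(units G, ℂ)) : ConvAlg G :=
  ConvAlg.mk (extendFun k) (continuous_extendFun k)
    (HasCompactSupport.intro (isCompact_iff_compactSpace.2 inferInstance)
      (fun _ hx => dif_neg hx))

theorem extend_apply_of_mem (k : C(units G, ℂ)) {γ : G} (h : γ ∈ units G) :
    extend k γ = k ⟨γ, h⟩ := dif_pos h

theorem extend_apply_of_notMem (k : C(units G, ℂ)) {γ : G} (h : γ ∉ units G) :
    extend k γ = 0 := dif_neg h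

variable (G) in
/-- The inclusion of `C(G⁰)` in `C_c(G)`, as a `*`-homomorphism. -/
noncomputable def extendHom : C(units G, ℂ) →⋆ₙₐ[ℂ] ConvAlg G where
  toFun := extend
  map_smul' c k := by
    refine ConvAlg.ext fun γ => ?_
    by_cases h : γ ∈ units G
    · simp [extend_apply_of_mem _ h]
    · simp [extend_apply_of_notMem _ h]
  map_zero' := by
    refine ConvAlg.ext fun γ => ?_
    by_cases h : γ ∈ units G
    · simp [extend_apply_of_mem _ h]
    · simp [extend_apply_of_notMem _ h]
  map_add' k l := by
    refine ConvAlg.ext fun γ => ?_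
    by_cases h : γ ∈ units G
    · simp [extend_apply_of_mem _ h]
    · simp [extend_apply_of_notMem _ h]
  map_mul' k l := by
    refine ConvAlg.ext fun γ => ?_
    rw [ConvAlg.mul_apply_of_units (fun x hx => extend_apply_of_notMem k hx)]
    by_cases h : γ ∈ units G
    · have h2 : rng γ = γ := rng_eq_of_src_eq (mem_units_iff.1 h)
      simp [extend_apply_of_mem _ h, h2]
    · simp [extend_apply_of_notMem _ h]
  map_star' k := by
    refine ConvAlg.ext fun γ => ?_
    rw [ConvAlg.star_apply]
    by_cases h : γ ∈ units G
    · have h2 : γ⁻¹ = γ := by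
        have := inv_src γ
        rwa [mem_units_iff.1 h] at this
      rw [h2]
      simp [extend_apply_of_mem _ h]
    · have h2 : γ⁻¹ ∉ units G := by
        intro h3
        have := inv_src γ⁻¹
        rw [mem_units_iff.1 h3, inv_inv] at this
        exact h (this ▸ h3)
      simp [extend_apply_of_notMem _ h, extend_apply_of_notMem _ h2]

theorem exists_star_mul_self_eq {U : Set G} (hU : IsCompactOpenBisection U) {f : ConvAlg G}
    (hf : ∀ x, x ∉ U → f x = 0) : ∃ k : C(units G, ℂ), star f * f = extendHom G k := by
  refine ⟨⟨fun x => (star f * f) x, (star f * f).continuous.comp continuous_subtype_val⟩, ?_⟩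
  refine ConvAlg.ext fun γ => ?_
  change _ = extend _ γ
  by_cases h : γ ∈ units G
  · rw [extend_apply_of_mem _ h]
    rfl
  · rw [extend_apply_of_notMem _ h, ConvAlg.mul_apply, conv_eq]
    refine finsum_eq_zero_of_forall_eq_zero fun α => ?_
    classical
    rw [finsum_eq_if, ConvAlg.star_apply]
    split_ifs with hα
    swap
    · rfl
    by_contra hne
    have h1 : α⁻¹ ∈ U := by
      by_contra hn
      rw [hf _ hn] at hne
      simp at hne
    have h2 : α⁻¹ * γ ∈ U := by
      by_contra hn
      rw [hf _ hn] at hne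
      simp at hne
    have h3 : src α⁻¹ = rng γ := by rw [src_inv, hα]
    have h4 : α⁻¹ * γ = α⁻¹ := hU.injOn_rng h2 h1 (rng_mul _ _ h3)
    have h5 : γ = rng α := by
      have h6 := mul_inv_cancel_left α γ hα
      rw [← h6, h4, TopologicalGroupoid.mul_inv]
    exact h (h5 ▸ rng_mem α)

theorem exists_norm_le (f : ConvAlg G) : ∃ C : ℝ, ∀ π : HilbertRep G, ‖π.toHom f‖ ≤ C := by
  induction f using ConvAlg.induction with
  | zero => exact ⟨0, fun π => by simp⟩
  | add f g hf hg =>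
    obtain ⟨C, hC⟩ := hf
    obtain ⟨D, hD⟩ := hg
    refine ⟨C + D, fun π => ?_⟩
    rw [map_add]
    exact (norm_add_le _ _).trans (add_le_add (hC π) (hD π))
  | bisection U hU f hf =>
    obtain ⟨k, hk⟩ := exists_star_mul_self_eq hU hf
    refine ⟨Real.sqrt ‖k‖, fun π => Real.le_sqrt_of_sq_le ?_⟩
    rw [sq, ← CStarRing.norm_star_mul_self, ← map_star, ← map_mul, hk]
    exact NonUnitalStarAlgHom.norm_apply_le (π.toHom.comp (extendHom G)) k

theorem bddAbove_norm (f : ConvAlg G) :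
    BddAbove (Set.range fun π : HilbertRep G => ‖π.toHom f‖) := by
  obtain ⟨C, hC⟩ := exists_norm_le f
  exact ⟨C, by rintro _ ⟨π, rfl⟩; exact hC π⟩

theorem norm_le_fullNorm (π : HilbertRep G) (f : ConvAlg G) : ‖π.toHom f‖ ≤ fullNorm f :=
  le_ciSup (bddAbove_norm f) π

theorem fullNorm_nonneg (f : ConvAlg G) : 0 ≤ fullNorm f :=
  Real.iSup_nonneg fun _ => norm_nonneg _

theorem fullNorm_star_mul_self (f : ConvAlg G) :
    fullNorm (star f * f) = fullNorm f * fullNorm f := by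
  apply le_antisymm
  · refine ciSup_le fun π => ?_
    rw [map_mul, map_star, CStarRing.norm_star_mul_self]
    exact mul_self_le_mul_self (norm_nonneg _) (norm_le_fullNorm π f)
  · have h : fullNorm f ≤ Real.sqrt (fullNorm (star f * f)) := by
      refine ciSup_le fun π => Real.le_sqrt_of_sq_le ?_
      rw [sq, ← CStarRing.norm_star_mul_self, ← map_star, ← map_mul]
      exact norm_le_fullNorm π _
    exact (mul_self_le_mul_self (fullNorm_nonneg f) h).trans_eq
      (Real.mul_self_sqrt (fullNorm_nonneg _))

variable (G) in
/-- The full norm as a ring seminorm. -/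
noncomputable def fullSeminorm : RingSeminorm (ConvAlg G) where
  toFun := fullNorm
  map_zero' := by simp [fullNorm]
  add_le' f g := by
    refine ciSup_le fun π => ?_
    rw [map_add]
    exact (norm_add_le _ _).trans (add_le_add (norm_le_fullNorm π f) (norm_le_fullNorm π g))
  neg' f := by simp [fullNorm]
  mul_le' f g := by
    refine ciSup_le fun π => ?_
    rw [map_mul]
    exact (norm_mul_le _ _).trans (mul_le_mul (norm_le_fullNorm π f) (norm_le_fullNorm π g)
      (norm_nonneg _) (fullNorm_nonneg f))

noncomputable instance : SeminormedRing (ConvAlg G) :=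
  (fullSeminorm G).toSeminormedRing

theorem ConvAlg.norm_def (f : ConvAlg G) : ‖f‖ = fullNorm f := rfl

noncomputable instance : NormedAlgebra ℂ (ConvAlg G) where
  norm_smul_le c f := by
    rw [ConvAlg.norm_def, ConvAlg.norm_def]
    refine ciSup_le fun π => ?_
    rw [map_smul, norm_smul]
    exact mul_le_mul_of_nonneg_left (norm_le_fullNorm π f) (norm_nonneg c)

theorem ConvAlg.norm_star (f : ConvAlg G) : ‖star f‖ = ‖f‖ := by
  rw [ConvAlg.norm_def, ConvAlg.norm_def]
  refine iSup_congr fun π => ?_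
  rw [map_star, _root_.norm_star]

theorem ConvAlg.isometry_star : Isometry (star : ConvAlg G → ConvAlg G) := by
  refine Isometry.of_dist_eq fun f g => ?_
  rw [dist_eq_norm, dist_eq_norm, ← star_sub, ConvAlg.norm_star]

variable (G) in
/-- The full C*-algebra `C*(G)`: the (Hausdorff) completion of `C_c(G)` in the full norm. -/
def FullCStar : Type u := UniformSpace.Completion (ConvAlg G)

namespace FullCStar

open UniformSpace

noncomputable instance : NormedRing (FullCStar G) :=
  inferInstanceAs (NormedRing (Completion (ConvAlg G)))

noncomputable instance : NormedAlgebra ℂ (FullCStar G) :=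
  { (inferInstance : Algebra ℂ (Completion (ConvAlg G))) with
    norm_smul_le := fun c x => norm_smul_le (β := Completion (ConvAlg G)) c x }

instance : CompleteSpace (FullCStar G) :=
  inferInstanceAs (CompleteSpace (Completion (ConvAlg G)))

variable (G) in
/-- The canonical map from `C_c(G)` to `C*(G)`, as a map of algebras. -/
noncomputable def ofAlgHom : ConvAlg G →ₐ[ℂ] FullCStar G where
  toFun f := (f : Completion (ConvAlg G))
  map_one' := Completion.coe_one _
  map_mul' f g := Completion.coe_mul f g
  map_zero' := Completion.coe_zero
  map_add' f g := Completion.coe_add f g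
  commutes' _ := rfl

theorem norm_ofAlgHom (f : ConvAlg G) : ‖ofAlgHom G f‖ = ‖f‖ := Completion.norm_coe f

theorem isometry_ofAlgHom : Isometry (ofAlgHom G) := Completion.coe_isometry

theorem denseRange_ofAlgHom : DenseRange (ofAlgHom G) := Completion.denseRange_coe

/-- The involution of `C*(G)`, extended by continuity from `C_c(G)`. -/
noncomputable instance : Star (FullCStar G) where
  star := Completion.map (star : ConvAlg G → ConvAlg G)

theorem continuous_star : Continuous (star : FullCStar G → FullCStar G) :=
  Completion.continuous_map

theorem star_ofAlgHom (f : ConvAlg G) : star (ofAlgHom G f) = ofAlgHom G (star f) :=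
  Completion.map_coe ConvAlg.isometry_star.uniformContinuous f

noncomputable instance : StarRing (FullCStar G) where
  star_involutive x := by
    refine denseRange_ofAlgHom.induction_on (p := fun x => star (star x) = x) x
      (isClosed_eq (continuous_star.comp continuous_star) continuous_id) fun f => ?_
    rw [star_ofAlgHom, star_ofAlgHom, star_star]
  star_mul x y := by
    refine denseRange_ofAlgHom.induction_on₂ (p := fun x y => star (x * y) = star y * star x)
      (isClosed_eq (continuous_star.comp continuous_mul)
        ((continuous_star.comp continuous_snd).mul (continuous_star.comp continuous_fst)))
      (fun f g => ?_) x y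
    rw [← map_mul, star_ofAlgHom, star_ofAlgHom, star_ofAlgHom, star_mul, map_mul]
  star_add x y := by
    refine denseRange_ofAlgHom.induction_on₂ (p := fun x y => star (x + y) = star x + star y)
      (isClosed_eq (continuous_star.comp continuous_add)
        ((continuous_star.comp continuous_fst).add (continuous_star.comp continuous_snd)))
      (fun f g => ?_) x y
    rw [← map_add, star_ofAlgHom, star_ofAlgHom, star_ofAlgHom, star_add, map_add]

noncomputable instance : CStarAlgebra (FullCStar G) where
  norm_mul_self_le x := by
    refine denseRange_ofAlgHom.induction_on (p := fun x => ‖x‖ * ‖x‖ ≤ ‖star x * x‖) x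
      (isClosed_le (continuous_norm.mul continuous_norm)
        (continuous_norm.comp (continuous_star.mul continuous_id))) fun f => ?_
    rw [star_ofAlgHom, ← map_mul, norm_ofAlgHom, norm_ofAlgHom, ConvAlg.norm_def,
      ConvAlg.norm_def, fullNorm_star_mul_self]
  star_smul c x := by
    refine denseRange_ofAlgHom.induction_on (p := fun x => star (c • x) = star c • star x) x
      (isClosed_eq (continuous_star.comp (continuous_const_smul c))
        (continuous_star.const_smul (star c))) fun f => ?_
    rw [← map_smul, star_ofAlgHom, star_ofAlgHom, star_smul, map_smul]

variable (G) in
/-- The canonical `*`-homomorphism from `C_c(G)` to `C*(G)`. -/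
noncomputable def of : ConvAlg G →⋆ₐ[ℂ] FullCStar G where
  __ := ofAlgHom G
  map_star' f := (star_ofAlgHom f).symm

end FullCStar

end FullCStar

section FullGroup

set_option linter.unusedSectionVars false

variable {G : Type u} [TopologicalSpace G] [TopologicalGroupoid G] [IsAmple G]

variable (G) in
/-- The topological full group `[[G]]`: the compact open bisections `U` with
`s(U) = r(U) = G⁰`. -/
structure TopFullGroup where
  carrier : Set G
  isBisection : IsCompactOpenBisection carrier
  src_image : src '' carrier = units G
  rng_image : rng '' carrier = units G

namespace TopFullGroup

theorem ext {U V : TopFullGroup G} (h : U.carrier = V.carrier) : U = V := by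
  cases U
  cases V
  cases h
  rfl

theorem exists_rng (U : TopFullGroup G) (γ : G) : ∃ α ∈ U.carrier, rng α = rng γ := by
  have h := rng_mem γ
  rwa [← U.rng_image] at h

theorem exists_src (U : TopFullGroup G) (γ : G) : ∃ α ∈ U.carrier, src α = rng γ := by
  have h := rng_mem γ
  rwa [← U.src_image] at h

variable [CompactSpace (units G)]

/-- The product `UV = {gh | g ∈ U, h ∈ V, s(g) = r(h)}`. -/
instance : Mul (TopFullGroup G) where
  mul U V :=
    { carrier := {γ | ∃ g ∈ U.carrier, ∃ h ∈ V.carrier, src g = rng h ∧ g * h = γ}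
      isBisection :=
        { isCompact := by
            have hcl : IsClosed {p : G × G | src p.1 = rng p.2} :=
              isClosed_eq (continuous_src.comp continuous_fst) (continuous_rng.comp continuous_snd)
            have hK : IsCompact ((fun p : G × G => p.1 * p.2) ''
                ((U.carrier ×ˢ V.carrier) ∩ {p : G × G | src p.1 = rng p.2})) :=
              ((U.isBisection.isCompact.prod V.isBisection.isCompact).inter_right
                hcl).image_of_continuousOn (continuousOn_mul.mono Set.inter_subset_right)
            convert hK using 1
            ext γ
            constructor
            · rintro ⟨g, hg, h, hh, hc, rfl⟩
              exact ⟨(g, h), ⟨⟨hg, hh⟩, hc⟩, rfl⟩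
            · rintro ⟨⟨g, h⟩, ⟨⟨hg, hh⟩, hc⟩, rfl⟩
              exact ⟨g, hg, h, hh, hc, rfl⟩
          isOpen := by
            have hc := continuousOn_sec_inv_mul U.isBisection.isOpen U.isBisection.injOn_rng
            have hu : {γ : G | ∃ α ∈ U.carrier, rng α = rng γ} = Set.univ :=
              Set.eq_univ_of_forall fun γ => U.exists_rng γ
            rw [hu, continuousOn_univ] at hc
            convert V.isBisection.isOpen.preimage hc using 1
            ext γ
            constructor
            · rintro ⟨g, hg, h, hh, hc, rfl⟩
              rw [Set.mem_preimage, sec_eq U.isBisection.injOn_rng hg (rng_mul g h hc).symm,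
                inv_mul_cancel_left g h hc]
              exact hh
            · intro hγ
              exact ⟨sec U.carrier γ, sec_mem (U.exists_rng γ), _, hγ,
                by rw [rng_mul _ _ (by rw [src_inv, rng_sec]), rng_inv],
                mul_inv_cancel_left _ _ rng_sec⟩
          injOn_src := by
            rintro _ ⟨g, hg, h, hh, hc, rfl⟩ _ ⟨g₂, hg₂, h₂, hh₂, hc₂, rfl⟩ he
            rw [src_mul g h hc, src_mul g₂ h₂ hc₂] at he
            have e := V.isBisection.injOn_src hh hh₂ he
            subst e
            rw [U.isBisection.injOn_src hg hg₂ (hc.trans hc₂.symm)]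
          injOn_rng := by
            rintro _ ⟨g, hg, h, hh, hc, rfl⟩ _ ⟨g₂, hg₂, h₂, hh₂, hc₂, rfl⟩ he
            rw [rng_mul g h hc, rng_mul g₂ h₂ hc₂] at he
            have e := U.isBisection.injOn_rng hg hg₂ he
            subst e
            rw [V.isBisection.injOn_rng hh hh₂ (hc.symm.trans hc₂)] }
      src_image := by
        apply Set.Subset.antisymm
        · rintro _ ⟨γ, _, rfl⟩
          exact src_mem γ
        · intro x hx
          rw [← V.src_image] at hx
          obtain ⟨h, hh, rfl⟩ := hx
          obtain ⟨g, hg, hc⟩ := U.exists_src h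
          exact ⟨g * h, ⟨g, hg, h, hh, hc, rfl⟩, src_mul g h hc⟩
      rng_image := by
        apply Set.Subset.antisymm
        · rintro _ ⟨γ, _, rfl⟩
          exact rng_mem γ
        · intro x hx
          rw [← U.rng_image] at hx
          obtain ⟨g, hg, rfl⟩ := hx
          obtain ⟨h, hh, hc⟩ := V.exists_rng g⁻¹
          rw [rng_inv] at hc
          exact ⟨g * h, ⟨g, hg, h, hh, hc.symm, rfl⟩, rng_mul g h hc.symm⟩ }

theorem mem_mul {U V : TopFullGroup G} {γ : G} : γ ∈ (U * V).carrier ↔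
    ∃ g ∈ U.carrier, ∃ h ∈ V.carrier, src g = rng h ∧ g * h = γ := Iff.rfl

/-- The unit of `[[G]]` is the unit space. -/
instance : One (TopFullGroup G) where
  one :=
    { carrier := units G
      isBisection := ConvAlg.isCompactOpenBisection_units
      src_image := by
        apply Set.Subset.antisymm
        · rintro _ ⟨γ, _, rfl⟩
          exact src_mem γ
        · intro x hx
          exact ⟨x, hx, mem_units_iff.1 hx⟩
      rng_image := by
        apply Set.Subset.antisymm
        · rintro _ ⟨γ, _, rfl⟩
          exact rng_mem γ
        · intro x hx
          exact ⟨x, hx, rng_eq_of_src_eq (mem_units_iff.1 hx)⟩ }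

theorem carrier_one : (1 : TopFullGroup G).carrier = units G := rfl

/-- The inverse of `U` in `[[G]]` is the set of inverses of the arrows in `U`. -/
instance : Inv (TopFullGroup G) where
  inv U :=
    { carrier := {γ | γ⁻¹ ∈ U.carrier}
      isBisection :=
        { isCompact := by
            convert U.isBisection.isCompact.image continuous_inv using 1
            ext γ
            constructor
            · intro h
              exact ⟨_, h, inv_inv γ⟩
            · rintro ⟨g, hg, rfl⟩
              change (g⁻¹)⁻¹ ∈ U.carrier
              rwa [inv_inv]
          isOpen := U.isBisection.isOpen.preimage continuous_inv
          injOn_src := by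
            intro a ha b hb h
            rw [← inv_inv a, ← inv_inv b]
            exact congrArg _ (U.isBisection.injOn_rng ha hb (by rw [rng_inv, rng_inv, h]))
          injOn_rng := by
            intro a ha b hb h
            rw [← inv_inv a, ← inv_inv b]
            exact congrArg _ (U.isBisection.injOn_src ha hb (by rw [src_inv, src_inv, h])) }
      src_image := by
        apply Set.Subset.antisymm
        · rintro _ ⟨γ, _, rfl⟩
          exact src_mem γ
        · intro x hx
          rw [← U.rng_image] at hx
          obtain ⟨g, hg, rfl⟩ := hx
          refine ⟨g⁻¹, ?_, src_inv g⟩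
          change (g⁻¹)⁻¹ ∈ U.carrier
          rwa [inv_inv]
      rng_image := by
        apply Set.Subset.antisymm
        · rintro _ ⟨γ, _, rfl⟩
          exact rng_mem γ
        · intro x hx
          rw [← U.src_image] at hx
          obtain ⟨g, hg, rfl⟩ := hx
          refine ⟨g⁻¹, ?_, rng_inv g⟩
          change (g⁻¹)⁻¹ ∈ U.carrier
          rwa [inv_inv] }

theorem mem_inv {U : TopFullGroup G} {γ : G} : γ ∈ (U⁻¹).carrier ↔ γ⁻¹ ∈ U.carrier := Iff.rfl

instance : Group (TopFullGroup G) where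
  mul_assoc U V W := by
    apply ext
    ext γ
    simp only [mem_mul]
    constructor
    · rintro ⟨_, ⟨g, hg, h, hh, hc, rfl⟩, k, hk, hc2, rfl⟩
      rw [src_mul g h hc] at hc2
      exact ⟨g, hg, h * k, ⟨h, hh, k, hk, hc2, rfl⟩, by rw [rng_mul h k hc2, hc],
        (TopologicalGroupoid.mul_assoc g h k hc hc2).symm⟩
    · rintro ⟨g, hg, _, ⟨h, hh, k, hk, hc, rfl⟩, hc2, rfl⟩
      rw [rng_mul h k hc] at hc2
      exact ⟨g * h, ⟨g, hg, h, hh, hc2, rfl⟩, k, hk, by rw [src_mul g h hc2, hc],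
        TopologicalGroupoid.mul_assoc g h k hc2 hc⟩
  one_mul U := by
    apply ext
    ext γ
    rw [mem_mul, carrier_one]
    constructor
    · rintro ⟨g, hg, h, hh, hc, rfl⟩
      rw [mem_units_iff.1 hg] at hc
      rwa [hc, rng_mul_self]
    · intro h
      exact ⟨rng γ, rng_mem γ, γ, h, src_rng γ, rng_mul_self γ⟩
  mul_one U := by
    apply ext
    ext γ
    rw [mem_mul, carrier_one]
    constructor
    · rintro ⟨g, hg, h, hh, hc, rfl⟩
      rw [rng_eq_of_src_eq (mem_units_iff.1 hh)] at hc
      rwa [← hc, mul_src]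
    · intro h
      exact ⟨γ, h, src γ, src_mem γ, (rng_src γ).symm, mul_src γ⟩
  inv_mul_cancel U := by
    apply ext
    ext γ
    rw [mem_mul, carrier_one]
    constructor
    · rintro ⟨g, hg, h, hh, hc, rfl⟩
      rw [mem_inv] at hg
      have e : g⁻¹ = h := U.isBisection.injOn_rng hg hh (by rw [rng_inv, hc])
      rw [← e, TopologicalGroupoid.mul_inv]
      exact rng_mem g
    · intro h
      have hs := h
      rw [← U.src_image] at hs
      obtain ⟨g, hg, hgs⟩ := hs
      exact ⟨g⁻¹, by rwa [mem_inv, inv_inv], g, hg, src_inv g, by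
        rw [TopologicalGroupoid.inv_mul, hgs]⟩

/-- The indicator function `1_U` of an element of `[[G]]`. -/
noncomputable def ind (U : TopFullGroup G) : ConvAlg G :=
  ConvAlg.ind U.carrier U.isBisection.isCompact U.isBisection.isOpen

theorem ind_of_mem {U : TopFullGroup G} {γ : G} (h : γ ∈ U.carrier) : U.ind γ = 1 :=
  Set.indicator_of_mem h fun _ => (1 : ℂ)

theorem ind_of_notMem {U : TopFullGroup G} {γ : G} (h : γ ∉ U.carrier) : U.ind γ = 0 :=
  Set.indicator_of_notMem h fun _ => (1 : ℂ)

theorem ind_one : (1 : TopFullGroup G).ind = 1 := rfl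

theorem ind_mul (U V : TopFullGroup G) : (U * V).ind = U.ind * V.ind := by
  refine ConvAlg.ext fun γ => ?_
  have hr : rng (sec U.carrier γ) = rng γ := rng_sec
  rw [ConvAlg.mul_apply_of_bisection U.isBisection (fun x hx => ind_of_notMem hx),
    ind_of_mem (sec_mem (U.exists_rng γ)), _root_.one_mul]
  by_cases h : (sec U.carrier γ)⁻¹ * γ ∈ V.carrier
  · rw [ind_of_mem h, ind_of_mem]
    exact mem_mul.2 ⟨_, sec_mem (U.exists_rng γ), _, h,
      by rw [rng_mul _ _ (by rw [src_inv, hr]), rng_inv], mul_inv_cancel_left _ _ hr⟩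
  · rw [ind_of_notMem h, ind_of_notMem]
    rintro ⟨g, hg, k, hk, hc, rfl⟩
    rw [sec_eq U.isBisection.injOn_rng hg (rng_mul g k hc).symm, inv_mul_cancel_left g k hc] at h
    exact h hk

theorem ind_inv (U : TopFullGroup G) : (U⁻¹).ind = star U.ind := by
  refine ConvAlg.ext fun γ => ?_
  rw [ConvAlg.star_apply]
  by_cases h : γ⁻¹ ∈ U.carrier
  · rw [ind_of_mem h, ind_of_mem (mem_inv.2 h), map_one]
  · rw [ind_of_notMem h, ind_of_notMem (fun h2 => h (mem_inv.1 h2)), map_zero]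

variable (G) in
/-- The canonical unitary representation `π : [[G]] → C*(G)`, `π(U) = 1_U`. -/
noncomputable def canonicalRep : TopFullGroup G →* unitary (FullCStar G) where
  toFun U := ⟨FullCStar.of G U.ind, by
    rw [Unitary.mem_iff, ← map_star, ← map_mul, ← map_mul, ← ind_inv, ← ind_mul, ← ind_mul,
      inv_mul_cancel, mul_inv_cancel, ind_one, map_one]
    exact ⟨rfl, rfl⟩⟩
  map_one' := Subtype.ext (by simp [ind_one])
  map_mul' U V := Subtype.ext (by simp [ind_mul])

end TopFullGroup

end FullGroup

end TopologicalGroupoid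

section UnitaryRepresentations

/-- The linear extension to the group algebra `ℂΓ` of a unitary representation of `Γ` on a unital
C*-algebra. -/
noncomputable def groupAlgebraHom {Γ A : Type*} [Group Γ] [CStarAlgebra A] (σ : Γ →* unitary A) :
    MonoidAlgebra ℂ Γ →ₐ[ℂ] A :=
  MonoidAlgebra.lift ℂ A Γ ((unitary A).subtype.comp σ)

/-- The unitary representation `σ` weakly contains the unitary representation `η`:
`‖∑ αᵢ η(gᵢ)‖ ≤ ‖∑ αᵢ σ(gᵢ)‖` for every `∑ αᵢ gᵢ` in `ℂΓ`. -/
def WeaklyContains {Γ A B : Type*} [Group Γ] [CStarAlgebra A] [CStarAlgebra B]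
    (σ : Γ →* unitary A) (η : Γ →* unitary B) : Prop :=
  ∀ a : MonoidAlgebra ℂ Γ, ‖groupAlgebraHom η a‖ ≤ ‖groupAlgebraHom σ a‖

/-- The trivial representation `Γ → ℂ`. -/
noncomputable def trivialRep (Γ : Type*) [Group Γ] : Γ →* unitary ℂ := 1

/-- The C*-algebra `C*_σ(Γ)` generated by the image of a unitary representation `σ`. -/
noncomputable def generatedCStar {Γ A : Type*} [Group Γ] [CStarAlgebra A] (σ : Γ →* unitary A) :
    StarSubalgebra ℂ A :=
  (StarAlgebra.adjoin ℂ (Set.range fun g => (σ g : A))).topologicalClosure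

open scoped ComplexOrder in
/-- Tracial states on a unital C*-algebra. -/
structure IsTracialState {A : Type*} [CStarAlgebra A] (τ : A →ₗ[ℂ] ℂ) : Prop where
  nonneg : ∀ a, 0 ≤ τ (star a * a)
  map_one : τ 1 = 1
  trace : ∀ a b, τ (a * b) = τ (b * a)

end UnitaryRepresentations

/-! Write `u`, `v`, ... for the indicator functions of bisections. Let `I` be the span in `C_c(G)`
of the elements `1 - u` with `U` in `[[G]]` (`augmentation`), and `J` its closure in `C*(G)`.

From (iii) to (iv). The heart is that `f a g` lies in `J` for `f`, `g` in `I` and arbitrary `a` in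
`C_c(G)` (`mul_mul_mem_closedAugmentation`), although `I` is only closed under products. Near a unit
`b`, the element `(1 - u) w e (1 - v)` has the form `(p - q) e (p' - q')*`, where the four
bisections contain arrows leaving `b` and `e` is a small projection around `b`. If the arrows of `p`
and `q` end at different points, `(p - q) e (p - q)*` is `1` minus the element of `[[G]]` which
exchanges the two ends, hence lies in `I`. Products of such elements yield all the others, because
`e (p - q)* (p - r) e = e` when the three ends are distinct; this is the role of the three points in
each orbit (`augRel_of_maps`). If `π` does not weakly contain the trivial representation, some `a`
in `ℂ[[G]]` has coefficient sum `1` and `‖π(a)‖ < 1`, so `1 = lim (1 - π(a)^n)` is in `J`, and every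
`f = 1 f 1` is in `J`, hence in `C*_π([[G]])`.

From (iv) to (ii) and from (ii) to (iii). `C*(G)` has no character, since a function supported near
an arrow is a multiple of some `p e` with square zero. If `π` weakly contains the trivial
representation, the coefficient sum extends by continuity to a character.

Between (i) and (iii) stands an invariant probability measure on the unit space. A tracial state
restricts to such a `μ`, and `f ↦ μ(sums of f over the source fibres)` is a state with value `1` on
`[[G]]`. Conversely, Hahn–Banach gives a state `φ` with value `1` on `[[G]]`. It vanishes on `1 -
swap = (v - v*v)(v - v*v)*`, so `φ(v a) = φ(v*v a)` by Cauchy–Schwarz. Arrows of the isotropy are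
products of two arrows which move their source, so `φ` is invariant on `C(G⁰)`, and its composition
with the restriction to `G⁰` is a trace. Boundedness for the full norm is automatic for positive
functionals on `C_c(G)`, by the GNS construction (`norm_apply_le`). -/

/-! ### Positive functionals and the GNS representation -/

section PositiveFunctionals

open scoped ComplexOrder InnerProductSpace
open UniformSpace

/-- Positive linear functionals on a complex `*`-algebra. -/
structure PositiveFunctional (A : Type*) [Ring A] [Algebra ℂ A] [StarRing A] extends
    A →ₗ[ℂ] ℂ where
  star_mul_self_nonneg : ∀ a : A, 0 ≤ toLinearMap (star a * a)

namespace PositiveFunctional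

variable {A : Type*} [Ring A] [Algebra ℂ A] [StarRing A] [StarModule ℂ A]

/-- Positivity alone forces hermitian symmetry: the values at `star (a + c • 1) * (a + c • 1)` are
real, and the cross terms for `c = 1` and `c = I` compare the imaginary and the real parts
respectively. -/
theorem map_star (φ : PositiveFunctional A) (a : A) :
    φ.toLinearMap (star a) = starRingEnd ℂ (φ.toLinearMap a) := by
  have h0 := φ.star_mul_self_nonneg a
  have h1 := φ.star_mul_self_nonneg 1
  have h2 := φ.star_mul_self_nonneg (a + 1)
  have h3 := φ.star_mul_self_nonneg (a + Complex.I • 1)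
  rw [Complex.nonneg_iff] at h0 h1 h2 h3
  simp only [star_add, star_one, star_smul, Complex.star_def, Complex.conj_I, mul_add, add_mul,
    one_mul, mul_one, smul_mul_assoc, mul_smul_comm, map_add, map_smul, smul_eq_mul,
    Complex.add_im, Complex.mul_im, Complex.I_re, Complex.I_im, Complex.neg_re,
    Complex.neg_im, Complex.mul_re, neg_smul, neg_mul, map_neg] at h0 h1 h2 h3
  apply Complex.ext
  · rw [Complex.conj_re]; linarith [h0.2, h1.2, h3.2]
  · rw [Complex.conj_im]; linarith [h0.2, h1.2, h2.2]

/-- The space on which the representation of Gelfand, Naimark and Segal is defined, before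
completion. -/
def PreGNS (_φ : PositiveFunctional A) : Type _ := A

variable (φ : PositiveFunctional A)

instance : AddCommGroup φ.PreGNS := inferInstanceAs (AddCommGroup A)
instance : Module ℂ φ.PreGNS := inferInstanceAs (Module ℂ A)

/-- The identity map. -/
def toPreGNS : A ≃ₗ[ℂ] φ.PreGNS := LinearEquiv.refl ℂ A

/-- The semi-inner product defined by a positive functional. -/
noncomputable abbrev core : PreInnerProductSpace.Core ℂ φ.PreGNS where
  inner a b := φ.toLinearMap (star (φ.toPreGNS.symm a) * φ.toPreGNS.symm b)
  conj_inner_symm a b := by rw [← φ.map_star, star_mul, star_star]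
  re_inner_nonneg a := (Complex.nonneg_iff.1 (φ.star_mul_self_nonneg _)).1
  add_left a b c := by rw [_root_.map_add, star_add, add_mul, _root_.map_add]
  smul_left a b r := by
    rw [_root_.map_smul, star_smul, smul_mul_assoc, _root_.map_smul]; rfl

/-- Cauchy–Schwarz for the vectors `star a` and `b`. It is applied to elements with `a * star a = 1
- swap`, on which a state trivial on `[[G]]` vanishes. -/
theorem apply_mul_eq_zero {a : A}
    (ha : φ.toLinearMap (a * star a) = 0) (b : A) : φ.toLinearMap (a * b) = 0 := by
  have h := @InnerProductSpace.Core.inner_mul_inner_self_le ℂ φ.PreGNS _ _ _ φ.core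
    (φ.toPreGNS (star a)) (φ.toPreGNS b)
  change ‖φ.toLinearMap (star (star a) * b)‖ * ‖φ.toLinearMap (star b * star a)‖ ≤
    (φ.toLinearMap (star (star a) * star a)).re * _ at h
  have e : star b * star a = star (a * b) := (star_mul a b).symm
  rw [star_star, ha, Complex.zero_re, zero_mul, e, φ.map_star, RCLike.norm_conj] at h
  exact norm_eq_zero.1 (mul_self_eq_zero.1 (le_antisymm h (mul_self_nonneg _)))

noncomputable instance : SeminormedAddCommGroup φ.PreGNS :=
  InnerProductSpace.Core.toSeminormedAddCommGroup (c := φ.core)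
noncomputable instance : InnerProductSpace ℂ φ.PreGNS :=
  InnerProductSpace.ofCore φ.core

theorem inner_toPreGNS (a b : A) :
    ⟪φ.toPreGNS a, φ.toPreGNS b⟫_ℂ = φ.toLinearMap (star a * b) := rfl

theorem norm_toPreGNS_sq (a : A) :
    ‖φ.toPreGNS a‖ ^ 2 = (φ.toLinearMap (star a * a)).re := by
  rw [← inner_toPreGNS, @norm_sq_eq_re_inner ℂ]
  rfl

/-- `a` acts boundedly from the left for the semi-inner product given by `φ`. -/
def IsLeftBounded (a : A) : Prop :=
  ∃ C : ℝ, ∀ b : A, ‖φ.toPreGNS (a * b)‖ ≤ C * ‖φ.toPreGNS b‖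

/-- Left multiplication, on the completion. -/
noncomputable def leftMul (h : ∀ a, φ.IsLeftBounded a) (a : A) :
    Completion φ.PreGNS →L[ℂ] Completion φ.PreGNS :=
  ((φ.toPreGNS.toLinearMap ∘ₗ LinearMap.mulLeft ℂ a ∘ₗ φ.toPreGNS.symm.toLinearMap).mkContinuous
    (h a).choose (fun b => (h a).choose_spec (φ.toPreGNS.symm b))).completion

theorem leftMul_coe (h : ∀ a, φ.IsLeftBounded a) (a b : A) :
    φ.leftMul h a (φ.toPreGNS b : Completion φ.PreGNS) = (φ.toPreGNS (a * b) : Completion _) := by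
  rw [leftMul, ContinuousLinearMap.completion_apply_coe]
  rfl

theorem induction_completion {p : Completion φ.PreGNS → Prop} (hc : IsClosed {x | p x})
    (h : ∀ a : A, p (φ.toPreGNS a : Completion _)) (x) : p x :=
  Completion.induction_on x hc h

theorem ext_of_coe {S T : Completion φ.PreGNS →L[ℂ] Completion φ.PreGNS}
    (h : ∀ a : A, S (φ.toPreGNS a : Completion _) = T (φ.toPreGNS a : Completion _)) : S = T :=
  ContinuousLinearMap.ext fun x =>
    φ.induction_completion (p := fun x => S x = T x) (isClosed_eq S.continuous T.continuous) h x

theorem leftMul_star (h : ∀ a, φ.IsLeftBounded a) (a : A) (x y : Completion φ.PreGNS) :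
    ⟪φ.leftMul h (star a) x, y⟫_ℂ = ⟪x, φ.leftMul h a y⟫_ℂ := by
  refine φ.induction_completion (p := fun x => ⟪φ.leftMul h (star a) x, y⟫_ℂ =
    ⟪x, φ.leftMul h a y⟫_ℂ) (isClosed_eq
      ((φ.leftMul h (star a)).continuous.inner continuous_const)
      (continuous_id.inner continuous_const)) (fun b => ?_) x
  refine φ.induction_completion (p := fun y => ⟪φ.leftMul h (star a) (φ.toPreGNS b :
    Completion _), y⟫_ℂ = ⟪(φ.toPreGNS b : Completion _), φ.leftMul h a y⟫_ℂ) (isClosed_eq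
      (continuous_const.inner continuous_id)
      (continuous_const.inner (φ.leftMul h a).continuous)) (fun c => ?_) y
  rw [leftMul_coe, leftMul_coe, Completion.inner_coe, Completion.inner_coe, inner_toPreGNS,
    inner_toPreGNS, star_mul, star_star, mul_assoc]

/-- The representation of Gelfand, Naimark and Segal. -/
noncomputable def gns (h : ∀ a, φ.IsLeftBounded a) :
    A →⋆ₙₐ[ℂ] (Completion φ.PreGNS →L[ℂ] Completion φ.PreGNS) where
  toFun := φ.leftMul h
  map_smul' c a := φ.ext_of_coe fun b => by
    rw [smul_apply, leftMul_coe, leftMul_coe, smul_mul_assoc,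
      _root_.map_smul, Completion.coe_smul]
    rfl
  map_zero' := φ.ext_of_coe fun b => by
    rw [leftMul_coe, zero_mul, _root_.map_zero]
    rfl
  map_add' a a' := φ.ext_of_coe fun b => by
    rw [_root_.add_apply, leftMul_coe, leftMul_coe, leftMul_coe, add_mul,
      _root_.map_add, Completion.coe_add]
  map_mul' a a' := φ.ext_of_coe fun b => by
    rw [mul_apply_eq_comp, leftMul_coe, leftMul_coe, leftMul_coe, mul_assoc]
  map_star' a := (ContinuousLinearMap.eq_adjoint_iff _ _).2 (φ.leftMul_star h a)

/-- `φ` is the vector state of the class of `1`, a unit vector of the GNS space. -/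
theorem norm_apply_le_norm_gns (h : ∀ a, φ.IsLeftBounded a) (h1 : φ.toLinearMap 1 = 1) (a : A) :
    ‖φ.toLinearMap a‖ ≤ ‖φ.gns h a‖ := by
  have hn : ‖(φ.toPreGNS 1 : Completion φ.PreGNS)‖ = 1 := by
    rw [Completion.norm_coe, ← sq_eq_sq₀ (norm_nonneg _) zero_le_one, norm_toPreGNS_sq]
    simp [h1]
  have e : φ.toLinearMap a = ⟪(φ.toPreGNS 1 : Completion φ.PreGNS),
      φ.gns h a (φ.toPreGNS 1 : Completion φ.PreGNS)⟫_ℂ := by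
    change _ = ⟪_, φ.leftMul h a _⟫_ℂ
    rw [leftMul_coe, Completion.inner_coe, inner_toPreGNS, star_one, one_mul, mul_one]
  rw [e]
  refine (norm_inner_le_norm _ _).trans ?_
  have := (φ.gns h a).le_opNorm (φ.toPreGNS 1 : Completion φ.PreGNS)
  rw [hn] at this ⊢
  simpa using this

end PositiveFunctional

/-- A functional of norm at most one which maps `1` to `1` is positive. -/
theorem star_mul_self_nonneg_of_norm_le {A : Type*} [CStarAlgebra A] (φ : A →ₗ[ℂ] ℂ)
    (hφ : ∀ a, ‖φ a‖ ≤ ‖a‖) (h1 : φ 1 = 1) (a : A) : 0 ≤ φ (star a * a) := by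
  have : Nontrivial A := ⟨1, 0, fun h => by simp [h] at h1⟩
  have him : ∀ b : A, IsSelfAdjoint b → (φ b).im = 0 := by
    intro b hb
    -- Compare `|φ(b + it)|²` with `‖b + it‖² ≤ ‖b‖² + t²`. The terms `t²` cancel, and the remaining
    -- bound, linear in `t` and valid for all real `t`, forces the imaginary part to vanish.
    have key : ∀ t : ℝ, 2 * (φ b).im * t ≤ ‖b‖ ^ 2 := by
      intro t
      have e1 := hφ (b + (t * Complex.I : ℂ) • 1)
      have e2 : ‖b + (t * Complex.I : ℂ) • (1 : A)‖ ^ 2 ≤ ‖b‖ ^ 2 + t ^ 2 := by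
        rw [sq, ← CStarRing.norm_star_mul_self]
        have : star (b + (t * Complex.I : ℂ) • (1 : A)) * (b + (t * Complex.I : ℂ) • (1 : A)) =
            star b * b + ((t ^ 2 : ℝ) : ℂ) • 1 := by
          have hI : ((t : ℂ) * Complex.I) * (t * Complex.I) = -((t ^ 2 : ℝ) : ℂ) := by
            push_cast; linear_combination (t : ℂ) ^ 2 * Complex.I_sq
          have hs : star ((t : ℂ) * Complex.I) = -(t * Complex.I) := by simp
          rw [star_add, star_smul, star_one, hs, hb.star_eq]
          generalize (t : ℂ) * Complex.I = c at hI ⊢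
          have h2 : ((t ^ 2 : ℝ) : ℂ) = -(c * c) := by rw [hI, neg_neg]
          rw [h2]
          simp only [Algebra.smul_def, map_neg, map_mul, mul_one]
          have hc := Algebra.commutes c b
          rw [add_mul, mul_add, mul_add, neg_mul, neg_mul, hc]
          abel
        rw [this]
        refine (norm_add_le _ _).trans ?_
        rw [CStarRing.norm_star_mul_self, norm_smul, norm_one, mul_one, ← sq]
        simp
      have e3 : ‖φ (b + (t * Complex.I : ℂ) • 1)‖ ^ 2 = (φ b).re ^ 2 + ((φ b).im + t) ^ 2 := by
        rw [← Complex.normSq_eq_norm_sq, Complex.normSq_apply]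
        simp [h1]
        ring
      have e4 := pow_le_pow_left₀ (norm_nonneg _) e1 2
      nlinarith [sq_nonneg (φ b).re, sq_nonneg (φ b).im]
    by_contra hne
    have := key ((‖b‖ ^ 2 + 1) / (2 * (φ b).im))
    rw [mul_div_cancel₀ _ (by simpa using hne)] at this
    linarith
  rw [Complex.nonneg_iff]
  refine ⟨?_, (him _ (IsSelfAdjoint.star_mul_self a)).symm⟩
  -- Since `0 ≤ a*a ≤ ‖a*a‖`, the element `‖a*a‖ - a*a` has norm at most `‖a*a‖`. Contractivity then
  -- gives `‖a*a‖ - Re φ(a*a) ≤ ‖a*a‖`.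
  let _ := CStarAlgebra.spectralOrder A
  have := CStarAlgebra.spectralOrderedRing A
  have hn : (0 : A) ≤ star a * a := star_mul_self_nonneg a
  have hle : star a * a ≤ algebraMap ℝ A ‖star a * a‖ :=
    (IsSelfAdjoint.star_mul_self a).le_algebraMap_norm_self
  have h2 : ‖algebraMap ℝ A ‖star a * a‖ - star a * a‖ ≤ ‖star a * a‖ := by
    have h3 : algebraMap ℝ A ‖star a * a‖ - star a * a ≤ algebraMap ℝ A ‖star a * a‖ :=
      sub_le_self _ hn
    refine (CStarAlgebra.norm_le_norm_of_nonneg_of_le (sub_nonneg.2 hle) h3).trans ?_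
    rw [norm_algebraMap']
    simp
  have h4 := (Complex.re_le_norm _).trans ((hφ _).trans h2)
  have h5 : φ (algebraMap ℝ A ‖star a * a‖) = ‖star a * a‖ := by
    rw [Algebra.algebraMap_eq_smul_one, ← Complex.coe_smul, map_smul, h1]
    simp
  rw [map_sub, h5, Complex.sub_re, Complex.ofReal_re] at h4
  linarith

end PositiveFunctionals

/-! ### Continuous functions on profinite spaces -/

section ClopenIndicators

/-- The indicator function of a clopen set, as a continuous function. -/
noncomputable def clopenIndicator {X : Type*} [TopologicalSpace X] (B : Set X) (hB : IsClopen B) :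
    C(X, ℂ) :=
  ⟨B.indicator fun _ => 1, continuous_const.indicator (fun x hx => by
    rw [hB.frontier_eq] at hx
    exact absurd hx (Set.notMem_empty x))⟩

theorem clopenIndicator_apply {X : Type*} [TopologicalSpace X] (B : Set X) (hB : IsClopen B)
    (x : X) : clopenIndicator B hB x = B.indicator (fun _ => 1) x := rfl

/-- On a profinite space, a closed linear condition on continuous functions has to be checked on
the indicator functions of clopen sets only. -/
theorem ContinuousMap.mem_of_clopenIndicator_mem {X : Type*} [TopologicalSpace X] [CompactSpace X]
    [T2Space X] [TotallyDisconnectedSpace X] (M : Submodule ℂ C(X, ℂ))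
    (hM : IsClosed (M : Set C(X, ℂ))) (h : ∀ B hB, clopenIndicator B hB ∈ M) (k : C(X, ℂ)) :
    k ∈ M := by
  -- Indicators of clopen sets are stable under products and conjugation, so the star algebra which
  -- they generate is just their linear span; it separates points, and Stone–Weierstrass makes it
  -- dense.
  let I : Submonoid C(X, ℂ) :=
    { carrier := {k | ∃ B hB, k = clopenIndicator B hB}
      one_mem' := ⟨Set.univ, isClopen_univ, by ext x; simp [clopenIndicator_apply]⟩
      mul_mem' := by
        rintro _ _ ⟨B, hB, rfl⟩ ⟨C, hC, rfl⟩
        refine ⟨B ∩ C, hB.inter hC, ?_⟩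
        ext x
        by_cases h1 : x ∈ B <;> by_cases h2 : x ∈ C <;> simp [clopenIndicator_apply, h1, h2] }
  let S : StarSubalgebra ℂ C(X, ℂ) := StarAlgebra.adjoin ℂ (I : Set C(X, ℂ))
  have hS : ∀ k ∈ S, k ∈ Submodule.span ℂ (I : Set C(X, ℂ)) := by
    intro k hk
    have hstar : star (I : Set C(X, ℂ)) = I := by
      have : ∀ k : C(X, ℂ), k ∈ I → star k ∈ I := by
        rintro _ ⟨B, hB, rfl⟩
        refine ⟨B, hB, ?_⟩
        ext x
        by_cases h1 : x ∈ B <;> simp [clopenIndicator_apply, h1]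
      ext k
      exact ⟨fun hk => by simpa using this _ hk, fun hk => this _ hk⟩
    have h1 : k ∈ Algebra.adjoin ℂ ((I : Set C(X, ℂ)) ∪ star (I : Set C(X, ℂ))) := hk
    rw [hstar, Set.union_self, ← Subalgebra.mem_toSubmodule, Algebra.adjoin_eq_span,
      Submonoid.closure_eq] at h1
    exact h1
  have hsep : S.SeparatesPoints := by
    intro x y hxy
    obtain ⟨B, hB, hx, hy⟩ := exists_isClopen_of_totally_separated hxy
    refine ⟨_, ⟨_, StarAlgebra.subset_adjoin ℂ _ ⟨B, hB, rfl⟩, rfl⟩, ?_⟩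
    have hy' : y ∉ B := hy
    simp [clopenIndicator_apply, hx, hy']
  have htop := ContinuousMap.starSubalgebra_topologicalClosure_eq_top_of_separatesPoints S hsep
  have hk : k ∈ S.topologicalClosure := by rw [htop]; trivial
  refine closure_minimal (fun k hk => ?_) hM hk
  refine Submodule.span_le.2 ?_ (hS k hk)
  rintro _ ⟨B, hB, rfl⟩
  exact h B hB

end ClopenIndicators

/-! ### The inverse semigroup of compact open bisections, and swaps -/

namespace TopologicalGroupoid

variable {G : Type u} [TopologicalSpace G] [TopologicalGroupoid G] [IsAmple G]
  [CompactSpace (units G)]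

set_option linter.unusedSectionVars false

theorem IsCompactOpenBisection.of_subset {V W : Set G} (hV : IsCompactOpenBisection V)
    (hW : IsClopen W) (h : W ⊆ V) : IsCompactOpenBisection W where
  isCompact := hV.isCompact.of_isClosed_subset hW.isClosed h
  isOpen := hW.isOpen
  injOn_src := hV.injOn_src.mono h
  injOn_rng := hV.injOn_rng.mono h

theorem isOpen_image_src {U : Set G} (hU : IsOpen U) : IsOpen (src '' U) := by
  have h : src '' U = Subtype.val '' (srcUnit '' U) := by
    rw [Set.image_image]
    rfl
  rw [h]
  exact isOpen_units.isOpenMap_subtype_val _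
    ((IsAmple.isLocalHomeomorph_src (G := G)).isOpenMap U hU)

/-- A bisection through `γ` is cut down by a clopen set of sources. As `src` is injective on it, an
arrow whose source is also the source of an arrow in `O` is that arrow. -/
theorem exists_isCompactOpenBisection_subset {O : Set G} (hO : IsOpen O) {γ : G} (hγ : γ ∈ O) :
    ∃ V : Set G, IsCompactOpenBisection V ∧ γ ∈ V ∧ V ⊆ O := by
  obtain ⟨V, hV, hγV⟩ := exists_isCompactOpenBisection γ
  have := IsAmple.totallyDisconnected (G := G)
  have h1 : IsOpen (srcUnit '' (V ∩ O) : Set (units G)) :=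
    (IsAmple.isLocalHomeomorph_src (G := G)).isOpenMap _ (hV.isOpen.inter hO)
  obtain ⟨B, hB, hγB, hBsub⟩ := compact_exists_isClopen_in_isOpen h1 ⟨γ, ⟨hγV, hγ⟩, rfl⟩
  have hc : IsClopen (V ∩ srcUnit ⁻¹' B) := hV.isClopen.inter
    (hB.preimage (IsAmple.isLocalHomeomorph_src (G := G)).continuous)
  refine ⟨_, hV.of_subset hc Set.inter_subset_left, ⟨hγV, hγB⟩, ?_⟩
  rintro g ⟨hg, hgB⟩
  obtain ⟨k, ⟨hkV, hkO⟩, hk⟩ := hBsub hgB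
  rwa [← hV.injOn_src hkV hg (congrArg Subtype.val hk)]

/-- A property of the functions in `C_c(G)` which is stable under sums holds for all of them if it
holds for functions supported near a given arrow. -/
theorem ConvAlg.local_induction {P : ConvAlg G → Prop} (zero : P 0)
    (add : ∀ f g, P f → P g → P (f + g))
    (nhds : ∀ γ : G, ∃ V : Set G, IsOpen V ∧ γ ∈ V ∧
      ∀ W ⊆ V, IsCompactOpenBisection W → ∀ f : ConvAlg G, (∀ x, x ∉ W → f x = 0) → P f)
    (f : ConvAlg G) : P f := by
  classical
  have key : ∃ V : Set G, IsClopen V ∧ tsupport f ⊆ V ∧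
      ∀ f : ConvAlg G, (∀ x, x ∉ V → f x = 0) → P f := by
    refine f.hasCompactSupport.isCompact.induction_on (p := fun s => ∃ V : Set G, IsClopen V ∧
      s ⊆ V ∧ ∀ f : ConvAlg G, (∀ x, x ∉ V → f x = 0) → P f) ?_ ?_ ?_ ?_
    · refine ⟨∅, isClopen_empty, subset_rfl, fun f hf => ?_⟩
      have : f = 0 := ext fun x => hf x (Set.notMem_empty x)
      rwa [this]
    · rintro s t hst ⟨V, hV, htV, h⟩
      exact ⟨V, hV, hst.trans htV, h⟩
    · rintro s t ⟨V, hV, hsV, h⟩ ⟨W, hW, htW, h2⟩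
      refine ⟨V ∪ W, hV.union hW, Set.union_subset_union hsV htW, fun f hf => ?_⟩
      have : f = f.restrict V hV + f.restrict (W \ V) (hW.diff hV) := by
        refine ext fun x => ?_
        simp only [restrict, add_apply, mk_apply, Set.indicator_apply, Set.mem_sdiff]
        by_cases h1 : x ∈ V
        · simp [h1]
        · by_cases h2 : x ∈ W
          · simp [h1, h2]
          · simp [h1, h2, hf x (fun h => h.elim h1 h2)]
      rw [this]
      refine add _ _ (h _ fun x hx => ?_) (h2 _ fun x hx => ?_)
      · simp [restrict, hx]
      · simp [restrict, hx]
    · intro x _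
      obtain ⟨V, hV, hx, h⟩ := nhds x
      obtain ⟨W, hW, hxW, hWV⟩ := exists_isCompactOpenBisection_subset hV hx
      exact ⟨W, mem_nhdsWithin_of_mem_nhds (hW.isOpen.mem_nhds hxW), W, hW.isClopen, subset_rfl,
        h W hWV hW⟩
  obtain ⟨V, _, hfV, h⟩ := key
  exact h f fun x hx => image_eq_zero_of_notMem_tsupport (fun h => hx (hfV h))
variable (G) in
/-- Bundled compact open bisections. -/
structure Bisection where
  carrier : Set G
  isBisection : IsCompactOpenBisection carrier

namespace Bisection

theorem ext {U V : Bisection G} (h : U.carrier = V.carrier) : U = V := by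
  cases U
  cases V
  cases h
  rfl

/-- The product of compact open bisections. -/
instance : Mul (Bisection G) where
  mul U V :=
    { carrier := {γ | ∃ g ∈ U.carrier, ∃ h ∈ V.carrier, src g = rng h ∧ g * h = γ}
      isBisection :=
        { isCompact := by
            have hcl : IsClosed {p : G × G | src p.1 = rng p.2} :=
              isClosed_eq (continuous_src.comp continuous_fst) (continuous_rng.comp continuous_snd)
            have hK : IsCompact ((fun p : G × G => p.1 * p.2) ''
                ((U.carrier ×ˢ V.carrier) ∩ {p : G × G | src p.1 = rng p.2})) :=
              ((U.isBisection.isCompact.prod V.isBisection.isCompact).inter_right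
                hcl).image_of_continuousOn (continuousOn_mul.mono Set.inter_subset_right)
            convert hK using 1
            ext γ
            constructor
            · rintro ⟨g, hg, h, hh, hc, rfl⟩
              exact ⟨(g, h), ⟨⟨hg, hh⟩, hc⟩, rfl⟩
            · rintro ⟨⟨g, h⟩, ⟨⟨hg, hh⟩, hc⟩, rfl⟩
              exact ⟨g, hg, h, hh, hc, rfl⟩
          isOpen := by
            have hc := continuousOn_sec_inv_mul U.isBisection.isOpen U.isBisection.injOn_rng
            convert hc.isOpen_inter_preimage (isOpen_rngDom U.isBisection.isOpen)
              V.isBisection.isOpen using 1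
            ext γ
            constructor
            · rintro ⟨g, hg, h, hh, hc, rfl⟩
              refine ⟨⟨g, hg, (rng_mul g h hc).symm⟩, ?_⟩
              rw [Set.mem_preimage, sec_eq U.isBisection.injOn_rng hg (rng_mul g h hc).symm,
                inv_mul_cancel_left g h hc]
              exact hh
            · rintro ⟨hr, hγ⟩
              exact ⟨sec U.carrier γ, sec_mem hr, _, hγ,
                by rw [rng_mul _ _ (by rw [src_inv, rng_sec]), rng_inv],
                mul_inv_cancel_left _ _ rng_sec⟩
          injOn_src := by
            rintro _ ⟨g, hg, h, hh, hc, rfl⟩ _ ⟨g₂, hg₂, h₂, hh₂, hc₂, rfl⟩ he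
            rw [src_mul g h hc, src_mul g₂ h₂ hc₂] at he
            have e := V.isBisection.injOn_src hh hh₂ he
            subst e
            rw [U.isBisection.injOn_src hg hg₂ (hc.trans hc₂.symm)]
          injOn_rng := by
            rintro _ ⟨g, hg, h, hh, hc, rfl⟩ _ ⟨g₂, hg₂, h₂, hh₂, hc₂, rfl⟩ he
            rw [rng_mul g h hc, rng_mul g₂ h₂ hc₂] at he
            have e := U.isBisection.injOn_rng hg hg₂ he
            subst e
            rw [V.isBisection.injOn_rng hh hh₂ (hc.symm.trans hc₂)] } }

theorem mem_mul {U V : Bisection G} {γ : G} : γ ∈ (U * V).carrier ↔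
    ∃ g ∈ U.carrier, ∃ h ∈ V.carrier, src g = rng h ∧ g * h = γ := Iff.rfl

/-- The inverse of a compact open bisection. -/
instance : Inv (Bisection G) where
  inv U :=
    { carrier := {γ | γ⁻¹ ∈ U.carrier}
      isBisection :=
        { isCompact := by
            convert U.isBisection.isCompact.image continuous_inv using 1
            ext γ
            constructor
            · intro h
              exact ⟨_, h, inv_inv γ⟩
            · rintro ⟨g, hg, rfl⟩
              change (g⁻¹)⁻¹ ∈ U.carrier
              rwa [inv_inv]
          isOpen := U.isBisection.isOpen.preimage continuous_inv
          injOn_src := by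
            intro a ha b hb h
            rw [← inv_inv a, ← inv_inv b]
            exact congrArg _ (U.isBisection.injOn_rng ha hb (by rw [rng_inv, rng_inv, h]))
          injOn_rng := by
            intro a ha b hb h
            rw [← inv_inv a, ← inv_inv b]
            exact congrArg _ (U.isBisection.injOn_src ha hb (by rw [src_inv, src_inv, h])) } }

theorem mem_inv {U : Bisection G} {γ : G} : γ ∈ (U⁻¹).carrier ↔ γ⁻¹ ∈ U.carrier := Iff.rfl

theorem mem_inv_mul_self {U : Bisection G} {γ : G} :
    γ ∈ (U⁻¹ * U).carrier ↔ γ ∈ src '' U.carrier := by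
  rw [mem_mul]
  constructor
  · rintro ⟨g, hg, h, hh, hc, rfl⟩
    have e : g⁻¹ = h := U.isBisection.injOn_rng hg hh (by rw [rng_inv, hc])
    refine ⟨h, hh, ?_⟩
    rw [← TopologicalGroupoid.inv_mul, ← e, inv_inv]
  · rintro ⟨g, hg, rfl⟩
    exact ⟨g⁻¹, by rwa [mem_inv, inv_inv], g, hg, src_inv g, TopologicalGroupoid.inv_mul g⟩

theorem mem_mul_inv_self {U : Bisection G} {γ : G} :
    γ ∈ (U * U⁻¹).carrier ↔ γ ∈ rng '' U.carrier := by
  rw [mem_mul]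
  constructor
  · rintro ⟨g, hg, h, hh, hc, rfl⟩
    have e : g = h⁻¹ := U.isBisection.injOn_src hg hh (by rw [src_inv, hc])
    refine ⟨g, hg, ?_⟩
    rw [← TopologicalGroupoid.mul_inv, e, inv_inv]
  · rintro ⟨g, hg, rfl⟩
    exact ⟨g, hg, g⁻¹, by rwa [mem_inv, inv_inv], (rng_inv g).symm, TopologicalGroupoid.mul_inv g⟩

theorem isOpen_src_image (U : Bisection G) : IsOpen (src '' U.carrier) :=
  isOpen_image_src U.isBisection.isOpen

theorem isClopen_src_image (U : Bisection G) : IsClopen (src '' U.carrier) :=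
  ⟨(U.isBisection.isCompact.image continuous_src).isClosed, U.isOpen_src_image⟩

theorem src_image_inv (U : Bisection G) : src '' (U⁻¹).carrier = rng '' U.carrier := by
  ext γ
  constructor
  · rintro ⟨g, hg, rfl⟩
    exact ⟨_, hg, rng_inv g⟩
  · rintro ⟨g, hg, rfl⟩
    exact ⟨g⁻¹, by rwa [mem_inv, inv_inv], src_inv g⟩

theorem isClopen_rng_image (U : Bisection G) : IsClopen (rng '' U.carrier) := by
  rw [← src_image_inv]
  exact U⁻¹.isClopen_src_image

/-- The indicator function of a compact open bisection. -/
noncomputable def ind (U : Bisection G) : ConvAlg G :=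
  ConvAlg.ind U.carrier U.isBisection.isCompact U.isBisection.isOpen

theorem ind_of_mem {U : Bisection G} {γ : G} (h : γ ∈ U.carrier) : U.ind γ = 1 :=
  Set.indicator_of_mem h fun _ => (1 : ℂ)

theorem ind_of_notMem {U : Bisection G} {γ : G} (h : γ ∉ U.carrier) : U.ind γ = 0 :=
  Set.indicator_of_notMem h fun _ => (1 : ℂ)

theorem exists_mem (γ : G) : ∃ U : Bisection G, γ ∈ U.carrier := by
  obtain ⟨V, hV, h⟩ := exists_isCompactOpenBisection γ
  exact ⟨⟨V, hV⟩, h⟩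

theorem ind_mul (U V : Bisection G) : (U * V).ind = U.ind * V.ind := by
  refine ConvAlg.ext fun γ => ?_
  have hr : rng (sec U.carrier γ) = rng γ := rng_sec
  rw [ConvAlg.mul_apply_of_bisection U.isBisection (fun x hx => ind_of_notMem hx)]
  by_cases hd : sec U.carrier γ ∈ U.carrier
  · rw [ind_of_mem hd, one_mul]
    by_cases h : (sec U.carrier γ)⁻¹ * γ ∈ V.carrier
    · rw [ind_of_mem h, ind_of_mem]
      exact mem_mul.2 ⟨_, hd, _, h,
        by rw [rng_mul _ _ (by rw [src_inv, hr]), rng_inv], mul_inv_cancel_left _ _ hr⟩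
    · rw [ind_of_notMem h, ind_of_notMem]
      rintro ⟨g, hg, k, hk, hc, rfl⟩
      rw [sec_eq U.isBisection.injOn_rng hg (rng_mul g k hc).symm,
        inv_mul_cancel_left g k hc] at h
      exact h hk
  · rw [ind_of_notMem hd, zero_mul, ind_of_notMem]
    rintro ⟨g, hg, k, hk, hc, rfl⟩
    exact hd (sec_mem ⟨g, hg, (rng_mul g k hc).symm⟩)

theorem ind_inv (U : Bisection G) : (U⁻¹).ind = star U.ind := by
  refine ConvAlg.ext fun γ => ?_
  rw [ConvAlg.star_apply]
  by_cases h : γ⁻¹ ∈ U.carrier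
  · rw [ind_of_mem h, ind_of_mem (mem_inv.2 h), map_one]
  · rw [ind_of_notMem h, ind_of_notMem (fun h2 => h (mem_inv.1 h2)), map_zero]

theorem ind_eq_zero {U : Bisection G} (h : ∀ γ, γ ∉ U.carrier) : U.ind = 0 :=
  ConvAlg.ext fun γ => ind_of_notMem (h γ)

/-- The unit space. -/
instance : One (Bisection G) := ⟨⟨units G, ConvAlg.isCompactOpenBisection_units⟩⟩

theorem carrier_one : (1 : Bisection G).carrier = units G := rfl

theorem ind_one : (1 : Bisection G).ind = 1 := rfl

/-- A clopen subset of the unit space, as a bisection. -/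
def ofClopen (B : Set G) (hB : IsClopen B) (h : B ⊆ units G) : Bisection G :=
  ⟨B, ConvAlg.isCompactOpenBisection_units.of_subset hB h⟩

theorem mul_self_of_subset_units {E : Bisection G} (h : E.carrier ⊆ units G) : E * E = E := by
  refine ext (Set.ext fun γ => ?_)
  rw [mem_mul]
  constructor
  · rintro ⟨g, hg, k, hk, hc, rfl⟩
    rw [mem_units_iff.1 (h hg)] at hc
    rwa [hc, rng_mul_self]
  · intro hγ
    have e := mem_units_iff.1 (h hγ)
    refine ⟨γ, hγ, γ, hγ, by rw [e, rng_eq_of_src_eq e], ?_⟩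
    nth_rw 2 [← e]
    exact mul_src γ

theorem inv_eq_of_subset_units {E : Bisection G} (h : E.carrier ⊆ units G) : E⁻¹ = E := by
  refine ext (Set.ext fun γ => ?_)
  rw [mem_inv]
  constructor
  · intro hγ
    have e := inv_src γ⁻¹
    rw [mem_units_iff.1 (h hγ), inv_inv] at e
    rwa [e]
  · intro hγ
    have e := inv_src γ
    rw [mem_units_iff.1 (h hγ)] at e
    rwa [e]

theorem ind_mul_self {E : Bisection G} (h : E.carrier ⊆ units G) : E.ind * E.ind = E.ind := by
  rw [← ind_mul, mul_self_of_subset_units h]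

theorem star_ind {E : Bisection G} (h : E.carrier ⊆ units G) : star E.ind = E.ind := by
  rw [← ind_inv, inv_eq_of_subset_units h]

/-- `P.ind` is a partial isometry whose initial projection is the indicator function of `src ''
P.carrier`, and this projection dominates `E.ind`. -/
theorem ind_star_mul_self_mul {P E : Bisection G} (hE : E.carrier ⊆ units G)
    (h : E.carrier ⊆ src '' P.carrier) : star P.ind * P.ind * E.ind = E.ind := by
  rw [← ind_inv, ← ind_mul, ← ind_mul]
  congr 1
  refine ext (Set.ext fun γ => ?_)
  rw [mem_mul]
  constructor
  · rintro ⟨g, hg, k, hk, hc, rfl⟩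
    obtain ⟨p, hp, rfl⟩ := mem_inv_mul_self.1 hg
    rw [src_src] at hc
    rwa [hc, rng_mul_self]
  · intro hγ
    have e := mem_units_iff.1 (hE hγ)
    refine ⟨γ, mem_inv_mul_self.2 (h hγ), γ, hγ, by rw [e, rng_eq_of_src_eq e], ?_⟩
    nth_rw 2 [← e]
    exact mul_src γ

/-- A nonzero value would come from a composable product of arrows in `E`, `P⁻¹`, `Q`, `E`; the
arrows in `P` and `Q` would then start in `E` and have a common range. -/
theorem ind_star_mul_mul_eq_zero {P Q E : Bisection G} (hE : E.carrier ⊆ units G)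
    (h : ∀ p ∈ P.carrier, ∀ q ∈ Q.carrier, src p ∈ E.carrier → src q ∈ E.carrier →
      rng p ≠ rng q) : E.ind * star P.ind * Q.ind * E.ind = 0 := by
  rw [← ind_inv, ← ind_mul, ← ind_mul, ← ind_mul]
  refine ind_eq_zero fun γ hγ => ?_
  obtain ⟨_, ⟨_, ⟨e, he, p, hp, hc1, rfl⟩, q, hq, hc2, rfl⟩, f, hf, hc3, rfl⟩ := hγ
  rw [src_mul _ _ hc1] at hc2
  rw [src_mul _ _ (by rw [src_mul _ _ hc1, hc2]), rng_eq_of_src_eq (mem_units_iff.1 (hE hf))] at hc3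
  rw [mem_units_iff.1 (hE he)] at hc1
  refine h p⁻¹ hp q hq ?_ ?_ ?_
  · rwa [src_inv, ← hc1]
  · rwa [hc3]
  · rw [rng_inv, hc2]

theorem notMem_units_of_disjoint {V : Bisection G}
    (h : Disjoint (rng '' V.carrier) (src '' V.carrier)) {γ : G} (hγ : γ ∈ V.carrier) :
    γ ∉ units G := fun hu =>
  Set.disjoint_left.1 h ⟨γ, hγ, rfl⟩
    ⟨γ, hγ, by rw [mem_units_iff.1 hu, rng_eq_of_src_eq (mem_units_iff.1 hu)]⟩

theorem inv_notMem_of_disjoint {V : Bisection G}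
    (h : Disjoint (rng '' V.carrier) (src '' V.carrier)) {γ : G} (hγ : γ ∈ V.carrier) :
    γ⁻¹ ∉ V.carrier := fun hu =>
  Set.disjoint_left.1 h ⟨γ, hγ, rfl⟩ ⟨γ⁻¹, hu, src_inv γ⟩

/-- The element of the topological full group which exchanges the source and the range of a
bisection `V`, if these are disjoint, and is trivial elsewhere. -/
def swap (V : Bisection G) (h : Disjoint (rng '' V.carrier) (src '' V.carrier)) :
    TopFullGroup G where
  carrier := (V.carrier ∪ (V⁻¹).carrier) ∪ (units G \ (src '' V.carrier ∪ rng '' V.carrier))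
  isBisection :=
    { isCompact := (V.isBisection.isCompact.union V⁻¹.isBisection.isCompact).union
        (ConvAlg.isCompactOpenBisection_units.isCompact.diff
          (V.isClopen_src_image.isOpen.union V.isClopen_rng_image.isOpen))
      isOpen := (V.isBisection.isOpen.union V⁻¹.isBisection.isOpen).union
        (isOpen_units.sdiff (V.isClopen_src_image.isClosed.union V.isClopen_rng_image.isClosed))
      injOn_src := by
        have hd := Set.disjoint_left.1 h
        rintro a ((ha | ha) | ⟨ha, ha'⟩) b ((hb | hb) | ⟨hb, hb'⟩) he
        · exact V.isBisection.injOn_src ha hb he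
        · exact absurd ⟨a, ha, he⟩ (hd ⟨b⁻¹, hb, rng_inv b⟩)
        · exact absurd (Or.inl ⟨a, ha, he.trans (mem_units_iff.1 hb)⟩) hb'
        · exact absurd ⟨b, hb, he.symm⟩ (hd ⟨a⁻¹, ha, rng_inv a⟩)
        · exact V⁻¹.isBisection.injOn_src ha hb he
        · exact absurd (Or.inr ⟨a⁻¹, ha, (rng_inv a).trans (he.trans (mem_units_iff.1 hb))⟩) hb'
        · exact absurd (Or.inl ⟨b, hb, he.symm.trans (mem_units_iff.1 ha)⟩) ha'
        · exact absurd
            (Or.inr ⟨b⁻¹, hb, (rng_inv b).trans (he.symm.trans (mem_units_iff.1 ha))⟩) ha'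
        · exact ConvAlg.isCompactOpenBisection_units.injOn_src ha hb he
      injOn_rng := by
        have hd := Set.disjoint_left.1 h
        have hu : ∀ {a : G}, a ∈ units G → rng a = a :=
          fun ha => rng_eq_of_src_eq (mem_units_iff.1 ha)
        rintro a ((ha | ha) | ⟨ha, ha'⟩) b ((hb | hb) | ⟨hb, hb'⟩) he
        · exact V.isBisection.injOn_rng ha hb he
        · exact absurd ⟨b⁻¹, hb, (src_inv b).trans he.symm⟩ (hd ⟨a, ha, rfl⟩)
        · exact absurd (Or.inr ⟨a, ha, he.trans (hu hb)⟩) hb'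
        · exact absurd ⟨a⁻¹, ha, (src_inv a).trans he⟩ (hd ⟨b, hb, rfl⟩)
        · exact V⁻¹.isBisection.injOn_rng ha hb he
        · exact absurd (Or.inl ⟨a⁻¹, ha, (src_inv a).trans (he.trans (hu hb))⟩) hb'
        · exact absurd (Or.inr ⟨b, hb, he.symm.trans (hu ha)⟩) ha'
        · exact absurd (Or.inl ⟨b⁻¹, hb, (src_inv b).trans (he.symm.trans (hu ha))⟩) ha'
        · exact ConvAlg.isCompactOpenBisection_units.injOn_rng ha hb he }
  src_image := by
    apply Set.Subset.antisymm
    · rintro _ ⟨γ, _, rfl⟩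
      exact src_mem γ
    · intro x hx
      by_cases hs : x ∈ src '' V.carrier ∪ rng '' V.carrier
      · rcases hs with ⟨g, hg, rfl⟩ | ⟨g, hg, rfl⟩
        · exact ⟨g, Or.inl (Or.inl hg), rfl⟩
        · exact ⟨g⁻¹, Or.inl (Or.inr (by rwa [mem_inv, inv_inv])), src_inv g⟩
      · exact ⟨x, Or.inr ⟨hx, hs⟩, mem_units_iff.1 hx⟩
  rng_image := by
    apply Set.Subset.antisymm
    · rintro _ ⟨γ, _, rfl⟩
      exact rng_mem γ
    · intro x hx
      by_cases hs : x ∈ src '' V.carrier ∪ rng '' V.carrier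
      · rcases hs with ⟨g, hg, rfl⟩ | ⟨g, hg, rfl⟩
        · exact ⟨g⁻¹, Or.inl (Or.inr (by rwa [mem_inv, inv_inv])), rng_inv g⟩
        · exact ⟨g, Or.inl (Or.inl hg), rfl⟩
      · exact ⟨x, Or.inr ⟨hx, hs⟩, rng_eq_of_src_eq (mem_units_iff.1 hx)⟩

/-- With `v = V.ind`, the swap is `v + v*` plus the projection complementary to the orthogonal
projections `v*v` and `vv*`. The right-hand side equals `(v - v*v)(v - v*v)*`; for `v = q e p*` it
becomes `(p - q) e (p - q)*`. The two halves of the proof rest on these two factorisations. -/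
theorem one_sub_ind_swap (V : Bisection G) (h : Disjoint (rng '' V.carrier) (src '' V.carrier)) :
    1 - (V.swap h).ind =
      star V.ind * V.ind + V.ind * star V.ind - V.ind - star V.ind := by
  have hd := Set.disjoint_left.1 h
  -- Once the negative terms are moved across, both sides are sums of indicator functions and can be
  -- compared pointwise: units in the source, in the range or in neither, then other arrows in `V`,
  -- in `V⁻¹` or in neither.
  have key : 1 + (V.ind + star V.ind) =
      star V.ind * V.ind + V.ind * star V.ind + (V.swap h).ind := by
    rw [← ind_inv, ← ind_mul, ← ind_mul, ← ind_one]
    have hmem : ∀ γ, γ ∈ (V.swap h).carrier ↔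
      (γ ∈ V.carrier ∨ γ ∈ (V⁻¹).carrier) ∨
        (γ ∈ units G ∧ ¬ (γ ∈ src '' V.carrier ∨ γ ∈ rng '' V.carrier)) := fun γ => Iff.rfl
    have hS : ∀ γ, γ ∈ src '' V.carrier → γ ∈ units G := by
      rintro _ ⟨γ, _, rfl⟩
      exact src_mem γ
    have hR : ∀ γ, γ ∈ rng '' V.carrier → γ ∈ units G := by
      rintro _ ⟨γ, _, rfl⟩
      exact rng_mem γ
    have hVi : ∀ γ, γ ∈ (V⁻¹).carrier → γ ∉ units G := fun γ hγ hu => by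
      have e := inv_src γ
      rw [mem_units_iff.1 hu] at e
      rw [mem_inv, e] at hγ
      exact notMem_units_of_disjoint h hγ hu
    refine ConvAlg.ext fun γ => ?_
    simp only [ConvAlg.add_apply]
    classical
    have e : ∀ W : Bisection G, W.ind γ = if γ ∈ W.carrier then 1 else 0 := fun W => by
      split_ifs with hw
      · exact ind_of_mem hw
      · exact ind_of_notMem hw
    have e' : (V.swap h).ind γ = if γ ∈ (V.swap h).carrier then 1 else 0 := by
      split_ifs with hw
      · exact TopFullGroup.ind_of_mem hw
      · exact TopFullGroup.ind_of_notMem hw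
    rw [e, e, e, e, e, e']
    simp only [mem_inv_mul_self, mem_mul_inv_self, hmem, carrier_one]
    by_cases hu : γ ∈ units G
    · have h1 : γ ∉ V.carrier := fun h1 => notMem_units_of_disjoint h h1 hu
      have h2 : γ ∉ (V⁻¹).carrier := fun h1 => hVi γ h1 hu
      by_cases hs : γ ∈ src '' V.carrier
      · have hr : γ ∉ rng '' V.carrier := fun hr => hd hr hs
        simp [hu, h1, h2, hs, hr, -Set.mem_image]
      · by_cases hr : γ ∈ rng '' V.carrier
        · simp [hu, h1, h2, hs, hr, -Set.mem_image]
        · simp [hu, h1, h2, hs, hr, -Set.mem_image]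
    · have hs : γ ∉ src '' V.carrier := fun hs => hu (hS γ hs)
      have hr : γ ∉ rng '' V.carrier := fun hr => hu (hR γ hr)
      by_cases h1 : γ ∈ V.carrier
      · have h2 : γ ∉ (V⁻¹).carrier := inv_notMem_of_disjoint h h1
        simp [hu, h1, h2, hs, hr, -Set.mem_image]
      · by_cases h2 : γ ∈ (V⁻¹).carrier
        · simp [hu, h1, h2, hs, hr, -Set.mem_image]
        · simp [hu, h1, h2, hs, hr, -Set.mem_image]
  rw [sub_sub, sub_eq_sub_iff_add_eq_add, key]

end Bisection

end TopologicalGroupoid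

/-! ### The augmentation ideal near a unit -/

namespace TopologicalGroupoid

variable {G : Type u} [TopologicalSpace G] [TopologicalGroupoid G] [IsAmple G]
  [CompactSpace (units G)]

set_option linter.unusedSectionVars false

variable (G) in
/-- The image in `C_c(G)` of the augmentation ideal of the group algebra of `[[G]]`. -/
noncomputable def augmentation : Submodule ℂ (ConvAlg G) :=
  Submodule.span ℂ (Set.range fun U : TopFullGroup G => 1 - U.ind)

theorem one_sub_ind_mem_augmentation (U : TopFullGroup G) : 1 - U.ind ∈ augmentation G :=
  Submodule.subset_span ⟨U, rfl⟩

theorem mul_mem_augmentation {f g : ConvAlg G} (hf : f ∈ augmentation G)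
    (hg : g ∈ augmentation G) : f * g ∈ augmentation G := by
  induction hf using Submodule.span_induction with
  | mem f hf =>
    obtain ⟨U, rfl⟩ := hf
    induction hg using Submodule.span_induction with
    | mem g hg =>
      obtain ⟨V, rfl⟩ := hg
      have e : (1 - U.ind) * (1 - V.ind) = (1 - U.ind) + (1 - V.ind) - (1 - (U * V).ind) := by
        rw [TopFullGroup.ind_mul]
        noncomm_ring
      simp only [e]
      exact sub_mem (add_mem (one_sub_ind_mem_augmentation U) (one_sub_ind_mem_augmentation V))
        (one_sub_ind_mem_augmentation _)
    | zero => rw [mul_zero]; exact zero_mem _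
    | add g g' _ _ h h' => rw [mul_add]; exact add_mem h h'
    | smul c g _ h => rw [mul_smul_comm]; exact Submodule.smul_mem _ _ h
  | zero => rw [zero_mul]; exact zero_mem _
  | add f f' _ _ h h' => rw [add_mul]; exact add_mem h h'
  | smul c f _ h => rw [smul_mul_assoc]; exact Submodule.smul_mem _ _ h

theorem star_mem_augmentation {f : ConvAlg G} (hf : f ∈ augmentation G) :
    star f ∈ augmentation G := by
  induction hf using Submodule.span_induction with
  | mem f hf =>
    obtain ⟨U, rfl⟩ := hf
    rw [star_sub, star_one, ← TopFullGroup.ind_inv]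
    exact one_sub_ind_mem_augmentation _
  | zero => rw [star_zero]; exact zero_mem _
  | add f f' _ _ h h' => rw [star_add]; exact add_mem h h'
  | smul c f _ h => rw [star_smul]; exact Submodule.smul_mem _ _ h

open Filter Topology

/-- The filter of the compact open bisections which are contained in small neighbourhoods of
a point. -/
def smallBisections (b : G) : Filter (Bisection G) :=
  (𝓝 b).smallSets.comap Bisection.carrier

theorem eventually_smallBisections {b : G} {O : Set G} (hO : O ∈ 𝓝 b) :
    ∀ᶠ E in smallBisections b, E.carrier ⊆ O :=
  (eventually_smallSets_subset.2 hO).comap _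

theorem exists_of_eventually_smallBisections {b : G} {p : Bisection G → Prop}
    (h : ∀ᶠ E in smallBisections b, p E) :
    ∃ O : Set G, IsOpen O ∧ b ∈ O ∧ ∀ E : Bisection G, E.carrier ⊆ O → p E := by
  rw [smallBisections, eventually_comap, eventually_smallSets] at h
  obtain ⟨s, hs, h⟩ := h
  obtain ⟨O, hOs, hO, hb⟩ := mem_nhds_iff.1 hs
  exact ⟨O, hO, hb, fun E hE => h _ (hE.trans hOs) E rfl⟩

theorem eventually_subset_units {b : G} (hb : b ∈ units G) :
    ∀ᶠ E in smallBisections b, E.carrier ⊆ units G :=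
  eventually_smallBisections (isOpen_units.mem_nhds hb)

/-- The bisection `P` contains an arrow from `b` to `x`. -/
def Bisection.Maps (P : Bisection G) (b x : G) : Prop :=
  ∃ γ ∈ P.carrier, src γ = b ∧ rng γ = x

namespace Bisection.Maps

variable {P Q R : Bisection G} {b x y z : G}

theorem mem_units (hP : P.Maps b x) : b ∈ units G := by
  obtain ⟨γ, _, rfl, _⟩ := hP
  exact src_mem γ

theorem eventually_star_mul_self (hP : P.Maps b x) :
    ∀ᶠ E in smallBisections b, star P.ind * P.ind * E.ind = E.ind := by
  have hb := hP.mem_units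
  obtain ⟨γ, hγ, rfl, _⟩ := hP
  filter_upwards [eventually_smallBisections (P.isOpen_src_image.mem_nhds ⟨γ, hγ, rfl⟩),
    eventually_subset_units hb] with E hE hu
  exact ind_star_mul_self_mul hu hE

/-- Separate `x` and `y` by disjoint open sets. Since `src` is open, and injective on a bisection,
the arrows of `P` and of `Q` which start close to `b` end in the first and in the second of these
sets respectively. -/
theorem eventually_rng_ne (hP : P.Maps b x) (hQ : Q.Maps b y) (hxy : x ≠ y) :
    ∀ᶠ E in smallBisections b, ∀ p ∈ P.carrier, ∀ q ∈ Q.carrier,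
      src p ∈ E.carrier → src q ∈ E.carrier → rng p ≠ rng q := by
  obtain ⟨N, M, hN, hM, hxN, hyM, hd⟩ := t2_separation hxy
  have hopen : ∀ {P : Bisection G} {x : G} {N : Set G}, P.Maps b x → IsOpen N → x ∈ N →
      src '' (P.carrier ∩ rng ⁻¹' N) ∈ 𝓝 b := by
    rintro P x N ⟨γ, hγ, rfl, rfl⟩ hN hx
    exact (isOpen_image_src (P.isBisection.isOpen.inter (hN.preimage continuous_rng))).mem_nhds
      ⟨γ, ⟨hγ, hx⟩, rfl⟩
  filter_upwards [eventually_smallBisections (hopen hP hN hxN),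
    eventually_smallBisections (hopen hQ hM hyM)] with E h1 h2 p hp q hq hpE hqE he
  obtain ⟨p', ⟨hp', hpN⟩, hpp⟩ := h1 hpE
  obtain ⟨q', ⟨hq', hqM⟩, hqq⟩ := h2 hqE
  rw [P.isBisection.injOn_src hp' hp hpp] at hpN
  rw [Q.isBisection.injOn_src hq' hq hqq, Set.mem_preimage, ← he] at hqM
  exact Set.disjoint_left.1 hd hpN hqM

theorem eventually_star_mul_eq_zero (hP : P.Maps b x) (hQ : Q.Maps b y) (hxy : x ≠ y) :
    ∀ᶠ E in smallBisections b, E.ind * star P.ind * Q.ind * E.ind = 0 := by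
  filter_upwards [hP.eventually_rng_ne hQ hxy, eventually_subset_units hP.mem_units] with E h hE
  exact ind_star_mul_mul_eq_zero hE h

end Bisection.Maps

/-- `ξ 1_E η*` belongs to the augmentation ideal of `[[G]]`, if `E` is a small neighbourhood of the
unit `b`. -/
def AugRel (b : G) (ξ η : ConvAlg G) : Prop :=
  ∀ᶠ E in smallBisections b, ξ * E.ind * star η ∈ augmentation G

namespace AugRel

variable {b : G} {ξ ξ' η η' ζ : ConvAlg G}

theorem symm (hb : b ∈ units G) (h : AugRel b ξ η) : AugRel b η ξ := by
  filter_upwards [h, eventually_subset_units hb] with E h hE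
  have h2 := star_mem_augmentation h
  rwa [star_mul, star_mul, star_star, Bisection.star_ind hE, ← _root_.mul_assoc] at h2

theorem add_left (h : AugRel b ξ η) (h' : AugRel b ξ' η) : AugRel b (ξ + ξ') η := by
  filter_upwards [h, h'] with E h h'
  rw [add_mul, add_mul]
  exact add_mem h h'

theorem neg_left (h : AugRel b ξ η) : AugRel b (-ξ) η := by
  filter_upwards [h] with E h
  rw [neg_mul, neg_mul]
  exact neg_mem h

/-- In the product of `ξ 1_E η*` and `η' 1_E ζ*` the middle factor `1_E η* η' 1_E` collapses to a
nonzero multiple of `1_E`. Only the stability of the augmentation ideal under products is used. -/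
theorem comp (hb : b ∈ units G) (h : AugRel b ξ η) (h' : AugRel b η' ζ) {c : ℂ} (hc : c ≠ 0)
    (he : ∀ᶠ E in smallBisections b, E.ind * star η * η' * E.ind = c • E.ind) :
    AugRel b ξ ζ := by
  filter_upwards [h, h', he, eventually_subset_units hb] with E h h' he hE
  have h2 := mul_mem_augmentation h h'
  have e : ξ * E.ind * star η * (η' * E.ind * star ζ) =
      ξ * (E.ind * star η * η' * E.ind) * star ζ := by noncomm_ring
  rw [e, he, mul_smul_comm, smul_mul_assoc] at h2
  have h3 := Submodule.smul_mem _ c⁻¹ h2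
  rwa [smul_smul, inv_mul_cancel₀ hc, one_smul] at h3

end AugRel

section Equivalence

open Bisection

variable {P P' Q Q' R : Bisection G} {b x x' y y' z : G}

/-- For small `E` the bisection `Q E P⁻¹` carries a neighbourhood of `x` in the unit space to a
disjoint neighbourhood of `y`. Its swap belongs to `[[G]]`, and `1 - swap = (p - q) 1_E (p - q)*`.
-/
theorem augRel_self (hP : P.Maps b x) (hQ : Q.Maps b y) (hxy : x ≠ y) :
    AugRel b (P.ind - Q.ind) (P.ind - Q.ind) := by
  filter_upwards [eventually_subset_units hP.mem_units, hP.eventually_star_mul_self,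
    hQ.eventually_star_mul_self, hP.eventually_rng_ne hQ hxy] with E hE h1 h2 h3
  have hd : Disjoint (rng '' (Q * E * P⁻¹).carrier) (src '' (Q * E * P⁻¹).carrier) := by
    rw [Set.disjoint_left]
    rintro _ ⟨_, ⟨_, ⟨q, hq, e, he, hc1, rfl⟩, p, hp, hc2, rfl⟩, rfl⟩
      ⟨_, ⟨_, ⟨q', hq', e', he', hc1', rfl⟩, p', hp', hc2', rfl⟩, h⟩
    rw [rng_mul _ _ hc2, rng_mul _ _ hc1, src_mul _ _ hc2'] at h
    rw [src_mul _ _ hc1', mem_units_iff.1 (hE he')] at hc2'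
    rw [rng_eq_of_src_eq (mem_units_iff.1 (hE he))] at hc1
    refine h3 p'⁻¹ hp' q hq ?_ ?_ ?_
    · rwa [src_inv, ← hc2']
    · rwa [hc1]
    · rw [rng_inv, h]
  have h4 := one_sub_ind_mem_augmentation ((Q * E * P⁻¹).swap hd)
  rw [one_sub_ind_swap, ind_mul, ind_mul, ind_inv, star_mul, star_mul, star_star, star_ind hE]
    at h4
  have e1 : P.ind * (E.ind * star Q.ind) * (Q.ind * E.ind * star P.ind) =
      P.ind * E.ind * star P.ind := by
    have : P.ind * (E.ind * star Q.ind) * (Q.ind * E.ind * star P.ind) =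
      P.ind * E.ind * (star Q.ind * Q.ind * E.ind) * star P.ind := by noncomm_ring
    rw [this, h2, _root_.mul_assoc P.ind, ind_mul_self hE]
  have e2 : Q.ind * E.ind * star P.ind * (P.ind * (E.ind * star Q.ind)) =
      Q.ind * E.ind * star Q.ind := by
    have : Q.ind * E.ind * star P.ind * (P.ind * (E.ind * star Q.ind)) =
      Q.ind * E.ind * (star P.ind * P.ind * E.ind) * star Q.ind := by noncomm_ring
    rw [this, h1, _root_.mul_assoc Q.ind, ind_mul_self hE]
  rw [e1, e2] at h4
  convert h4 using 1
  rw [star_sub]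
  noncomm_ring

/-- Compose the self-relations of `p - q` and `p - r`. Over a small `E` the three partial isometries
have orthogonal ranges, so of `1_E (p - q)* (p - r) 1_E` only `1_E p*p 1_E = 1_E` survives. -/
theorem augRel_of_ne (hP : P.Maps b x) (hQ : Q.Maps b y) (hR : R.Maps b z) (hxy : x ≠ y)
    (hxz : x ≠ z) (hyz : y ≠ z) : AugRel b (P.ind - Q.ind) (P.ind - R.ind) := by
  refine (augRel_self hP hQ hxy).comp hP.mem_units (augRel_self hP hR hxz) one_ne_zero ?_
  filter_upwards [eventually_subset_units hP.mem_units, hP.eventually_star_mul_self,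
    hP.eventually_star_mul_eq_zero hR hxz, hQ.eventually_star_mul_eq_zero hP hxy.symm,
    hQ.eventually_star_mul_eq_zero hR hyz] with E hE h1 h2 h3 h4
  have e : E.ind * star (P.ind - Q.ind) * (P.ind - R.ind) * E.ind =
      E.ind * (star P.ind * P.ind * E.ind) - E.ind * star P.ind * R.ind * E.ind -
        E.ind * star Q.ind * P.ind * E.ind + E.ind * star Q.ind * R.ind * E.ind := by
    rw [star_sub]
    noncomm_ring
  rw [e, h1, h2, h3, h4, ind_mul_self hE, one_smul]
  abel

theorem eventually_star_sub_mul_sub (hP : P.Maps b x) (hQ : Q.Maps b y) (hxy : x ≠ y) :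
    ∀ᶠ E in smallBisections b,
      E.ind * star (P.ind - Q.ind) * (P.ind - Q.ind) * E.ind = (2 : ℂ) • E.ind := by
  filter_upwards [eventually_subset_units hP.mem_units, hP.eventually_star_mul_self,
    hQ.eventually_star_mul_self, hP.eventually_star_mul_eq_zero hQ hxy,
    hQ.eventually_star_mul_eq_zero hP hxy.symm] with E hE h1 h2 h3 h4
  have e : E.ind * star (P.ind - Q.ind) * (P.ind - Q.ind) * E.ind =
      E.ind * (star P.ind * P.ind * E.ind) - E.ind * star P.ind * Q.ind * E.ind -
        E.ind * star Q.ind * P.ind * E.ind + E.ind * (star Q.ind * Q.ind * E.ind) := by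
    rw [star_sub]
    noncomm_ring
  rw [e, h1, h2, h3, h4, ind_mul_self hE, two_smul]
  abel

/-- Transitivity through `p - q` holds when the two ends are distinct: the middle factor is then `2
• 1_E`, one copy of `1_E` from each of the orthogonal partial isometries. -/
theorem AugRel.trans {ξ ζ : ConvAlg G} (hP : P.Maps b x) (hQ : Q.Maps b y) (hxy : x ≠ y)
    (h : AugRel b ξ (P.ind - Q.ind)) (h' : AugRel b (P.ind - Q.ind) ζ) : AugRel b ξ ζ :=
  h.comp hP.mem_units h' two_ne_zero (eventually_star_sub_mul_sub hP hQ hxy)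

theorem exists_maps_of_three_le
    (horbit : ∀ x : units G, 3 ≤ (orbit x).encard) (hb : b ∈ units G) (x y : G) :
    ∃ (R : Bisection G) (z : G), R.Maps b z ∧ z ≠ x ∧ z ≠ y := by
  have h : ∃ z ∈ orbit (⟨b, hb⟩ : units G), z ∉ ({x, y} : Set G) := by
    by_contra! hc
    have h1 := (horbit ⟨b, hb⟩).trans ((Set.encard_le_encard hc).trans ((Set.encard_insert_le _ _).trans
      (by rw [Set.encard_singleton])))
    norm_num at h1
  obtain ⟨z, ⟨γ, hγ, rfl⟩, hz⟩ := h
  obtain ⟨R, hR⟩ := Bisection.exists_mem γ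
  simp only [Set.mem_insert_iff, Set.mem_singleton_iff, not_or] at hz
  exact ⟨R, _, ⟨γ, hR, hγ, rfl⟩, hz.1, hz.2⟩

theorem augRel_change_left (horbit : ∀ x : units G, 3 ≤ (orbit x).encard)
    (hP : P.Maps b x) (hP' : P'.Maps b x') (hQ : Q.Maps b y) (h : x ≠ y) (h' : x' ≠ y) :
    AugRel b (P.ind - Q.ind) (P'.ind - Q.ind) := by
  have key : ∀ {P P' : Bisection G} {x x' : G}, P.Maps b x → P'.Maps b x' → x ≠ y → x' ≠ y →
      x ≠ x' → AugRel b (P.ind - Q.ind) (P'.ind - Q.ind) := by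
    intro P P' x x' hP hP' h h' hne
    have h1 := (augRel_of_ne hQ hP hP' h.symm h'.symm hne).neg_left
    have h2 := (h1.symm hP.mem_units).neg_left
    have h3 := h2.symm hP.mem_units
    rwa [neg_sub, neg_sub] at h3
  -- Equal ends do not make `P` and `P'` equal, and `key` does not apply to them; a third point `z`
  -- of the orbit serves as an intermediate end.
  by_cases hne : x = x'
  · obtain ⟨R, z, hR, hzx, hzy⟩ := exists_maps_of_three_le horbit hP.mem_units x y
    exact (key hP hR h hzy hzx.symm).trans hR hQ hzy (key hR hP' hzy h' (hne ▸ hzx))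
  · exact key hP hP' h h' hne

theorem AugRel.neg_neg {ξ η : ConvAlg G} (hb : b ∈ units G) (h : AugRel b ξ η) :
    AugRel b (-ξ) (-η) :=
  ((h.symm hb).neg_left.symm hb).neg_left

theorem augRel_change_right (horbit : ∀ x : units G, 3 ≤ (orbit x).encard)
    (hP : P.Maps b x) (hQ : Q.Maps b y) (hQ' : Q'.Maps b y') (h : x ≠ y) (h' : x ≠ y') :
    AugRel b (P.ind - Q.ind) (P.ind - Q'.ind) := by
  have := (augRel_change_left horbit hQ hQ' hP h.symm h'.symm).neg_neg hP.mem_units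
  rwa [neg_sub, neg_sub] at this

theorem augRel_of_ne_of_ne (horbit : ∀ x : units G, 3 ≤ (orbit x).encard)
    (hP : P.Maps b x) (hQ : Q.Maps b y) (hP' : P'.Maps b x') (hQ' : Q'.Maps b y')
    (h : x ≠ y) (h' : x' ≠ y') : AugRel b (P.ind - Q.ind) (P'.ind - Q'.ind) := by
  -- If `x' = y`, the intermediate difference `p' - q` would have equal ends. The chain `p - q`, `p
  -- - p'`, `q' - p'` avoids this, and a sign change leads to `p' - q'`.
  by_cases hy : x' = y
  · subst hy
    have h1 := augRel_change_right horbit hP hQ hP' h h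
    have h2 := augRel_change_left horbit hP hQ' hP' h h'.symm
    have h3 := h1.trans hP hP' h h2
    have h4 := ((h3.symm hP.mem_units).neg_left).symm hP.mem_units
    rwa [neg_sub] at h4
  · exact (augRel_change_left horbit hP hP' hQ h hy).trans hP' hQ hy
      (augRel_change_right horbit hP' hQ hQ' hy h')

/-- The relation is additive in its left argument, so `p - q = (p - r) + (r - q)` with `r` ending at
a third point removes the condition on the ends of `p` and `q`. -/
theorem augRel_of_ne_left (horbit : ∀ x : units G, 3 ≤ (orbit x).encard)
    (hP : P.Maps b x) (hQ : Q.Maps b y) (hP' : P'.Maps b x') (hQ' : Q'.Maps b y')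
    (h' : x' ≠ y') : AugRel b (P.ind - Q.ind) (P'.ind - Q'.ind) := by
  obtain ⟨R, z, hR, hzx, hzy⟩ := exists_maps_of_three_le horbit hP.mem_units x y
  have := (augRel_of_ne_of_ne horbit hP hR hP' hQ' hzx.symm h').add_left
    (augRel_of_ne_of_ne horbit hR hQ hP' hQ' hzy h')
  rwa [sub_add_sub_cancel] at this

/-- The ends must be allowed to coincide: in the application the bisections are `W` and `UW`, and
`U` may fix the range of the given arrow. The same splitting is made on the right, after passing to
adjoints. -/
theorem augRel_of_maps (horbit : ∀ x : units G, 3 ≤ (orbit x).encard)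
    (hP : P.Maps b x) (hQ : Q.Maps b y) (hP' : P'.Maps b x') (hQ' : Q'.Maps b y') :
    AugRel b (P.ind - Q.ind) (P'.ind - Q'.ind) := by
  obtain ⟨R, z, hR, hzx, hzy⟩ := exists_maps_of_three_le horbit hP.mem_units x' y'
  have := ((augRel_of_ne_left horbit hP hQ hP' hR hzx.symm).symm hP.mem_units).add_left
    ((augRel_of_ne_left horbit hP hQ hR hQ' hzy).symm hP.mem_units)
  rw [sub_add_sub_cancel] at this
  exact this.symm hP.mem_units

end Equivalence

end TopologicalGroupoid

/-! ### The closed augmentation ideal, and the absence of characters -/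

namespace TopologicalGroupoid

variable {G : Type u} [TopologicalSpace G] [TopologicalGroupoid G] [IsAmple G]
  [CompactSpace (units G)]

set_option linter.unusedSectionVars false

/-- Right multiplication by a function supported on the unit space. -/
theorem ConvAlg.mul_apply_of_units_right {f : ConvAlg G} (hf : ∀ x, x ∉ units G → f x = 0)
    (g : ConvAlg G) (γ : G) : (g * f) γ = g γ * f (src γ) := by
  have hs : ∀ x, x ∉ units G → star f x = 0 := by
    intro x hx
    rw [star_apply, hf, map_zero]
    intro h
    have e := inv_src x⁻¹
    rw [mem_units_iff.1 h, inv_inv] at e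
    exact hx (e ▸ h)
  have h := mul_apply_of_units hs (star g) γ⁻¹
  rw [← star_mul, star_apply, star_apply, star_apply, inv_inv, rng_inv, inv_src, ← map_mul] at h
  rw [(starRingEnd ℂ).injective h, mul_comm]

/-- The restriction to the unit space of a function in `C_c(G)`. -/
def restrictUnits (f : ConvAlg G) : C(units G, ℂ) :=
  ⟨fun x => f x, f.continuous.comp continuous_subtype_val⟩

theorem restrictUnits_apply (f : ConvAlg G) (x : units G) : restrictUnits f x = f x := rfl

theorem extend_restrictUnits {f : ConvAlg G} (hf : ∀ x, x ∉ units G → f x = 0) :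
    extend (restrictUnits f) = f := by
  refine ConvAlg.ext fun γ => ?_
  by_cases h : γ ∈ units G
  · rw [extend_apply_of_mem _ h]
    rfl
  · rw [extend_apply_of_notMem _ h, hf _ h]

theorem star_ind_mul_apply_of_notMem_units {W : Bisection G} {f : ConvAlg G}
    (hf : ∀ x, x ∉ W.carrier → f x = 0) {γ : G} (hγ : γ ∉ units G) :
    (star W.ind * f) γ = 0 := by
  rw [← Bisection.ind_inv, ConvAlg.mul_apply_of_bisection W⁻¹.isBisection
    (fun x hx => Bisection.ind_of_notMem hx)]
  by_cases h1 : sec (W⁻¹).carrier γ ∈ (W⁻¹).carrier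
  swap
  · rw [Bisection.ind_of_notMem h1, zero_mul]
  by_cases h2 : (sec (W⁻¹).carrier γ)⁻¹ * γ ∈ W.carrier
  swap
  · rw [hf _ h2, mul_zero]
  have hr : rng (sec (W⁻¹).carrier γ) = rng γ := rng_sec
  have e := W.isBisection.injOn_rng h2 h1 (rng_mul _ _ (by rw [src_inv, hr]))
  have h3 := mul_inv_cancel_left _ _ hr
  rw [e, TopologicalGroupoid.mul_inv] at h3
  exact absurd (h3 ▸ rng_mem _) hγ

theorem ind_mul_star_ind_mul {W : Bisection G} {f : ConvAlg G}
    (hf : ∀ x, x ∉ W.carrier → f x = 0) : W.ind * (star W.ind * f) = f := by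
  rw [← _root_.mul_assoc, ← Bisection.ind_inv, ← Bisection.ind_mul]
  refine ConvAlg.ext fun γ => ?_
  rw [ConvAlg.mul_apply_of_units]
  · by_cases hγ : γ ∈ W.carrier
    · rw [Bisection.ind_of_mem (Bisection.mem_mul_inv_self.2 ⟨γ, hγ, rfl⟩), one_mul]
    · rw [hf γ hγ, mul_zero]
  · intro x hx
    refine Bisection.ind_of_notMem fun h => hx ?_
    obtain ⟨g, _, rfl⟩ := Bisection.mem_mul_inv_self.1 h
    exact rng_mem g

/-- Functions supported on a bisection are products of its indicator function and of a function
on the unit space. -/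
theorem eq_ind_mul_extend {W : Bisection G} {f : ConvAlg G}
    (hf : ∀ x, x ∉ W.carrier → f x = 0) :
    W.ind * extend (restrictUnits (star W.ind * f)) = f := by
  rw [extend_restrictUnits fun _ => star_ind_mul_apply_of_notMem_units hf, ind_mul_star_ind_mul hf]

/-- Restricting to `W` and then to sources in `B` amounts to restricting `V` to sources in `E`. Thus
one bisection `V` can be fixed around an arrow, and only the set of units `E` varies. -/
theorem ind_mul_extend_clopenIndicator {V W E : Bisection G} (hWV : W.carrier ⊆ V.carrier)
    {B : Set (units G)} (hB : IsClopen B)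
    (hE : E.carrier = src '' W.carrier ∩ Subtype.val '' B) :
    W.ind * extend (clopenIndicator B hB) = V.ind * E.ind := by
  have hEu : E.carrier ⊆ units G := by
    rw [hE]
    rintro _ ⟨_, x, _, rfl⟩
    exact x.2
  refine ConvAlg.ext fun γ => ?_
  rw [ConvAlg.mul_apply_of_units_right fun x hx => extend_apply_of_notMem _ hx,
    ConvAlg.mul_apply_of_units_right fun x hx => Bisection.ind_of_notMem fun h => hx (hEu h),
    extend_apply_of_mem _ (src_mem γ), clopenIndicator_apply]
  by_cases hB : (⟨src γ, src_mem γ⟩ : units G) ∈ B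
  · rw [Set.indicator_of_mem hB, mul_one]
    by_cases hW : γ ∈ W.carrier
    · have : src γ ∈ E.carrier := by
        rw [hE]
        exact ⟨⟨γ, hW, rfl⟩, _, hB, rfl⟩
      rw [Bisection.ind_of_mem hW, Bisection.ind_of_mem (hWV hW), Bisection.ind_of_mem this,
        mul_one]
    · rw [Bisection.ind_of_notMem hW]
      by_cases hV : γ ∈ V.carrier
      · have : src γ ∉ E.carrier := by
          rw [hE]
          rintro ⟨⟨w, hw, hs⟩, _⟩
          exact hW (V.isBisection.injOn_src (hWV hw) hV hs ▸ hw)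
        rw [Bisection.ind_of_notMem this, mul_zero]
      · rw [Bisection.ind_of_notMem hV, zero_mul]
  · have : src γ ∉ E.carrier := by
      rw [hE]
      rintro ⟨_, y, hy, hs⟩
      exact hB ((Subtype.ext hs : y = ⟨src γ, src_mem γ⟩) ▸ hy)
    rw [Set.indicator_of_notMem hB, mul_zero, Bisection.ind_of_notMem this, mul_zero]

/-- Elements of the topological full group, as bisections. -/
def TopFullGroup.toBisection (U : TopFullGroup G) : Bisection G := ⟨U.carrier, U.isBisection⟩

theorem TopFullGroup.ind_toBisection (U : TopFullGroup G) : U.toBisection.ind = U.ind := rfl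

/-- The product is `(w - uw) 1_E (1 - v*)*`. The bisections `W`, `UW`, `G⁰` and `V⁻¹` all contain an
arrow leaving `src γ`, so `augRel_of_maps` applies. -/
theorem exists_nhds_one_sub_mul_mem_augmentation
    (horbit : ∀ x : units G, 3 ≤ (orbit x).encard) (U V : TopFullGroup G) (W : Bisection G)
    {γ : G} (hγ : γ ∈ W.carrier) :
    ∃ O : Set G, IsOpen O ∧ src γ ∈ O ∧ ∀ E : Bisection G, E.carrier ⊆ O →
      (1 - U.ind) * (W.ind * E.ind) * (1 - V.ind) ∈ augmentation G := by
  apply exists_of_eventually_smallBisections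
  have hW : W.Maps (src γ) (rng γ) := ⟨γ, hγ, rfl, rfl⟩
  have hUW : ∃ x, (U.toBisection * W).Maps (src γ) x := by
    obtain ⟨g, hg, hs⟩ := U.exists_src γ
    exact ⟨_, g * γ, ⟨g, hg, γ, hγ, hs, rfl⟩, src_mul _ _ hs, rfl⟩
  have h1 : (1 : Bisection G).Maps (src γ) (src γ) := ⟨src γ, src_mem γ, src_src γ, rng_src γ⟩
  have hV : ∃ x, (V⁻¹).toBisection.Maps (src γ) x := by
    obtain ⟨g, hg, hs⟩ := (V⁻¹).exists_src (src γ)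
    rw [rng_src] at hs
    exact ⟨_, g, hg, hs, rfl⟩
  obtain ⟨x, hUW⟩ := hUW
  obtain ⟨y, hV⟩ := hV
  filter_upwards [augRel_of_maps horbit hW hUW h1 hV] with E hE
  rw [star_sub, Bisection.ind_one, star_one, TopFullGroup.ind_toBisection, TopFullGroup.ind_inv,
    star_star, Bisection.ind_mul, TopFullGroup.ind_toBisection] at hE
  convert hE using 1
  noncomm_ring

variable (G) in
/-- The inclusion of `C(G⁰)` in `C*(G)`. -/
noncomputable def unitsHom : C(units G, ℂ) →⋆ₙₐ[ℂ] FullCStar G :=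
  (FullCStar.of G : ConvAlg G →⋆ₙₐ[ℂ] FullCStar G).comp (extendHom G)

theorem continuous_unitsHom : Continuous (unitsHom G) :=
  AddMonoidHomClass.continuous_of_bound (unitsHom G) 1 fun k => by
    rw [one_mul]
    exact NonUnitalStarAlgHom.norm_apply_le (unitsHom G) k

theorem FullCStar.denseRange_of : DenseRange (FullCStar.of G) := denseRange_ofAlgHom

variable (G) in
/-- The closure in `C*(G)` of the augmentation ideal of `[[G]]`. -/
noncomputable def closedAugmentation : Submodule ℂ (FullCStar G) :=
  ((augmentation G).map (FullCStar.ofAlgHom G).toLinearMap).topologicalClosure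

theorem isClosed_closedAugmentation : IsClosed (closedAugmentation G : Set (FullCStar G)) :=
  Submodule.isClosed_topologicalClosure _

theorem of_mem_closedAugmentation {f : ConvAlg G} (hf : f ∈ augmentation G) :
    FullCStar.of G f ∈ closedAugmentation G :=
  Submodule.le_topologicalClosure _ ⟨f, hf, rfl⟩

/-- Near an arrow, `f` is `1_W'` times a function `k` on the unit space. Indicator functions of
clopen sets are covered by the algebraic statement, and a general `k` is a uniform limit of their
combinations; the closure is needed for this limit. -/
theorem one_sub_mul_mem_closedAugmentation
    (horbit : ∀ x : units G, 3 ≤ (orbit x).encard) (U V : TopFullGroup G) (f : ConvAlg G) :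
    FullCStar.of G ((1 - U.ind) * f * (1 - V.ind)) ∈ closedAugmentation G := by
  induction f using ConvAlg.local_induction with
  | zero => rw [mul_zero, zero_mul, map_zero]; exact zero_mem _
  | add f g hf hg => rw [mul_add, add_mul, map_add]; exact add_mem hf hg
  | nhds γ =>
    obtain ⟨W, hγW⟩ := Bisection.exists_mem γ
    obtain ⟨O, hO, hγO, h⟩ := exists_nhds_one_sub_mul_mem_augmentation horbit U V W hγW
    refine ⟨W.carrier ∩ src ⁻¹' O, W.isBisection.isOpen.inter (hO.preimage continuous_src),
      ⟨hγW, hγO⟩, fun W' hW' hb f hf => ?_⟩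
    let W₁ : Bisection G := ⟨W', hb⟩
    -- The map `k ↦ (1 - u) 1_W' k (1 - v)` is linear and continuous, so the functions `k` sent into
    -- the closed augmentation form a closed subspace.
    let L : C(units G, ℂ) →ₗ[ℂ] FullCStar G :=
      LinearMap.mulRight ℂ (FullCStar.of G (1 - V.ind)) ∘ₗ
        LinearMap.mulLeft ℂ (FullCStar.of G ((1 - U.ind) * W₁.ind)) ∘ₗ
          (unitsHom G : C(units G, ℂ) →ₗ[ℂ] FullCStar G)
    have hL : Continuous L := (continuous_const.mul continuous_unitsHom).mul continuous_const
    have hLk : ∀ k, L k = FullCStar.of G ((1 - U.ind) * (W₁.ind * extend k) * (1 - V.ind)) := by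
      intro k
      rw [← _root_.mul_assoc, map_mul _ (_ * _), map_mul _ (_ * _)]
      rfl
    have := IsAmple.totallyDisconnected (G := G)
    have hmem := ContinuousMap.mem_of_clopenIndicator_mem ((closedAugmentation G).comap L)
      (isClosed_closedAugmentation.preimage hL) (fun B hB => by
        rw [Submodule.mem_comap, hLk]
        have hBc : IsClopen (Subtype.val '' B : Set G) :=
          ⟨(hB.isClosed.isCompact.image continuous_subtype_val).isClosed,
            isOpen_units.isOpenMap_subtype_val _ hB.isOpen⟩
        let E := Bisection.ofClopen (src '' W₁.carrier ∩ Subtype.val '' B)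
          (W₁.isClopen_src_image.inter hBc) (by rintro _ ⟨_, x, _, rfl⟩; exact x.2)
        rw [ind_mul_extend_clopenIndicator (V := W) (E := E) (fun w hw => (hW' hw).1) hB rfl]
        refine of_mem_closedAugmentation (h E ?_)
        rintro _ ⟨⟨w, hw, rfl⟩, _⟩
        exact (hW' hw).2) (restrictUnits (star W₁.ind * f))
    rwa [Submodule.mem_comap, hLk, eq_ind_mul_extend hf] at hmem

theorem mul_mul_mem_closedAugmentation
    (horbit : ∀ x : units G, 3 ≤ (orbit x).encard) {f h : ConvAlg G} (hf : f ∈ augmentation G)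
    (hh : h ∈ augmentation G) (g : ConvAlg G) :
    FullCStar.of G (f * g * h) ∈ closedAugmentation G := by
  induction hf using Submodule.span_induction with
  | mem f hf =>
    obtain ⟨U, rfl⟩ := hf
    induction hh using Submodule.span_induction with
    | mem h hh =>
      obtain ⟨V, rfl⟩ := hh
      exact one_sub_mul_mem_closedAugmentation horbit U V g
    | zero => rw [mul_zero, map_zero]; exact zero_mem _
    | add g g' _ _ h h' => rw [mul_add, map_add]; exact add_mem h h'
    | smul c g _ h => rw [mul_smul_comm, map_smul]; exact Submodule.smul_mem _ _ h
  | zero => rw [zero_mul, zero_mul, map_zero]; exact zero_mem _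
  | add f f' _ _ h h' => rw [add_mul, add_mul, map_add]; exact add_mem h h'
  | smul c f _ h => rw [smul_mul_assoc, smul_mul_assoc, map_smul]; exact Submodule.smul_mem _ _ h

/-- In `f = 1 f 1` both factors `1` are limits of elements of the augmentation ideal, and for `g`,
`h` in that ideal `g f h` is in its closure. The two factors are replaced one at a time. -/
theorem closedAugmentation_eq_top (horbit : ∀ x : units G, 3 ≤ (orbit x).encard)
    (h1 : 1 ∈ closedAugmentation G) (a : FullCStar G) : a ∈ closedAugmentation G := by
  have key : ∀ {p : FullCStar G → Prop}, IsClosed {x | p x} →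
      (∀ f ∈ augmentation G, p (FullCStar.of G f)) → p 1 := by
    intro p hc hp
    refine closure_minimal ?_ hc h1
    rintro _ ⟨f, hf, rfl⟩
    exact hp f hf
  refine FullCStar.denseRange_of.induction_on (p := fun a => a ∈ closedAugmentation G) a
    isClosed_closedAugmentation fun f => ?_
  have e : FullCStar.of G f = 1 * FullCStar.of G f * 1 := by rw [one_mul, mul_one]
  rw [e]
  refine key (p := fun x => 1 * FullCStar.of G f * x ∈ closedAugmentation G)
    (isClosed_closedAugmentation.preimage (continuous_const.mul continuous_id)) fun h hh => ?_
  refine key (p := fun x => x * FullCStar.of G f * _ ∈ closedAugmentation G)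
    (isClosed_closedAugmentation.preimage
      ((continuous_id.mul continuous_const).mul continuous_const)) fun g hg => ?_
  rw [← map_mul, ← map_mul]
  exact mul_mul_mem_closedAugmentation horbit hg hh f

open TopFullGroup

theorem groupAlgebraHom_single {Γ A : Type*} [Group Γ] [CStarAlgebra A] (σ : Γ →* unitary A)
    (g : Γ) (c : ℂ) : groupAlgebraHom σ (MonoidAlgebra.single g c) = c • (σ g : A) := by
  rw [groupAlgebraHom, MonoidAlgebra.lift_single]
  rfl

theorem groupAlgebraHom_trivialRep_single {Γ : Type*} [Group Γ] (g : Γ) (c : ℂ) :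
    groupAlgebraHom (trivialRep Γ) (MonoidAlgebra.single g c) = c := by
  rw [groupAlgebraHom_single]
  simp [trivialRep]

theorem smul_one_sub_mem_closedAugmentation (a : MonoidAlgebra ℂ (TopFullGroup G)) :
    groupAlgebraHom (trivialRep (TopFullGroup G)) a • 1 - groupAlgebraHom (canonicalRep G) a ∈
      closedAugmentation G := by
  induction a using MonoidAlgebra.induction_linear with
  | zero => simp
  | add a b ha hb =>
    rw [map_add, map_add, add_smul, add_sub_add_comm]
    exact add_mem ha hb
  | single U c =>
    rw [groupAlgebraHom_trivialRep_single, groupAlgebraHom_single, ← smul_sub]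
    refine Submodule.smul_mem _ _ ?_
    have := of_mem_closedAugmentation (one_sub_ind_mem_augmentation U)
    rwa [map_sub, map_one] at this

/-- Failure of weak containment gives, after scaling, an element `a` of coefficient sum `1` with
`‖π(a)‖ < 1`. All powers of `a` have coefficient sum `1`, so `1 - π(a)^n` comes from the
augmentation ideal, and it tends to `1`. -/
theorem one_mem_closedAugmentation
    (h : ¬ WeaklyContains (canonicalRep G) (trivialRep (TopFullGroup G))) :
    1 ∈ closedAugmentation G := by
  rw [WeaklyContains] at h
  push Not at h
  obtain ⟨a, ha⟩ := h
  set c := groupAlgebraHom (trivialRep (TopFullGroup G)) a with hc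
  have hc0 : c ≠ 0 := fun h0 => by
    rw [h0, norm_zero] at ha
    exact absurd ha (not_lt.2 (norm_nonneg _))
  have h1 : groupAlgebraHom (trivialRep (TopFullGroup G)) (c⁻¹ • a) = 1 := by
    rw [map_smul, ← hc, smul_eq_mul, inv_mul_cancel₀ hc0]
  have h2 : ‖groupAlgebraHom (canonicalRep G) (c⁻¹ • a)‖ < 1 := by
    rw [map_smul, norm_smul, norm_inv, inv_mul_lt_iff₀ (norm_pos_iff.2 hc0), mul_one]
    exact ha
  have h3 : Filter.Tendsto (fun n : ℕ => 1 - groupAlgebraHom (canonicalRep G) (c⁻¹ • a) ^ n)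
      Filter.atTop (nhds (1 - 0)) :=
    tendsto_const_nhds.sub (tendsto_pow_atTop_nhds_zero_of_norm_lt_one h2)
  rw [sub_zero] at h3
  refine isClosed_closedAugmentation.mem_of_tendsto h3 (Filter.Eventually.of_forall fun n => ?_)
  have := smul_one_sub_mem_closedAugmentation ((c⁻¹ • a) ^ n)
  rwa [map_pow, map_pow, h1, one_pow, one_smul] at this

theorem closedAugmentation_le_generatedCStar {a : FullCStar G} (ha : a ∈ closedAugmentation G) :
    a ∈ generatedCStar (canonicalRep G) := by
  have hc : IsClosed (generatedCStar (canonicalRep G) : Set (FullCStar G)) :=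
    StarSubalgebra.isClosed_topologicalClosure _
  refine closure_minimal ?_ hc ha
  rintro _ ⟨f, hf, rfl⟩
  change FullCStar.of G f ∈ generatedCStar (canonicalRep G)
  induction hf using Submodule.span_induction with
  | mem f hf =>
    obtain ⟨U, rfl⟩ := hf
    simp only [map_sub, map_one]
    exact sub_mem (one_mem _)
      (StarSubalgebra.le_topologicalClosure _ (StarAlgebra.subset_adjoin ℂ _ ⟨U, rfl⟩))
  | zero => rw [map_zero]; exact zero_mem _
  | add f f' _ _ h h' => rw [map_add]; exact add_mem h h'
  | smul c f _ h => rw [map_smul]; exact SMulMemClass.smul_mem _ h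

theorem generatedCStar_eq_top (horbit : ∀ x : units G, 3 ≤ (orbit x).encard)
    (h : ¬ WeaklyContains (canonicalRep G) (trivialRep (TopFullGroup G))) :
    generatedCStar (canonicalRep G) = ⊤ :=
  eq_top_iff.2 fun a _ => closedAugmentation_le_generatedCStar
    (closedAugmentation_eq_top horbit (one_mem_closedAugmentation h) a)

/-- An arrow from `src γ` to another unit yields, over a small set of units `E`, an element `p e` of
square zero with `e = p* p e`. A character kills `p e`, hence every function supported near `γ`,
hence all of `C_c(G)`, including `1`. -/
theorem isEmpty_characterSpace_of_eq_top (horbit : ∀ x : units G, 3 ≤ (orbit x).encard)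
    (h : generatedCStar (canonicalRep G) = ⊤) :
    IsEmpty (WeakDual.characterSpace ℂ (generatedCStar (canonicalRep G))) := by
  refine ⟨fun χ => ?_⟩
  let i : ConvAlg G → generatedCStar (canonicalRep G) :=
    fun f => ⟨FullCStar.of G f, h ▸ StarSubalgebra.mem_top⟩
  have hmul : ∀ f g, χ (i (f * g)) = χ (i f) * χ (i g) := fun f g => by
    rw [← map_mul]
    exact congrArg χ (Subtype.ext (map_mul (FullCStar.of G) f g))
  have key : ∀ f, χ (i f) = 0 := by
    intro f
    induction f using ConvAlg.local_induction with
    | zero =>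
      rw [← map_zero χ]
      exact congrArg χ (Subtype.ext (map_zero (FullCStar.of G)))
    | add f g hf hg =>
      rw [← add_zero (0 : ℂ)]
      nth_rw 1 [← hf]
      rw [← hg, ← map_add]
      exact congrArg χ (Subtype.ext (map_add (FullCStar.of G) f g))
    | nhds γ =>
      obtain ⟨P, x, hP, hx, _⟩ := exists_maps_of_three_le horbit (src_mem γ) (src γ) (src γ)
      have h1 : (1 : Bisection G).Maps (src γ) (src γ) := ⟨src γ, src_mem γ, src_src γ, rng_src γ⟩
      obtain ⟨O, hO, hγO, hE⟩ := exists_of_eventually_smallBisections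
        ((hP.eventually_star_mul_self.and (h1.eventually_star_mul_eq_zero hP hx.symm)).and
          (eventually_subset_units (src_mem γ)))
      refine ⟨src ⁻¹' O, hO.preimage continuous_src, hγO, fun W hWO hW f hf => ?_⟩
      let E : Bisection G := Bisection.ofClopen (src '' W)
        (Bisection.isClopen_src_image ⟨W, hW⟩) (by rintro _ ⟨x, _, rfl⟩; exact src_mem x)
      obtain ⟨⟨h2, h3⟩, h4⟩ := hE E (by rintro _ ⟨x, hx, rfl⟩; exact hWO hx)
      rw [Bisection.ind_one, star_one, mul_one] at h3
      have hfE : f * E.ind = f := by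
        refine ConvAlg.ext fun δ => ?_
        rw [ConvAlg.mul_apply_of_units_right
          fun x hx => Bisection.ind_of_notMem fun h => hx (h4 h)]
        by_cases hδ : δ ∈ W
        · rw [Bisection.ind_of_mem (⟨δ, hδ, rfl⟩ : src δ ∈ E.carrier), mul_one]
        · rw [hf δ hδ, zero_mul]
      -- `E` and its image under `P` are disjoint, that is, `e p e = 0`; so `p e` has square zero.
      have e1 : χ (i (P.ind * E.ind)) = 0 := by
        rw [← mul_self_eq_zero, ← hmul]
        have : P.ind * E.ind * (P.ind * E.ind) = P.ind * (E.ind * P.ind * E.ind) := by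
          noncomm_ring
        rw [this, h3, mul_zero, ← map_zero χ]
        exact congrArg χ (Subtype.ext (map_zero (FullCStar.of G)))
      have e2 : f = f * star P.ind * (P.ind * E.ind) := by
        have e3 : f * E.ind = f * (star P.ind * P.ind * E.ind) := by rw [h2]
        rw [hfE] at e3
        exact e3.trans (by noncomm_ring)
      rw [e2, hmul, e1, mul_zero]
  have h1 := key 1
  have e : i 1 = 1 := Subtype.ext (map_one (FullCStar.of G))
  rw [e, map_one] at h1
  exact one_ne_zero h1

end TopologicalGroupoid

/-! ### Extension of the trivial character -/

namespace TopologicalGroupoid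

section Extension

variable {Γ A : Type*} [Group Γ] [CStarAlgebra A] {σ : Γ →* unitary A}

/-- If `σ` weakly contains the trivial representation, then the trivial character of `ℂΓ` extends
to a contractive functional on the whole C*-algebra. -/
theorem exists_extension_of_weaklyContains (h : WeaklyContains σ (trivialRep Γ)) :
    ∃ φ : A →L[ℂ] ℂ, (∀ a, ‖φ a‖ ≤ ‖a‖) ∧
      ∀ a, φ (groupAlgebraHom σ a) = groupAlgebraHom (trivialRep Γ) a := by
  let s : MonoidAlgebra ℂ Γ →ₗ[ℂ] A := (groupAlgebraHom σ).toLinearMap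
  let t : MonoidAlgebra ℂ Γ →ₗ[ℂ] ℂ := (groupAlgebraHom (trivialRep Γ)).toLinearMap
  -- Weak containment makes the coefficient sum well defined and contractive on the image of `ℂΓ`;
  -- Hahn–Banach then extends it without increasing the norm.
  have hker : LinearMap.ker s ≤ LinearMap.ker t := by
    intro a ha
    have h1 := h a
    have h2 : groupAlgebraHom σ a = 0 := ha
    rw [h2, norm_zero] at h1
    exact norm_le_zero_iff.1 h1
  let ψ : LinearMap.range s →ₗ[ℂ] ℂ :=
    (LinearMap.ker s).liftQ t hker ∘ₗ s.quotKerEquivRange.symm.toLinearMap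
  have hψ : ∀ a, ψ ⟨s a, LinearMap.mem_range_self s a⟩ = t a := by
    intro a
    have : s.quotKerEquivRange.symm ⟨s a, LinearMap.mem_range_self s a⟩ =
        Submodule.Quotient.mk a := by
      rw [LinearEquiv.symm_apply_eq]
      rfl
    change (LinearMap.ker s).liftQ t hker (s.quotKerEquivRange.symm _) = _
    rw [this]
    rfl
  let ψ' : StrongDual ℂ (LinearMap.range s) := ψ.mkContinuous 1 (by
    rintro ⟨_, a, rfl⟩
    rw [one_mul, hψ]
    exact h a)
  obtain ⟨φ, hφ, hn⟩ := exists_extension_norm_eq (LinearMap.range s) ψ'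
  refine ⟨φ, fun a => ?_, fun a => ?_⟩
  · refine (φ.le_opNorm a).trans ?_
    rw [hn]
    exact mul_le_of_le_one_left (norm_nonneg _) (LinearMap.mkContinuous_norm_le _ zero_le_one _)
  · exact (hφ ⟨s a, LinearMap.mem_range_self s a⟩).trans (hψ a)

theorem groupAlgebraHom_star_mem (a : MonoidAlgebra ℂ Γ) :
    ∃ b, groupAlgebraHom σ b = star (groupAlgebraHom σ a) := by
  induction a using MonoidAlgebra.induction_linear with
  | zero => exact ⟨0, by simp⟩
  | add a b ha hb =>
    obtain ⟨a', ha⟩ := ha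
    obtain ⟨b', hb⟩ := hb
    exact ⟨a' + b', by rw [map_add, map_add, star_add, ha, hb]⟩
  | single g c =>
    refine ⟨MonoidAlgebra.single g⁻¹ (star c), ?_⟩
    rw [groupAlgebraHom_single, groupAlgebraHom_single, star_smul, map_inv]
    rfl

theorem exists_groupAlgebraHom_eq {a : A}
    (ha : a ∈ StarAlgebra.adjoin ℂ (Set.range fun g => (σ g : A))) :
    ∃ b, groupAlgebraHom σ b = a := by
  induction ha using StarAlgebra.adjoin_induction with
  | mem x hx =>
    obtain ⟨g, rfl⟩ := hx
    exact ⟨MonoidAlgebra.single g 1, by rw [groupAlgebraHom_single, one_smul]⟩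
  | algebraMap r => exact ⟨algebraMap _ _ r, AlgHom.commutes _ r⟩
  | add x y _ _ hx hy =>
    obtain ⟨a, rfl⟩ := hx
    obtain ⟨b, rfl⟩ := hy
    exact ⟨a + b, map_add _ _ _⟩
  | mul x y _ _ hx hy =>
    obtain ⟨a, rfl⟩ := hx
    obtain ⟨b, rfl⟩ := hy
    exact ⟨a * b, map_mul _ _ _⟩
  | star x _ hx =>
    obtain ⟨a, rfl⟩ := hx
    exact groupAlgebraHom_star_mem a

/-- The image of `ℂΓ` is already a star subalgebra, on which the extended functional is
multiplicative; multiplicativity passes to the closure by continuity. -/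
theorem nonempty_characterSpace_of_weaklyContains (h : WeaklyContains σ (trivialRep Γ)) :
    Nonempty (WeakDual.characterSpace ℂ (generatedCStar σ)) := by
  obtain ⟨φ, _, hφ⟩ := exists_extension_of_weaklyContains h
  have hmul : ∀ x ∈ generatedCStar σ, ∀ y ∈ generatedCStar σ, φ (x * y) = φ x * φ y := by
    intro x hx y hy
    have hc : IsClosed {p : A × A | φ (p.1 * p.2) = φ p.1 * φ p.2} :=
      isClosed_eq (φ.continuous.comp (continuous_fst.mul continuous_snd))
        ((φ.continuous.comp continuous_fst).mul (φ.continuous.comp continuous_snd))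
    have hxy : (x, y) ∈ closure
        ((StarAlgebra.adjoin ℂ (Set.range fun g => (σ g : A)) : Set A) ×ˢ
          (StarAlgebra.adjoin ℂ (Set.range fun g => (σ g : A)) : Set A)) := by
      rw [closure_prod_eq]
      exact ⟨hx, hy⟩
    refine closure_minimal ?_ hc hxy
    rintro ⟨x, y⟩ ⟨hx, hy⟩
    obtain ⟨a, rfl⟩ := exists_groupAlgebraHom_eq hx
    obtain ⟨b, rfl⟩ := exists_groupAlgebraHom_eq hy
    change φ (_ * _) = φ _ * φ _
    rw [← map_mul, hφ, hφ, hφ, map_mul]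
  let χ : WeakDual ℂ (generatedCStar σ) :=
    (φ.comp (generatedCStar σ).toSubalgebra.toSubmodule.subtypeL : generatedCStar σ →L[ℂ] ℂ)
  refine ⟨⟨χ, ?_, ?_⟩⟩
  · intro h0
    have h1 : χ 1 = 1 :=
      (congrArg φ (map_one (groupAlgebraHom σ)).symm).trans ((hφ 1).trans (map_one _))
    rw [h0] at h1
    exact zero_ne_one h1
  · intro x y
    exact hmul _ x.2 _ y.2

end Extension

end TopologicalGroupoid

/-! ### Sums over range and source fibres; boundedness of positive functionals -/

namespace TopologicalGroupoid

variable {G : Type u} [TopologicalSpace G] [TopologicalGroupoid G] [IsAmple G]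
  [CompactSpace (units G)]

set_option linter.unusedSectionVars false

/-- Convolution with the constant `1` sums `f` over range fibres. The constant need not be compactly
supported, so this is not a product in `ConvAlg G`. -/
theorem ConvAlg.continuous_conv_one (f : ConvAlg G) : Continuous (conv f fun _ => (1 : ℂ)) := by
  induction f using ConvAlg.induction with
  | zero =>
    have : conv (0 : ConvAlg G) (fun _ => (1 : ℂ)) = fun _ => 0 := by
      funext γ
      simp [conv]
    rw [this]
    exact continuous_const
  | add f₁ f₂ h₁ h₂ =>
    rw [ConvAlg.coe_add, conv_add_left _ f₁.hasCompactSupport f₂.hasCompactSupport]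
    exact h₁.add h₂
  | bisection U hU f hf => exact conv_continuous_of_bisection hU hf f.continuous continuous_const

variable (G) in
/-- The sum of the values of a function in `C_c(G)` over the arrows with a given range. -/
noncomputable def rngSum : ConvAlg G →ₗ[ℂ] C(units G, ℂ) where
  toFun f := ⟨fun x => conv f (fun _ => (1 : ℂ)) x,
    f.continuous_conv_one.comp continuous_subtype_val⟩
  map_add' f g := by
    ext x
    exact congrFun (conv_add_left (fun _ => (1 : ℂ)) f.hasCompactSupport g.hasCompactSupport) (x : G)
  map_smul' c f := by
    ext x
    exact congrFun (conv_smul_left c f fun _ => (1 : ℂ)) (x : G)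

theorem rngSum_apply (f : ConvAlg G) (x : units G) :
    rngSum G f x = conv f (fun _ => (1 : ℂ)) x := rfl

variable (G) in
/-- The sum of the values of a function in `C_c(G)` over the arrows with a given source. -/
noncomputable def srcSum : ConvAlg G →ₗ[ℂ] C(units G, ℂ) where
  toFun f := star (rngSum G (star f))
  map_add' f g := by rw [star_add, map_add, star_add]
  map_smul' c f := by rw [star_smul, map_smul, star_smul, star_star]; rfl

theorem srcSum_star (f : ConvAlg G) : srcSum G (star f) = star (rngSum G f) := by
  change star (rngSum G (star (star f))) = _
  rw [star_star]

theorem rngSum_star (f : ConvAlg G) : rngSum G (star f) = star (srcSum G f) :=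
  (star_star _).symm

theorem extend_star (k : C(units G, ℂ)) : extend (star k) = star (extend k) :=
  map_star (extendHom G) k

theorem extend_mul (k l : C(units G, ℂ)) : extend (k * l) = extend k * extend l :=
  map_mul (extendHom G) k l

theorem extend_injective : Function.Injective (extend : C(units G, ℂ) → ConvAlg G) := by
  intro k l h
  ext x
  have := congrArg (fun f : ConvAlg G => f x) h
  simpa only [extend_apply_of_mem _ x.2] using this

theorem extend_one : extend (1 : C(units G, ℂ)) = 1 := by
  refine ConvAlg.ext fun γ => ?_
  by_cases h : γ ∈ units G
  · rw [extend_apply_of_mem _ h, ConvAlg.one_apply, Set.indicator_of_mem h]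
    rfl
  · rw [extend_apply_of_notMem _ h, ConvAlg.one_apply, Set.indicator_of_notMem h]

theorem star_apply_eq_zero {W : Bisection G} {f : ConvAlg G}
    (hf : ∀ x, x ∉ W.carrier → f x = 0) : ∀ x, x ∉ (W⁻¹).carrier → star f x = 0 := by
  intro x hx
  rw [ConvAlg.star_apply, hf _ hx, map_zero]

/-- A range fibre meets `W` in at most one arrow, so the sum has at most one nonzero term and
becomes a product in `C_c(G)`. Identities between fibre sums thereby reduce to algebra. -/
theorem extend_rngSum {W : Bisection G} {f : ConvAlg G} (hf : ∀ x, x ∉ W.carrier → f x = 0) :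
    extend (rngSum G f) = f * star W.ind := by
  refine ConvAlg.ext fun γ => ?_
  by_cases hγ : γ ∈ units G
  · rw [extend_apply_of_mem _ hγ, rngSum_apply, conv_of_bisection W.isBisection.injOn_rng hf,
      ConvAlg.mul_apply_of_bisection W.isBisection hf]
    by_cases h : sec W.carrier γ ∈ W.carrier
    · congr 1
      have hs : src γ = γ := mem_units_iff.1 hγ
      have hr : rng (sec W.carrier γ) = γ := rng_sec.trans (rng_eq_of_src_eq hs)
      have e : ((sec W.carrier γ)⁻¹ * γ) = (sec W.carrier γ)⁻¹ := by
        nth_rw 2 [← hr]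
        rw [← src_inv, mul_src]
      rw [ConvAlg.star_apply, e, inv_inv, Bisection.ind_of_mem h, map_one]
    · rw [hf _ h, zero_mul, zero_mul]
  · rw [extend_apply_of_notMem _ hγ]
    have h := star_ind_mul_apply_of_notMem_units (W := W⁻¹) (star_apply_eq_zero hf) (γ := γ⁻¹)
      (fun h => hγ (by
        have e := inv_src γ⁻¹
        rw [mem_units_iff.1 h, inv_inv] at e
        rwa [e]))
    rw [Bisection.ind_inv, ← star_mul, ConvAlg.star_apply, inv_inv, map_eq_zero] at h
    exact h.symm

theorem extend_srcSum {W : Bisection G} {f : ConvAlg G} (hf : ∀ x, x ∉ W.carrier → f x = 0) :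
    extend (srcSum G f) = star W.ind * f := by
  change extend (star (rngSum G (star f))) = _
  rw [extend_star, extend_rngSum (star_apply_eq_zero hf), star_mul, star_star, star_star,
    Bisection.ind_inv]

theorem mul_apply_eq_zero {W V : Bisection G} {f g : ConvAlg G}
    (hf : ∀ x, x ∉ W.carrier → f x = 0) (hg : ∀ x, x ∉ V.carrier → g x = 0) :
    ∀ x, x ∉ (W * V).carrier → (f * g) x = 0 := by
  intro x hx
  rw [ConvAlg.mul_apply_of_bisection W.isBisection hf]
  by_cases h1 : sec W.carrier x ∈ W.carrier
  · rw [hg, mul_zero]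
    intro h2
    have hr : rng (sec W.carrier x) = rng x := rng_sec
    exact hx (Bisection.mem_mul.2 ⟨_, h1, _, h2,
      by rw [rng_mul _ _ (by rw [src_inv, hr]), rng_inv], mul_inv_cancel_left _ _ hr⟩)
  · rw [hf _ h1, zero_mul]

theorem mul_extend_apply_eq_zero {W : Bisection G} {f : ConvAlg G}
    (hf : ∀ x, x ∉ W.carrier → f x = 0) (k : C(units G, ℂ)) :
    ∀ x, x ∉ W.carrier → (f * extend k) x = 0 := by
  intro x hx
  rw [ConvAlg.mul_apply_of_units_right fun x hx => extend_apply_of_notMem _ hx, hf x hx, zero_mul]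

theorem extend_mul_apply_eq_zero {W : Bisection G} {f : ConvAlg G}
    (hf : ∀ x, x ∉ W.carrier → f x = 0) (k : C(units G, ℂ)) :
    ∀ x, x ∉ W.carrier → (extend k * f) x = 0 := by
  intro x hx
  rw [ConvAlg.mul_apply_of_units fun x hx => extend_apply_of_notMem _ hx, hf x hx, mul_zero]

/-- `C_c(G)` acts on functions on the unit space, and `rngSum` is the orbit map of the constant `1`:
this is associativity of the action. On bisections both sides are `f g 1_V* 1_U*`. -/
theorem rngSum_mul (f g : ConvAlg G) : rngSum G (f * g) = rngSum G (f * extend (rngSum G g)) := by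
  have hadd : ∀ k l : C(units G, ℂ), extend (k + l) = extend k + extend l := map_add (extendHom G)
  have hzero : extend (0 : C(units G, ℂ)) = 0 := map_zero (extendHom G)
  induction f using ConvAlg.induction with
  | zero => rw [zero_mul, zero_mul]
  | add f₁ f₂ h₁ h₂ => rw [add_mul, add_mul, map_add, map_add, h₁, h₂]
  | bisection U hU f hf =>
    induction g using ConvAlg.induction with
    | zero => rw [mul_zero, map_zero, hzero, mul_zero, map_zero]
    | add g₁ g₂ h₁ h₂ => rw [mul_add, map_add, map_add, hadd, mul_add, map_add, h₁, h₂]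
    | bisection V hV g hg =>
      let W₁ : Bisection G := ⟨U, hU⟩
      let W₂ : Bisection G := ⟨V, hV⟩
      apply extend_injective
      rw [extend_rngSum (mul_apply_eq_zero (W := W₁) (V := W₂) hf hg),
        extend_rngSum (W := W₁) (mul_extend_apply_eq_zero hf _), extend_rngSum (W := W₂) hg,
        Bisection.ind_mul, star_mul]
      noncomm_ring

theorem rngSum_extend_mul (k : C(units G, ℂ)) (g : ConvAlg G) :
    rngSum G (extend k * g) = k * rngSum G g := by
  induction g using ConvAlg.induction with
  | zero => rw [mul_zero, map_zero, mul_zero]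
  | add g₁ g₂ h₁ h₂ => rw [mul_add, map_add, map_add, mul_add, h₁, h₂]
  | bisection V hV g hg =>
    let W : Bisection G := ⟨V, hV⟩
    apply extend_injective
    rw [extend_rngSum (W := W) (extend_mul_apply_eq_zero hg _), extend_mul,
      extend_rngSum (W := W) hg, _root_.mul_assoc]

theorem srcSum_mul (f g : ConvAlg G) :
    srcSum G (f * g) = srcSum G (extend (srcSum G f) * g) := by
  have h := rngSum_mul (star g) (star f)
  rw [← star_mul, rngSum_star, rngSum_star, extend_star, ← star_mul, rngSum_star] at h
  exact star_injective h

/-- The function `γ ↦ f(γ) g(γ⁻¹)`. -/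
noncomputable def mulInv (f g : ConvAlg G) : ConvAlg G :=
  ConvAlg.mk (fun γ => f γ * g γ⁻¹) (f.continuous.mul (g.continuous.comp continuous_inv))
    (f.hasCompactSupport.mul_right)

/-- At a unit, the factorisations in the convolution are the pairs `(α, α⁻¹)`. Together with
`srcSum_mulInv` this turns equality of range and source sums under a functional into the trace
identity. -/
theorem rngSum_mulInv (f g : ConvAlg G) : rngSum G (mulInv f g) = restrictUnits (f * g) := by
  classical
  ext x
  rw [rngSum_apply, restrictUnits_apply, ConvAlg.mul_apply, conv_eq, conv_eq]
  refine finsum_congr fun α => ?_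
  rw [finsum_eq_if, finsum_eq_if]
  split_ifs with h
  · have hx : rng α = x := h.trans (rng_eq_of_src_eq (mem_units_iff.1 x.2))
    have e : α⁻¹ * x = α⁻¹ := by rw [← hx, ← src_inv, mul_src]
    rw [e, mul_one]
    rfl
  · rfl

theorem srcSum_mulInv (f g : ConvAlg G) : srcSum G (mulInv f g) = restrictUnits (g * f) := by
  have e : star (mulInv f g) = mulInv (star f) (star g) := by
    refine ConvAlg.ext fun γ => ?_
    change starRingEnd ℂ (f γ⁻¹ * g (γ⁻¹)⁻¹) = starRingEnd ℂ (f γ⁻¹) * starRingEnd ℂ (g (γ⁻¹)⁻¹)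
    rw [map_mul]
  change star (rngSum G (star (mulInv f g))) = _
  rw [e, rngSum_mulInv, ← star_mul]
  ext x
  have hx : (x : G)⁻¹ = x := by
    have := inv_src (x : G)
    rwa [mem_units_iff.1 x.2] at this
  change starRingEnd ℂ (starRingEnd ℂ ((g * f) (x : G)⁻¹)) = (g * f) x
  rw [hx, Complex.conj_conj]

open scoped ComplexOrder

theorem restrictUnits_star_mul_self_nonneg (f : ConvAlg G) (x : units G) :
    0 ≤ restrictUnits (star f * f) x := by
  rw [← rngSum_mulInv, rngSum_apply, conv_eq]
  refine finsum_nonneg fun α => finsum_nonneg fun _ => ?_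
  rw [mul_one]
  change 0 ≤ starRingEnd ℂ (f α⁻¹) * f α⁻¹
  rw [mul_comm, Complex.mul_conj]
  exact_mod_cast Complex.normSq_nonneg _

theorem exists_eq_star_mul_self {X : Type*} [TopologicalSpace X] (k : C(X, ℂ))
    (h : ∀ x, 0 ≤ k x) : ∃ l : C(X, ℂ), k = star l * l := by
  refine ⟨⟨fun x => (Real.sqrt (k x).re : ℂ), by fun_prop⟩, ?_⟩
  ext x
  have h1 := Complex.nonneg_iff.1 (h x)
  change k x = starRingEnd ℂ (Real.sqrt (k x).re : ℂ) * (Real.sqrt (k x).re : ℂ)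
  rw [Complex.conj_ofReal, ← Complex.ofReal_mul, Real.mul_self_sqrt h1.1]
  exact Complex.ext rfl h1.2.symm

/-- For `f` supported on a bisection, `f*f` is a function `k` on the unit space and `‖k‖ - k = l*l`.
Positivity of `φ` at `(l g)*(l g)` reads `‖f g‖² ≤ ‖k‖ ‖g‖²` in the seminorm of `φ`. -/
theorem isLeftBounded (φ : PositiveFunctional (ConvAlg G)) (f : ConvAlg G) :
    φ.IsLeftBounded f := by
  induction f using ConvAlg.induction with
  | zero => exact ⟨0, fun g => by rw [zero_mul, map_zero, norm_zero, zero_mul]⟩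
  | add f₁ f₂ h₁ h₂ =>
    obtain ⟨C₁, h₁⟩ := h₁
    obtain ⟨C₂, h₂⟩ := h₂
    refine ⟨C₁ + C₂, fun g => ?_⟩
    rw [add_mul, map_add, add_mul]
    exact (norm_add_le _ _).trans (add_le_add (h₁ g) (h₂ g))
  | bisection U hU f hf =>
    obtain ⟨k, hk⟩ := exists_star_mul_self_eq hU hf
    have hk' : star f * f = extend k := hk
    have hstar : star k = k := extend_injective (by
      rw [extend_star, ← hk', star_mul, star_star])
    obtain ⟨l, hl⟩ := exists_eq_star_mul_self ((‖k‖ : ℂ) • (1 : C(units G, ℂ)) - k) (by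
      intro x
      have hx : (k x).im = 0 := Complex.conj_eq_iff_im.1 (congrArg (fun k => k x) hstar)
      have hn := (Complex.re_le_norm _).trans (k.norm_coe_le_norm x)
      rw [Complex.nonneg_iff]
      simp [hx, hn])
    refine ⟨Real.sqrt ‖k‖, fun g => ?_⟩
    rw [← sq_le_sq₀ (norm_nonneg _) (by positivity), mul_pow, Real.sq_sqrt (norm_nonneg _),
      φ.norm_toPreGNS_sq, φ.norm_toPreGNS_sq]
    have h1 := (Complex.nonneg_iff.1 (φ.star_mul_self_nonneg (extend l * g))).1
    have e : star (extend l * g) * (extend l * g) =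
        (‖k‖ : ℂ) • (star g * g) - star (f * g) * (f * g) := by
      have h2 : star (extend l) * extend l = (‖k‖ : ℂ) • 1 - star f * f := by
        rw [← extend_star, ← extend_mul, ← hl, hk', ← extend_one]
        exact (map_sub (extendHom G) _ _).trans (congrArg (· - _) (map_smul (extendHom G) _ _))
      rw [star_mul, star_mul, _root_.mul_assoc, ← _root_.mul_assoc _ (extend l), h2, sub_mul,
        smul_mul_assoc, one_mul, mul_sub, mul_smul_comm]
      noncomm_ring
    rw [e, map_sub, map_smul, smul_eq_mul, Complex.sub_re, Complex.re_ofReal_mul] at h1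
    linarith

/-- Positive functionals on `C_c(G)` which map `1` to `1` are contractive for the full norm. -/
theorem norm_apply_le (φ : PositiveFunctional (ConvAlg G)) (h1 : φ.toLinearMap 1 = 1)
    (f : ConvAlg G) : ‖φ.toLinearMap f‖ ≤ ‖f‖ :=
  (φ.norm_apply_le_norm_gns (isLeftBounded φ) h1 f).trans
    (norm_le_fullNorm ⟨UniformSpace.Completion φ.PreGNS, φ.gns (isLeftBounded φ)⟩ f)

end TopologicalGroupoid

/-! ### Invariant measures, tracial states and states trivial on `[[G]]` -/

namespace TopologicalGroupoid

variable {G : Type u} [TopologicalSpace G] [TopologicalGroupoid G] [IsAmple G]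
  [CompactSpace (units G)]

set_option linter.unusedSectionVars false

open TopFullGroup
open scoped ComplexOrder

theorem srcSum_ind_of_src_image {W : Bisection G} (h : src '' W.carrier = units G) :
    srcSum G W.ind = 1 := by
  apply extend_injective
  rw [extend_srcSum (fun x hx => Bisection.ind_of_notMem hx), extend_one, ← Bisection.ind_inv,
    ← Bisection.ind_mul, ← Bisection.ind_one]
  congr 1
  refine Bisection.ext (Set.ext fun γ => ?_)
  rw [Bisection.mem_inv_mul_self, h, Bisection.carrier_one]

/-- By linearity `φ` computes the coefficient sum on `ℂ[[G]]`, and `norm_apply_le` bounds it by the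
full norm. -/
theorem weaklyContains_of_positiveFunctional (φ : PositiveFunctional (ConvAlg G))
    (h : ∀ U : TopFullGroup G, φ.toLinearMap U.ind = 1) :
    WeaklyContains (canonicalRep G) (trivialRep (TopFullGroup G)) := by
  intro a
  have key : ∃ f, FullCStar.of G f = groupAlgebraHom (canonicalRep G) a ∧
      φ.toLinearMap f = groupAlgebraHom (trivialRep (TopFullGroup G)) a := by
    induction a using MonoidAlgebra.induction_linear with
    | zero => exact ⟨0, by simp, by simp⟩
    | add a b ha hb =>
      obtain ⟨f, h1, h2⟩ := ha
      obtain ⟨g, h3, h4⟩ := hb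
      exact ⟨f + g, by rw [map_add, map_add, h1, h3], by rw [map_add, map_add, h2, h4]⟩
    | single U c =>
      refine ⟨c • U.ind, ?_, ?_⟩
      · rw [groupAlgebraHom_single, map_smul]
        rfl
      · rw [groupAlgebraHom_trivialRep_single, map_smul, h, smul_eq_mul, mul_one]
  obtain ⟨f, h1, h2⟩ := key
  rw [← h1, ← h2]
  exact (norm_apply_le φ (by rw [← ind_one]; exact h 1) f).trans_eq
    (FullCStar.norm_ofAlgHom f).symm

/-- A tracial state on `C*(G)` restricts to an invariant measure on the unit space, which defines a
state on `C*(G)` that is trivial on `[[G]]`. -/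
theorem weaklyContains_of_isTracialState {τ : FullCStar G →ₗ[ℂ] ℂ} (hτ : IsTracialState τ) :
    WeaklyContains (canonicalRep G) (trivialRep (TopFullGroup G)) := by
  let μ : C(units G, ℂ) →ₗ[ℂ] ℂ := τ ∘ₗ (unitsHom G : C(units G, ℂ) →ₗ[ℂ] FullCStar G)
  have hμ : ∀ k, μ k = τ (FullCStar.of G (extend k)) := fun k => rfl
  -- Invariance of the measure: on a bisection the two sides are `τ(f w*)` and `τ(w* f)`.
  have hinv : ∀ f, μ (rngSum G f) = μ (srcSum G f) := by
    intro f
    induction f using ConvAlg.induction with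
    | zero => rw [map_zero (rngSum G), map_zero (srcSum G)]
    | add f g hf hg => rw [map_add, map_add, map_add, map_add, hf, hg]
    | bisection U hU f hf =>
      rw [hμ, hμ, extend_rngSum (W := ⟨U, hU⟩) hf, extend_srcSum (W := ⟨U, hU⟩) hf,
        map_mul (FullCStar.of G), map_mul (FullCStar.of G), hτ.trace]
  -- Invariance gives `φ(f*f) = μ(|rngSum f|²)`, which is nonnegative because `τ` is positive.
  let φ : PositiveFunctional (ConvAlg G) :=
    { toLinearMap := μ ∘ₗ srcSum G
      star_mul_self_nonneg := fun f => by
        rw [LinearMap.comp_apply, srcSum_mul, ← hinv, rngSum_extend_mul, srcSum_star, hμ,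
          extend_mul, extend_star, map_mul, map_star]
        exact hτ.nonneg _ }
  refine weaklyContains_of_positiveFunctional φ fun U => ?_
  change μ (srcSum G U.toBisection.ind) = 1
  rw [srcSum_ind_of_src_image U.src_image, hμ, extend_one, map_one, hτ.map_one]

section TrivialState

variable {φ : PositiveFunctional (ConvAlg G)}

/-- `φ` vanishes on `1 - swap = (v - v*v)(v - v*v)*`, so by Cauchy–Schwarz it vanishes on `(v - v*v)
a` for every `a`. -/
theorem apply_ind_mul_of_disjoint (hφ : ∀ U : TopFullGroup G, φ.toLinearMap U.ind = 1)
    {V : Bisection G} (h : Disjoint (rng '' V.carrier) (src '' V.carrier)) (a : ConvAlg G) :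
    φ.toLinearMap (V.ind * a) = φ.toLinearMap (star V.ind * V.ind * a) := by
  have hv : V.ind * (star V.ind * V.ind) = V.ind :=
    ind_mul_star_ind_mul fun x hx => Bisection.ind_of_notMem hx
  have hv' : star V.ind * V.ind * star V.ind = star V.ind := by
    have := congrArg star hv
    rwa [star_mul, star_mul, star_star] at this
  have e : 1 - (V.swap h).ind =
      (V.ind - star V.ind * V.ind) * star (V.ind - star V.ind * V.ind) := by
    rw [Bisection.one_sub_ind_swap, star_sub, star_mul, star_star, sub_mul, mul_sub, mul_sub, hv,
      hv', _root_.mul_assoc (star V.ind) V.ind (star V.ind * V.ind), hv]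
    abel
  have h1 : φ.toLinearMap
      ((V.ind - star V.ind * V.ind) * star (V.ind - star V.ind * V.ind)) = 0 := by
    rw [← e, map_sub, hφ, ← TopFullGroup.ind_one, hφ, sub_self]
  have h2 := φ.apply_mul_eq_zero h1 a
  rwa [sub_mul, map_sub, sub_eq_zero] at h2

theorem exists_bisection_disjoint {γ : G} (h : rng γ ≠ src γ) :
    ∃ V : Bisection G, γ ∈ V.carrier ∧ Disjoint (rng '' V.carrier) (src '' V.carrier) := by
  obtain ⟨N, M, hN, hM, hrN, hsM, hd⟩ := t2_separation h
  obtain ⟨V, hV, hγ, hVO⟩ := exists_isCompactOpenBisection_subset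
    ((hN.preimage continuous_rng).inter (hM.preimage continuous_src)) ⟨hrN, hsM⟩
  refine ⟨⟨V, hV⟩, hγ, hd.mono ?_ ?_⟩
  · rintro _ ⟨g, hg, rfl⟩
    exact (hVO hg).1
  · rintro _ ⟨g, hg, rfl⟩
    exact (hVO hg).2

/-- Swaps are available only near arrows with distinct source and range. An isotropy arrow `γ` is
written as `(γ ζ⁻¹) ζ`, a detour through another point of the orbit, and the identity is proved for
the product of bisections around the two factors. -/
theorem exists_bisection_apply_ind_mul (horbit : ∀ x : units G, 3 ≤ (orbit x).encard)
    (hφ : ∀ U : TopFullGroup G, φ.toLinearMap U.ind = 1) (γ : G) :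
    ∃ W : Bisection G, γ ∈ W.carrier ∧ ∀ a : ConvAlg G,
      φ.toLinearMap (W.ind * a) = φ.toLinearMap (star W.ind * W.ind * a) := by
  by_cases hγ : rng γ = src γ
  swap
  · obtain ⟨V, hV, hd⟩ := exists_bisection_disjoint hγ
    exact ⟨V, hV, apply_ind_mul_of_disjoint hφ hd⟩
  obtain ⟨_, z, ⟨ζ, _, hζs, hζr⟩, hz, _⟩ :=
    exists_maps_of_three_le horbit (src_mem γ) (src γ) (src γ)
  have hc : src γ = rng ζ⁻¹ := by rw [rng_inv, hζs]
  obtain ⟨Z, hZ, hZd⟩ := exists_bisection_disjoint (γ := ζ) (by rw [hζr, hζs]; exact hz)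
  obtain ⟨Y, hY, hYd⟩ := exists_bisection_disjoint (γ := γ * ζ⁻¹) (by
    rw [rng_mul _ _ hc, src_mul _ _ hc, src_inv, hζr, hγ]; exact hz.symm)
  have hγYZ : γ * ζ⁻¹ * ζ = γ := by
    rw [TopologicalGroupoid.mul_assoc _ _ _ hc (src_inv ζ), TopologicalGroupoid.inv_mul, hζs,
      mul_src]
  refine ⟨Y * Z, ⟨_, hY, ζ, hZ, by rw [src_mul _ _ hc, src_inv], hγYZ⟩, fun a => ?_⟩
  -- `φ(y z a) = φ(y*y z a)` by the identity for `Y`. The factor `y*y z` again belongs to a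
  -- bisection inside `Z`, to which the identity is applied a second time.
  have hsub : (Y⁻¹ * Y * Z).carrier ⊆ Z.carrier := by
    rintro _ ⟨g, hg, k, hk, hc, rfl⟩
    obtain ⟨y, _, rfl⟩ := Bisection.mem_inv_mul_self.1 hg
    rw [src_src] at hc
    rwa [hc, rng_mul_self]
  have hd : Disjoint (rng '' (Y⁻¹ * Y * Z).carrier) (src '' (Y⁻¹ * Y * Z).carrier) :=
    hZd.mono (Set.image_mono hsub) (Set.image_mono hsub)
  have h1 := apply_ind_mul_of_disjoint hφ hYd (Z.ind * a)
  have h2 := apply_ind_mul_of_disjoint hφ hd a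
  rw [Bisection.ind_mul, Bisection.ind_mul, Bisection.ind_inv] at h2
  have hv : Y.ind * (star Y.ind * Y.ind) = Y.ind :=
    ind_mul_star_ind_mul fun x hx => Bisection.ind_of_notMem hx
  rw [Bisection.ind_mul, _root_.mul_assoc, h1, ← _root_.mul_assoc, h2]
  congr 1
  have e : star (star Y.ind * Y.ind * Z.ind) * (star Y.ind * Y.ind * Z.ind) * a =
      star Z.ind * star Y.ind * (Y.ind * (star Y.ind * Y.ind)) * Z.ind * a := by
    rw [star_mul, star_mul, star_star]
    noncomm_ring
  rw [e, hv, star_mul]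
  noncomm_ring

/-- For `f` supported close to `γ`, the source sum is `w* f` and `w w* f = f`. The identity `φ(w a)
= φ(w*w a)` with `a = w* f` reads `φ(f) = φ(w* f)`. -/
theorem apply_eq_apply_srcSum (horbit : ∀ x : units G, 3 ≤ (orbit x).encard)
    (hφ : ∀ U : TopFullGroup G, φ.toLinearMap U.ind = 1) (f : ConvAlg G) :
    φ.toLinearMap (extend (srcSum G f)) = φ.toLinearMap f := by
  have hadd : ∀ k l : C(units G, ℂ), extend (k + l) = extend k + extend l := map_add (extendHom G)
  have hzero : extend (0 : C(units G, ℂ)) = 0 := map_zero (extendHom G)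
  induction f using ConvAlg.local_induction with
  | zero => rw [map_zero, hzero]
  | add f g hf hg => rw [map_add, hadd, map_add, map_add, hf, hg]
  | nhds γ =>
    obtain ⟨W, hγ, hW⟩ := exists_bisection_apply_ind_mul horbit hφ γ
    refine ⟨W.carrier, W.isBisection.isOpen, hγ, fun V hVW _ f hf => ?_⟩
    have hf' : ∀ x, x ∉ W.carrier → f x = 0 := fun x hx => hf x fun h => hx (hVW h)
    have h1 := hW (extend (srcSum G f))
    rw [_root_.mul_assoc, extend_srcSum hf', ind_mul_star_ind_mul hf'] at h1
    rw [extend_srcSum hf', h1]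

theorem apply_extend_rngSum (horbit : ∀ x : units G, 3 ≤ (orbit x).encard)
    (hφ : ∀ U : TopFullGroup G, φ.toLinearMap U.ind = 1) (f : ConvAlg G) :
    φ.toLinearMap (extend (rngSum G f)) = φ.toLinearMap f := by
  have h := apply_eq_apply_srcSum horbit hφ (star f)
  rw [srcSum_star, extend_star, φ.map_star, φ.map_star] at h
  exact (starRingEnd ℂ).injective h

end TrivialState

/-- A trace on `C_c(G)` extends to a tracial state on `C*(G)`. -/
theorem exists_isTracialState_of_positiveFunctional (φ : PositiveFunctional (ConvAlg G))
    (h1 : φ.toLinearMap 1 = 1)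
    (htrace : ∀ f g, φ.toLinearMap (f * g) = φ.toLinearMap (g * f)) :
    ∃ τ : FullCStar G →ₗ[ℂ] ℂ, IsTracialState τ := by
  let e : ConvAlg G →L[ℂ] FullCStar G :=
    ⟨(FullCStar.ofAlgHom G).toLinearMap, FullCStar.isometry_ofAlgHom.continuous⟩
  let ψ : ConvAlg G →L[ℂ] ℂ := φ.toLinearMap.mkContinuous 1 fun f => by
    rw [one_mul]
    exact norm_apply_le φ h1 f
  let τ : FullCStar G →L[ℂ] ℂ := ψ.extend e
  have hτ : ∀ f, τ (FullCStar.of G f) = φ.toLinearMap f := fun f =>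
    ψ.extend_eq (e := e) FullCStar.denseRange_ofAlgHom
      FullCStar.isometry_ofAlgHom.isUniformInducing f
  refine ⟨τ, ⟨fun a => ?_, ?_, fun a b => ?_⟩⟩
  · change 0 ≤ τ (star a * a)
    refine FullCStar.denseRange_of.induction_on (p := fun a => 0 ≤ τ (star a * a)) a
      (isClosed_le continuous_const
        (τ.continuous.comp (FullCStar.continuous_star.mul continuous_id))) fun f => ?_
    rw [← map_star, ← map_mul, hτ]
    exact φ.star_mul_self_nonneg f
  · change τ 1 = 1
    rw [← map_one (FullCStar.of G), hτ, h1]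
  · change τ (a * b) = τ (b * a)
    refine FullCStar.denseRange_of.induction_on₂ (p := fun a b => τ (a * b) = τ (b * a))
      (isClosed_eq (τ.continuous.comp (continuous_fst.mul continuous_snd))
        (τ.continuous.comp (continuous_snd.mul continuous_fst))) (fun f g => ?_) a b
    rw [← map_mul, ← map_mul, hτ, hτ, htrace]

/-- If `π` weakly contains the trivial representation, then the unit space has an invariant
measure, and hence `C*(G)` has a tracial state. -/
theorem exists_isTracialState_of_weaklyContains (horbit : ∀ x : units G, 3 ≤ (orbit x).encard)
    (h : WeaklyContains (canonicalRep G) (trivialRep (TopFullGroup G))) :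
    ∃ τ : FullCStar G →ₗ[ℂ] ℂ, IsTracialState τ := by
  obtain ⟨ψ, hn, hψ⟩ := exists_extension_of_weaklyContains h
  have hU : ∀ U : TopFullGroup G, ψ (FullCStar.of G U.ind) = 1 := by
    intro U
    have := hψ (MonoidAlgebra.single U 1)
    rwa [groupAlgebraHom_trivialRep_single, groupAlgebraHom_single, one_smul] at this
  have hψ1 : ψ 1 = 1 := by rw [← map_one (FullCStar.of G), ← TopFullGroup.ind_one, hU]
  let φ : PositiveFunctional (ConvAlg G) :=
    { toLinearMap := (ψ : FullCStar G →ₗ[ℂ] ℂ) ∘ₗ (FullCStar.ofAlgHom G).toLinearMap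
      star_mul_self_nonneg := fun f => by
        change 0 ≤ ψ (FullCStar.of G (star f * f))
        rw [map_mul, map_star]
        exact star_mul_self_nonneg_of_norm_le (ψ : FullCStar G →ₗ[ℂ] ℂ) hn hψ1 _ }
  have hφ : ∀ U : TopFullGroup G, φ.toLinearMap U.ind = 1 := hU
  let r : ConvAlg G →ₗ[ℂ] C(units G, ℂ) :=
    { toFun := restrictUnits
      map_add' := fun f g => rfl
      map_smul' := fun c f => rfl }
  -- The candidate trace is `φ` composed with the restriction to the unit space. It is positive
  -- because `f*f` restricts to a pointwise nonnegative function, of the form `l*l` in `C(G⁰)`.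
  let t : PositiveFunctional (ConvAlg G) :=
    { toLinearMap := φ.toLinearMap ∘ₗ (extendHom G : C(units G, ℂ) →ₗ[ℂ] ConvAlg G) ∘ₗ r
      star_mul_self_nonneg := fun f => by
        obtain ⟨l, hl⟩ := exists_eq_star_mul_self _ (restrictUnits_star_mul_self_nonneg f)
        change 0 ≤ φ.toLinearMap (extend (restrictUnits (star f * f)))
        rw [hl, extend_mul, extend_star]
        exact φ.star_mul_self_nonneg _ }
  have ht : ∀ f, t.toLinearMap f = φ.toLinearMap (extend (restrictUnits f)) := fun f => rfl
  refine exists_isTracialState_of_positiveFunctional t ?_ fun f g => ?_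
  · rw [ht, extend_restrictUnits, ← TopFullGroup.ind_one, hφ]
    exact fun x hx => by rw [ConvAlg.one_apply, Set.indicator_of_notMem hx]
  -- The restrictions of `f g` and `g f` are the range sum and the source sum of the same function
  -- `mulInv f g`, and `φ` takes the same value on both.
  · rw [ht, ht, ← rngSum_mulInv, ← srcSum_mulInv, apply_extend_rngSum horbit hφ,
      apply_eq_apply_srcSum horbit hφ]

end TopologicalGroupoid

/-! ### The equivalence -/

theorem theorem4p4 {G : Type u} [TopologicalSpace G] [TopologicalGroupoid G]
    [TopologicalGroupoid.IsAmple G] [CompactSpace (TopologicalGroupoid.units G)]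
    (horbit : ∀ x : TopologicalGroupoid.units G, 3 ≤ (TopologicalGroupoid.orbit x).encard) :
    List.TFAE [
      ¬ ∃ τ : TopologicalGroupoid.FullCStar G →ₗ[ℂ] ℂ, IsTracialState τ,
      IsEmpty (WeakDual.characterSpace ℂ
        (generatedCStar (TopologicalGroupoid.TopFullGroup.canonicalRep G))),
      ¬ WeaklyContains (TopologicalGroupoid.TopFullGroup.canonicalRep G)
        (trivialRep (TopologicalGroupoid.TopFullGroup G)),
      generatedCStar (TopologicalGroupoid.TopFullGroup.canonicalRep G) = ⊤] := by
  tfae_have 1 → 3 := fun h hw =>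
    h (TopologicalGroupoid.exists_isTracialState_of_weaklyContains horbit hw)
  tfae_have 3 → 1 := fun h ⟨_, hτ⟩ =>
    h (TopologicalGroupoid.weaklyContains_of_isTracialState hτ)
  tfae_have 3 → 4 := TopologicalGroupoid.generatedCStar_eq_top horbit
  tfae_have 4 → 2 := TopologicalGroupoid.isEmpty_characterSpace_of_eq_top horbit
  tfae_have 2 → 3 := fun h hw =>
    (TopologicalGroupoid.nonempty_characterSpace_of_weaklyContains hw).elim h.false
  tfae_finish
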